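/- For $\xi\in\mathbb R^3$ let $\langle \xi\rangle=\sqrt{1+|\xi|^2}$, $p(\xi)=|\xi|\sqrt{\frac{2+|\xi|^2}{1+|\xi|^2}}$, and for $\xi,\eta\in\mathbb R^3$ let $\Phi_1(\xi,\eta)=p(\xi)-p(\xi-\eta)-p(\eta)$ and $$\mathfrak M_1(\xi,\eta)=\frac{|\xi|\,|\xi-\eta|\,|\eta|}{\Phi_1(\xi,\eta)\,\langle\xi-\eta\rangle^{2\lambda}\langle\eta\rangle^{2\lambda}} .$$ Let $\|g\|_{\dot H^s}=\||\nabla|^s g\|_{L^2(\mathbb R^3)}$ denote the homogeneous Sobolev norm ($0\le s<3/2$), let $\|\mathfrak m\|_{L^\infty_\eta(\dot H^s_\xi)}=\operatorname{ess\,sup}_\eta\|\mathfrak m(\cdot,\eta)\|_{\dot H^s}$, and define $L^\infty_\xi(\dot H^s_\eta)$ symmetrically. (a) Let $\lambda>\frac98$ and let $\varepsilon>0$ be small, namely $\varepsilon\le\frac54$ and $\varepsilon<2\lambda-\frac94$. Then there is a constant $C=C(\lambda,\varepsilon)$ with $$\|\mathfrak M_1\|_{L^\infty_\eta(\dot H_\xi^{5/4-\varepsilon})}+\|\mathfrak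 M_1\|_{L^\infty_\xi(\dot H_\eta^{5/4-\varepsilon})}\le C .$$ (b) Let $\lambda>1$ and let $\varepsilon>0$ be small, namely $\varepsilon\le\frac32$ and $\varepsilon<2\lambda-2$; let $c>0$ and $A\in\mathbb R$. Then there is a constant $C=C(\lambda,\varepsilon,c,A)$ such that, for every cutoff function $\chi$ with constants $(c,A)$ (defined below) and for each of $f=\frac{\chi}{\langle\xi-\eta\rangle^{1/2}}$ and $f=\frac{\chi}{\langle\eta\rangle^{1/2}}$, $$\|f\,\mathfrak M_1\|_{L^\infty_\eta(\dot H_\xi^{3/2-\varepsilon})}+\|f\,\mathfrak M_1\|_{L^\infty_\xi(\dot H_\eta^{3/2-\varepsilon})}\le C .$$ Here a cutoff function with constants $(c,A)$ is a smooth function $\chi:\mathbb R^3\times\mathbb R^3\to\mathbb R$ that vanishes outside $\Omega=\{\max(|\xi|,|\xi-\eta|,|\eta|)\ge c\}$ and satisfies, for all $\xi,\eta$ and $k=0,1,2$, the scale-invariant bounds $$\min(|\xi|,|\xi-\eta|)^k\,|D_\xi^k\chi(\xi,\eta)|\le A,\qquad \min(|\eta|,|\xi-\eta|)^k\,|D_\eta^k\chi(\xi,\eta)|\le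 A .$$ -/

import Mathlib

open MeasureTheory
open scoped SchwartzMap FourierTransform ENNReal NNReal ContDiff

namespace IonEuler

noncomputable section

/-- The frequency space `ℝ³` with its Euclidean norm. -/
abbrev R3 : Type := EuclideanSpace ℝ (Fin 3)

/-- The Japanese bracket `⟨x⟩ = √(1 + |x|²)`. -/
def bracket (x : R3) : ℝ := Real.sqrt (1 + ‖x‖ ^ 2)

/-- The dispersion relation `p(ξ) = |ξ| √((2 + |ξ|²) / (1 + |ξ|²))`. -/
def p (ξ : R3) : ℝ := ‖ξ‖ * Real.sqrt ((2 + ‖ξ‖ ^ 2) / (1 + ‖ξ‖ ^ 2))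

/-- The phase `Φ₁(ξ, η) = p(ξ) - p(ξ - η) - p(η)`. -/
def Phi1 (ξ η : R3) : ℝ := p ξ - p (ξ - η) - p η

/-- The multiplier `𝔐₁ = |ξ| |ξ - η| |η| / (Φ₁ ⟨ξ - η⟩^{2λ} ⟨η⟩^{2λ})`.
The phase vanishes only if `η = 0` or `ξ = η`, where the value is `0`; for each fixed `ξ`
(resp. each fixed `η ≠ 0`) these `η` (resp. `ξ`) form a null set. -/
def M1 (lam : ℝ) (ξ η : R3) : ℝ :=
  (‖ξ‖ * ‖ξ - η‖ * ‖η‖) /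
    (Phi1 ξ η * bracket (ξ - η) ^ (2 * lam) * bracket η ^ (2 * lam))

/-- The tempered distribution `T` is (integration against) the function `f`. -/
def IsFunction (T : 𝓢'(R3, ℂ)) (f : R3 → ℂ) : Prop :=
  ∀ φ : 𝓢(R3, ℂ), Integrable (fun x => φ x * f x) ∧ T φ = ∫ x, φ x * f x

/-- The homogeneous Sobolev norm `‖f‖_{Ḣ^s} = ‖ |∇|^s f ‖_{L²}`, with values in `[0, ∞]`:
`f` is viewed as a tempered distribution, its Fourier transform has to be a function `g`
(which is then unique up to null sets), and the norm is the `L²` norm of `|2πζ|^s g(ζ)`,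
the factor `2π` being due to the normalisation `e^{-2πi x·ζ}` of the Fourier transform.
If `f` is not a tempered distribution, or if its Fourier transform is not a function, then
the infimum is over the empty set and the norm is `∞`. -/
def homSobolevNorm (s : ℝ) (f : R3 → ℂ) : ℝ≥0∞ :=
  ⨅ (T : 𝓢'(R3, ℂ)) (_ : IsFunction T f) (g : R3 → ℂ) (_ : IsFunction (𝓕 T) g),
    eLpNorm (fun ζ => (((2 * Real.pi * ‖ζ‖) ^ s : ℝ) : ℂ) * g ζ) 2 volume

/-- The norm of `L^∞_η(Ḣ^s_ξ)`. -/
def normLinftyEtaHsXi (s : ℝ) (m : R3 → R3 → ℝ) : ℝ≥0∞ :=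
  essSup (fun η => homSobolevNorm s (fun ξ => (m ξ η : ℂ))) volume

/-- The norm of `L^∞_ξ(Ḣ^s_η)`. -/
def normLinftyXiHsEta (s : ℝ) (m : R3 → R3 → ℝ) : ℝ≥0∞ :=
  essSup (fun ξ => homSobolevNorm s (fun η => (m ξ η : ℂ))) volume

/-- Cutoff functions supported in `Ω = {max(|ξ|, |ξ - η|, |η|) ≥ c}`: smooth functions of
`(ξ, η)` which are bounded, together with their scale-invariant derivatives of order at most
two, by `A`. At fixed `η` the variables `ξ` and `ξ - η` move, whence the weight
`min(|ξ|, |ξ - η|)`; similarly at fixed `ξ`. Products `a(ξ) b(ξ - η) c(η)` of smooth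
Mikhlin symbols, smooth symbols of order `0` in `(ξ, η)`, compactly supported smooth functions
and `1` minus such functions all satisfy these bounds for some `A`. -/
structure IsCutoff (c A : ℝ) (χ : R3 → R3 → ℝ) : Prop where
  smooth : ContDiff ℝ ∞ (fun z : R3 × R3 => χ z.1 z.2)
  support : ∀ ξ η, χ ξ η ≠ 0 → c ≤ max ‖ξ‖ (max ‖ξ - η‖ ‖η‖)
  bound_xi : ∀ k : ℕ, k ≤ 2 → ∀ ξ η,
    min ‖ξ‖ ‖ξ - η‖ ^ k * ‖iteratedFDeriv ℝ k (fun x => χ x η) ξ‖ ≤ A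
  bound_eta : ∀ k : ℕ, k ≤ 2 → ∀ ξ η,
    min ‖η‖ ‖ξ - η‖ ^ k * ‖iteratedFDeriv ℝ k (fun y => χ ξ y) η‖ ≤ A

end

end IonEuler

/-!
Why the multiplier is in these Sobolev spaces.

Write `r = |ξ|`, `a = |ξ - η|`, `b = |η|`. The phase has a sign: since `p` is increasing and
strictly subadditive, `-Φ₁ ≥ (2/3) (a + b - r) + (1/6) a b (a + b) / ((1 + a²) (1 + b²))`
(`phase_lower`), so `|Φ₁|` vanishes only at the endpoints and is otherwise smallest near the
configurations where `ξ - η` and `η` point in the same direction. The defect `a + b - r` is at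
least a multiple of `κ |y|²`, with `y` the component of the moving variable orthogonal to the
fixed one and `κ` a curvature, which gives `|Φ₁| ≥ c (κ |y|² + D)` (`perp_le_left`,
`perp_le_right`). Moreover, `|Φ₁|` nearly has the regularity of a nonnegative `C²` function: its
gradient satisfies `|∇Φ₁|² ≤ C κ |Φ₁|` and its Laplacian `|ΔΦ₁| ≤ C κ`, with `κ = b / (r a)` when
`ξ` moves and `κ = (a + b) / (a b)` when `η` moves (`exists_symbolAt_phase_left`,
`exists_symbolAt_phase_right`). Consequently `1 / Φ₁`, and with it the whole multiplier away from
`ξ = 0`, is a symbol on the length scale `(|Φ₁| / κ)^{1/2}`, in the sense of `SymbolAt`.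

Fix one frequency. As a function of the other one the multiplier has two singular points; a cutoff
separates them, and each part is cut into dyadic annuli of radius `R` around its singular point.
On such a piece the `L²` norms of the function and of its Laplacian are bounded by explicit
integrals over a slab of width `R` around a hyperplane orthogonal to the fixed frequency
(`interpolation_bound`), and Hölder's inequality on the Fourier side,
`‖u‖_{Ḣ^s} ≤ ‖u‖_{L²}^{1 - s/2} ‖Δu‖_{L²}^{s/2}`, gives a bound `pieceBound` for the square of
the `Ḣ^s` norm of the piece.
Under the hypotheses on `λ` and `ε` it decays geometrically as `R → 0` and as `R → ∞`, uniformly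
in the fixed frequency (`pieceDecay_of_nine_eighths`, `pieceDecay_of_one`). In the second case the
extra factor `⟨·⟩^{-1/2}` is used together with the lower bound `c` on the largest frequency;
pieces at smaller frequencies vanish.

The pieces are then summed in `Ḣ^s` (`hasSobolevBound_of_hasSum`). For `s < 3/2` the weight
`|ζ|^{-s}` is locally square integrable, so that the limit in `L²` of the functions `|2πζ|^s 𝓕u`
is `|2πζ|^s` times the Fourier transform of the sum, as a tempered distribution.
-/

namespace IonEuler

open Laplacian InnerProductSpace Topology

/-! ### The Fourier transform of integrable and of compactly supported functions -/

theorem integral_schwartz_mul_fourier {u : R3 → ℂ} (hu : Integrable u) (φ : 𝓢(R3, ℂ)) :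
    ∫ x, (𝓕 φ) x * u x = ∫ x, φ x * (𝓕 u) x := by
  have h := VectorFourier.integral_fourierIntegral_smul_eq_flip (μ := (volume : Measure R3))
    (ν := (volume : Measure R3)) (L := innerₗ R3) (f := (φ : R3 → ℂ)) (g := u)
    Real.continuous_fourierChar continuous_inner φ.integrable hu
  simp only [smul_eq_mul] at h
  rw [flip_innerₗ] at h
  exact h

/-- Plancherel's identity with the Fourier integral in place of the extension to `L²`. The two are
identified by testing against compactly supported smooth functions. -/
theorem plancherel {u : R3 → ℂ} (h1 : Integrable u) (h2 : MemLp u 2) :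
    eLpNorm (𝓕 u) 2 volume = eLpNorm u 2 volume := by
  set U : Lp ℂ 2 (volume : Measure R3) := h2.toLp u with hU
  set V : Lp ℂ 2 (volume : Measure R3) := 𝓕 U with hV
  have hcont : Continuous (𝓕 u) :=
    VectorFourier.fourierIntegral_continuous Real.continuous_fourierChar continuous_inner h1
  have key : (V : R3 → ℂ) =ᵐ[volume] 𝓕 u := by
    apply ae_eq_of_integral_contDiff_smul_eq
    · exact (Lp.memLp V).locallyIntegrable (by norm_num)
    · exact hcont.locallyIntegrable
    · intro g hg hgc
      have hgc' : HasCompactSupport (fun x => (g x : ℂ)) :=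
        hgc.comp_left (g := fun t : ℝ => (t : ℂ)) (by simp)
      set φ : 𝓢(R3, ℂ) := hgc'.toSchwartzMap (Complex.ofRealCLM.contDiff.comp hg) with hφ
      have hφx : ∀ x, φ x = (g x : ℂ) := fun x => rfl
      have e1 : Lp.toTemperedDistribution V φ = Lp.toTemperedDistribution U (𝓕 φ) := by
        rw [hV, ← Lp.fourier_toTemperedDistribution_eq, TemperedDistribution.fourier_apply]
      rw [Lp.toTemperedDistribution_apply, Lp.toTemperedDistribution_apply] at e1
      have e2 : ∫ x, (𝓕 φ) x • (U : R3 → ℂ) x = ∫ x, (𝓕 φ) x * u x := by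
        apply integral_congr_ae
        filter_upwards [h2.coeFn_toLp] with x hx
        rw [hU, hx, smul_eq_mul]
      rw [e2, integral_schwartz_mul_fourier h1] at e1
      simpa [hφx] using e1
  rw [← eLpNorm_congr_ae key, ← eLpNorm_congr_ae h2.coeFn_toLp]
  have := Lp.norm_fourier_eq U
  rw [Lp.norm_def, Lp.norm_def] at this
  exact (ENNReal.toReal_eq_toReal_iff' (Lp.eLpNorm_ne_top _) (Lp.eLpNorm_ne_top _)).1 this

theorem fourier_laplacian {u : R3 → ℂ} (hu : ContDiff ℝ 2 u) (hc : HasCompactSupport u) (ζ : R3) :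
    𝓕 (Δ u) ζ = -((2 * Real.pi * ‖ζ‖ : ℝ) : ℂ) ^ 2 * 𝓕 u ζ := by
  have hint : ∀ n : ℕ, (n : ℕ∞) ≤ (2 : ℕ∞) → Integrable (iteratedFDeriv ℝ n u) := by
    intro n hn
    refine (hu.continuous_iteratedFDeriv (m := n) ?_).integrable_of_hasCompactSupport
      (hc.iteratedFDeriv n)
    exact_mod_cast hn
  have h := Real.fourier_iteratedFDeriv (N := 2) (f := u) hu hint (n := 2) le_rfl
  set v := EuclideanSpace.basisFun (Fin 3) ℝ
  rw [laplacian_eq_iteratedFDeriv_orthonormalBasis u v]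
  have e1 : 𝓕 (fun x ↦ ∑ i, iteratedFDeriv ℝ 2 u x ![v i, v i]) ζ =
      ∑ i, 𝓕 (fun x ↦ iteratedFDeriv ℝ 2 u x ![v i, v i]) ζ := by
    simp only [Real.fourier_eq, Finset.smul_sum]
    rw [integral_finsetSum]
    intro i _
    rw [Real.fourierIntegral_convergent_iff]
    exact (ContinuousMultilinearMap.apply ℝ (fun _ : Fin 2 => R3) ℂ
      ![v i, v i]).integrable_comp (hint 2 le_rfl)
  rw [e1]
  have e2 : ∀ i, 𝓕 (fun x ↦ iteratedFDeriv ℝ 2 u x ![v i, v i]) ζ =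
      -((2 * Real.pi * ζ i : ℝ) : ℂ) ^ 2 * 𝓕 u ζ := by
    intro i
    rw [← Real.fourier_continuousMultilinearMap_apply (hint 2 le_rfl), h]
    simp only [VectorFourier.fourierPowSMulRight_apply]
    have h1 : innerSL ℝ ζ (EuclideanSpace.single i 1) = ζ i := by
      rw [innerSL_apply_apply, EuclideanSpace.inner_single_right]
      simp
    simp [Fin.prod_univ_two, v, h1, mul_pow]
    ring_nf
  simp_rw [e2]
  rw [← Finset.sum_mul]
  congr 1
  have : ‖ζ‖ ^ 2 = ∑ i, ζ i ^ 2 := by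
    rw [EuclideanSpace.norm_sq_eq]; simp
  have h3 : ((2 * Real.pi * ‖ζ‖ : ℝ) : ℂ) ^ 2 = ((4 * Real.pi ^ 2 * ∑ i, ζ i ^ 2 : ℝ) : ℂ) := by
    rw [← this]; push_cast; ring
  rw [h3]
  simp only [Fin.sum_univ_three]
  push_cast
  ring

/-- Hölder's inequality between the weights `1` and `|2πζ|²`. -/
theorem lintegral_weight_sq_le {G : R3 → ℂ} (hG : AEStronglyMeasurable G) {s : ℝ} (hs0 : 0 ≤ s)
    (hs2 : s ≤ 2) :
    ∫⁻ ζ, ‖(((2 * Real.pi * ‖ζ‖) ^ s : ℝ) : ℂ) * G ζ‖ₑ ^ (2 : ℝ) ≤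
      (∫⁻ ζ, ‖G ζ‖ₑ ^ (2 : ℝ)) ^ (1 - s / 2) *
        (∫⁻ ζ, ‖((2 * Real.pi * ‖ζ‖ : ℝ) : ℂ) ^ 2 * G ζ‖ₑ ^ (2 : ℝ)) ^ (s / 2) := by
  have hp : 0 ≤ 1 - s / 2 := by linarith
  have hq : 0 ≤ s / 2 := by linarith
  refine le_trans (le_of_eq ?_) (ENNReal.lintegral_mul_norm_pow_le (p := 1 - s / 2) (q := s / 2)
    (by fun_prop) (by fun_prop) hp hq (by ring))
  refine lintegral_congr fun ζ => ?_
  have h0 : 0 ≤ 2 * Real.pi * ‖ζ‖ := by positivity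
  have he : ∀ t : ℝ, ‖(t : ℂ)‖ₑ = ‖t‖ₑ := fun t => by
    rw [← ofReal_norm, ← ofReal_norm, Complex.norm_real]
  rw [enorm_mul, enorm_mul, enorm_pow, he, he]
  rw [Real.enorm_of_nonneg (Real.rpow_nonneg h0 s), Real.enorm_of_nonneg h0,
    ← ENNReal.ofReal_rpow_of_nonneg h0 hs0]
  set A := ENNReal.ofReal (2 * Real.pi * ‖ζ‖)
  set B := ‖G ζ‖ₑ
  rw [ENNReal.mul_rpow_of_nonneg _ _ (by norm_num : (0:ℝ) ≤ 2),
    ENNReal.mul_rpow_of_nonneg _ _ (by norm_num : (0:ℝ) ≤ 2),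
    ENNReal.mul_rpow_of_nonneg _ _ hq, ← ENNReal.rpow_natCast, ← ENNReal.rpow_mul,
    ← ENNReal.rpow_mul, ← ENNReal.rpow_mul, ← ENNReal.rpow_mul, ← ENNReal.rpow_mul,
    mul_left_comm, ← ENNReal.rpow_add_of_nonneg _ _ (by positivity) (by positivity)]
  congr 2
  · push_cast; ring
  · ring

/-! ### Homogeneous Sobolev bounds -/

/-- `f` is a tempered distribution whose homogeneous Sobolev norm is at most `N`. The function `g`
representing the Fourier transform is required to be a.e. strongly measurable, which the triangle
inequality for `eLpNorm` needs. -/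
def HasSobolevBound (s : ℝ) (f : R3 → ℂ) (N : ℝ≥0∞) : Prop :=
  ∃ T : 𝓢'(R3, ℂ), IsFunction T f ∧ ∃ g : R3 → ℂ, IsFunction (𝓕 T) g ∧
    AEStronglyMeasurable g ∧
    eLpNorm (fun ζ => (((2 * Real.pi * ‖ζ‖) ^ s : ℝ) : ℂ) * g ζ) 2 volume ≤ N

theorem HasSobolevBound.homSobolevNorm_le {s : ℝ} {f : R3 → ℂ} {N : ℝ≥0∞}
    (h : HasSobolevBound s f N) : homSobolevNorm s f ≤ N := by
  obtain ⟨T, hT, g, hg, -, hN⟩ := h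
  exact iInf₂_le_of_le T hT (iInf₂_le_of_le g hg hN)

theorem measurable_weight (s : ℝ) :
    Measurable fun ζ : R3 => (((2 * Real.pi * ‖ζ‖) ^ s : ℝ) : ℂ) :=
  Complex.measurable_ofReal.comp ((measurable_norm.const_mul _).pow_const s)

theorem IsFunction.add {S T : 𝓢'(R3, ℂ)} {f g : R3 → ℂ} (hf : IsFunction S f)
    (hg : IsFunction T g) : IsFunction (S + T) (fun x => f x + g x) := by
  intro φ
  obtain ⟨h1, h2⟩ := hf φ
  obtain ⟨h3, h4⟩ := hg φ
  refine ⟨?_, ?_⟩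
  · simp only [mul_add]
    exact h1.add h3
  · simp only [mul_add]
    rw [integral_add h1 h3, ← h2, ← h4]
    rfl

theorem HasSobolevBound.add {s : ℝ} {f g : R3 → ℂ} {M N : ℝ≥0∞}
    (hf : HasSobolevBound s f M) (hg : HasSobolevBound s g N) :
    HasSobolevBound s (fun x => f x + g x) (M + N) := by
  obtain ⟨S, hS, u, hu, hum, hM⟩ := hf
  obtain ⟨T, hT, v, hv, hvm, hN⟩ := hg
  refine ⟨S + T, hS.add hT, fun x => u x + v x, ?_, hum.add hvm, ?_⟩
  · rw [FourierTransform.fourier_add]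
    exact hu.add hv
  · simp only [mul_add]
    refine (eLpNorm_add_le ?_ ?_ (by norm_num)).trans (add_le_add hM hN)
    · exact (measurable_weight s).aestronglyMeasurable.mul hum
    · exact (measurable_weight s).aestronglyMeasurable.mul hvm

theorem exists_isFunction {f : R3 → ℂ} (hf : AEStronglyMeasurable f) {K : ℝ}
    (hK : ∀ᵐ x, ‖f x‖ ≤ K) : ∃ T : 𝓢'(R3, ℂ), IsFunction T f := by
  have hm : MemLp f ⊤ (volume : Measure R3) := memLp_top_of_bound hf K hK
  refine ⟨Lp.toTemperedDistribution (hm.toLp f), fun φ => ⟨?_, ?_⟩⟩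
  · exact φ.integrable.mul_bdd (c := K) hf hK
  · rw [Lp.toTemperedDistribution_apply]
    apply integral_congr_ae
    filter_upwards [hm.coeFn_toLp] with x hx
    rw [hx, smul_eq_mul]

theorem integrableOn_norm_rpow_neg {t : ℝ} (ht : t < 3) :
    IntegrableOn (fun ζ : R3 => ‖ζ‖ ^ (-t)) (Metric.ball 0 1) := by
  rw [integrableOn_fun_norm_addHaar (μ := volume) (f := fun y : ℝ => y ^ (-t))]
  have h : IntegrableOn (fun y : ℝ => y ^ (2 - t)) (Set.Ioo 0 1) := by
    have := (intervalIntegral.intervalIntegrable_rpow' (a := 0) (b := 1) (r := 2 - t)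
      (by linarith)).1
    exact this.mono_set Set.Ioo_subset_Ioc_self
  refine h.congr_fun (fun y hy => ?_) measurableSet_Ioo
  simp only [finrank_euclideanSpace, Fintype.card_fin, smul_eq_mul]
  rw [← Real.rpow_natCast, ← Real.rpow_add hy.1]
  norm_num
  ring_nf

/-- The weight `|2πζ|^{-s}` is locally square integrable for `s < 3/2`; this makes
`|2πζ|^{-s} G` a tempered distribution for every `G` in `L²`. -/
theorem memLp_schwartz_mul_weight (φ : 𝓢(R3, ℂ)) {s : ℝ} (hs0 : 0 ≤ s) (hs : s < 3 / 2) :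
    MemLp (fun ζ => φ ζ * (((2 * Real.pi * ‖ζ‖) ^ (-s) : ℝ) : ℂ)) 2 (volume : Measure R3) := by
  have hb : MemLp ((Metric.ball (0 : R3) 1).indicator fun ζ : R3 => ‖ζ‖ ^ (-s)) 2 volume := by
    rw [memLp_indicator_iff_restrict measurableSet_ball, memLp_two_iff_integrable_sq
      (measurable_norm.pow_const _).aestronglyMeasurable]
    refine (integrableOn_norm_rpow_neg (t := 2 * s) (by linarith)).congr_fun
      (fun ζ _ => ?_) measurableSet_ball
    simp only
    rw [← Real.rpow_natCast, ← Real.rpow_mul (norm_nonneg _)]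
    push_cast
    ring_nf
  obtain ⟨C, hC⟩ : ∃ C, ∀ x, ‖φ x‖ ≤ C := by
    obtain ⟨C, hC⟩ := φ.decay 0 0
    exact ⟨C, fun x => by simpa using hC.2 x⟩
  have h2 : MemLp (fun ζ => C * (Metric.ball (0 : R3) 1).indicator (fun ζ : R3 => ‖ζ‖ ^ (-s)) ζ
      + ‖φ ζ‖) 2 volume := (hb.const_mul C).add (φ.memLp 2).norm
  refine h2.mono (φ.continuous.aestronglyMeasurable.mul
    (measurable_weight _).aestronglyMeasurable) (Filter.Eventually.of_forall fun ζ => ?_)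
  have hC0 : 0 ≤ C := (norm_nonneg _).trans (hC 0)
  have hw : (2 * Real.pi * ‖ζ‖) ^ (-s) ≤ ‖ζ‖ ^ (-s) := by
    rcases eq_or_ne ζ 0 with rfl | h0
    · simp
    · have : 0 < ‖ζ‖ := norm_pos_iff.2 h0
      refine Real.rpow_le_rpow_of_nonpos this ?_ (by linarith)
      nlinarith [Real.pi_gt_three]
  have h0 : 0 ≤ (2 * Real.pi * ‖ζ‖) ^ (-s) := by positivity
  rw [norm_mul, Complex.norm_real, Real.norm_of_nonneg h0, Real.norm_eq_abs]
  refine le_trans ?_ (le_abs_self _)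
  by_cases hz : ζ ∈ Metric.ball (0 : R3) 1
  · rw [Set.indicator_of_mem hz]
    have := mul_le_mul (hC ζ) hw h0 hC0
    linarith [norm_nonneg (φ ζ)]
  · rw [Set.indicator_of_notMem hz, mul_zero, zero_add]
    have h1 : 1 ≤ ‖ζ‖ := by simpa using hz
    have : ‖ζ‖ ^ (-s) ≤ 1 := Real.rpow_le_one_of_one_le_of_nonpos h1 (by linarith)
    nlinarith [norm_nonneg (φ ζ)]

theorem eLpNorm_two_sq {G : R3 → ℂ} :
    eLpNorm G 2 volume ^ (2 : ℝ) = ∫⁻ x, ‖G x‖ₑ ^ (2 : ℝ) := by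
  rw [eLpNorm_eq_lintegral_rpow_enorm_toReal (by norm_num) (by norm_num), ← ENNReal.rpow_mul]
  norm_num

/-- Interpolation between `L²` and `Ḣ²`: `‖u‖_{Ḣ^s} ≤ ‖u‖_{L²}^{1-s/2} ‖Δu‖_{L²}^{s/2}`. -/
theorem eLpNorm_weight_fourier_sq_le {u : R3 → ℝ} (hu : ContDiff ℝ 2 u) (hc : HasCompactSupport u)
    {s : ℝ} (hs0 : 0 ≤ s) (hs2 : s ≤ 2) :
    eLpNorm (fun ζ => (((2 * Real.pi * ‖ζ‖) ^ s : ℝ) : ℂ) * 𝓕 (fun x => (u x : ℂ)) ζ) 2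
      volume ^ (2 : ℝ) ≤
    (∫⁻ x, ‖u x‖ₑ ^ (2 : ℝ)) ^ (1 - s / 2) * (∫⁻ x, ‖Δ u x‖ₑ ^ (2 : ℝ)) ^ (s / 2) := by
  set U : R3 → ℂ := fun x => (u x : ℂ) with hU
  have hU2 : ContDiff ℝ 2 U := Complex.ofRealCLM.contDiff.comp hu
  have hUc : HasCompactSupport U := hc.comp_left (g := fun t : ℝ => (t : ℂ)) (by simp)
  have hΔ : ∀ x, Δ U x = ((Δ u x : ℝ) : ℂ) := fun x =>
    (hu.contDiffAt).laplacian_CLM_comp_left (l := Complex.ofRealCLM)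
  have hsup : HasCompactSupport (Δ U) := by
    have h2 := hUc.iteratedFDeriv (𝕜 := ℝ) 2
    refine h2.mono fun x hx => ?_
    contrapose! hx
    simp only [Function.mem_support, not_not] at hx ⊢
    simp [laplacian_eq_iteratedFDeriv_stdOrthonormalBasis, hx]
  have hΔc : Continuous (Δ U) := by
    rw [laplacian_eq_iteratedFDeriv_stdOrthonormalBasis]
    refine continuous_finsetSum _ fun i _ => ?_
    exact (ContinuousMultilinearMap.apply ℝ (fun _ : Fin 2 => R3) ℂ _).continuous.comp
      (hU2.continuous_iteratedFDeriv le_rfl)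
  have hF : Continuous (𝓕 U) := VectorFourier.fourierIntegral_continuous
    Real.continuous_fourierChar continuous_inner
    (hU2.continuous.integrable_of_hasCompactSupport hUc)
  have e1 := plancherel (hU2.continuous.integrable_of_hasCompactSupport hUc)
    (hU2.continuous.memLp_of_hasCompactSupport hUc)
  have e2 := plancherel (hΔc.integrable_of_hasCompactSupport hsup)
    (hΔc.memLp_of_hasCompactSupport hsup)
  have he : ∀ t : ℝ, ‖(t : ℂ)‖ₑ = ‖t‖ₑ := fun t => by
    rw [← ofReal_norm, ← ofReal_norm, Complex.norm_real]
  have h := lintegral_weight_sq_le (G := 𝓕 U) hF.aestronglyMeasurable hs0 hs2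
  rw [eLpNorm_two_sq]
  refine h.trans (le_of_eq ?_)
  congr 2
  · rw [← eLpNorm_two_sq, e1, eLpNorm_two_sq]
    simp only [hU, he]
  · have : ∀ ζ, ‖((2 * Real.pi * ‖ζ‖ : ℝ) : ℂ) ^ 2 * 𝓕 U ζ‖ₑ = ‖𝓕 (Δ U) ζ‖ₑ := by
      intro ζ
      rw [fourier_laplacian hU2 hUc, neg_mul, enorm_neg]
    simp only [this]
    rw [← eLpNorm_two_sq, e2, eLpNorm_two_sq]
    simp only [hΔ, he]

/-- A function which is a sum of `C²` bumps is in `Ḣ^s` as soon as the interpolation bounds of the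
bumps are summable. The Fourier transform is constructed as `|2πζ|^{-s}` times an `L²` sum. -/
theorem hasSobolevBound_of_hasSum {ι : Type*} [Countable ι] {s : ℝ} (hs0 : 0 ≤ s) (hs : s < 3 / 2)
    {u : ι → R3 → ℝ} (hu : ∀ i, ContDiff ℝ 2 (u i)) (hc : ∀ i, HasCompactSupport (u i))
    {f : R3 → ℝ} {K : ℝ} (hK : ∀ᵐ x, ∀ t : Finset ι, |∑ i ∈ t, u i x| ≤ K)
    (hf : ∀ᵐ x, HasSum (fun i => u i x) (f x))
    {N : ι → ℝ} (hN0 : ∀ i, 0 ≤ N i) (hN : Summable N)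
    (hb : ∀ i, (∫⁻ x, ‖u i x‖ₑ ^ (2 : ℝ)) ^ (1 - s / 2) *
      (∫⁻ x, ‖Δ (u i) x‖ₑ ^ (2 : ℝ)) ^ (s / 2) ≤ ENNReal.ofReal (N i ^ 2)) :
    HasSobolevBound s (fun x => (f x : ℂ)) (ENNReal.ofReal (∑' i, N i)) := by
  set U : ι → R3 → ℂ := fun i x => (u i x : ℂ) with hU
  have hU2 : ∀ i, Continuous (U i) := fun i => Complex.continuous_ofReal.comp (hu i).continuous
  have hUc : ∀ i, HasCompactSupport (U i) := fun i =>
    (hc i).comp_left (g := fun t : ℝ => (t : ℂ)) (by simp)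
  have hUi : ∀ i, Integrable (U i) := fun i => (hU2 i).integrable_of_hasCompactSupport (hUc i)
  have hUf : ∀ᵐ x, HasSum (fun i => U i x) (f x : ℂ) := by
    filter_upwards [hf] with x hx
    exact Complex.hasSum_ofReal.2 hx
  have hfm : AEStronglyMeasurable (fun x => (f x : ℂ)) volume :=
    aestronglyMeasurable_of_tendsto_ae (u := Filter.atTop)
      (f := fun (t : Finset ι) x => ∑ i ∈ t, U i x)
      (fun t => (continuous_finsetSum _ fun i _ => hU2 i).aestronglyMeasurable) hUf
  have hnorm : ∀ᵐ x, ∀ t : Finset ι, ‖∑ i ∈ t, U i x‖ ≤ K := by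
    filter_upwards [hK] with x hx t
    rw [hU, ← Complex.ofReal_sum, Complex.norm_real]
    exact hx t
  have hfK : ∀ᵐ x, ‖(f x : ℂ)‖ ≤ K := by
    filter_upwards [hUf, hnorm] with x hx hK
    exact le_of_tendsto hx.norm (Filter.Eventually.of_forall hK)
  obtain ⟨T, hT⟩ := exists_isFunction hfm hfK
  -- the weighted Fourier transforms of the bumps, as elements of `L²`
  set h : ι → R3 → ℂ := fun i ζ => (((2 * Real.pi * ‖ζ‖) ^ s : ℝ) : ℂ) * 𝓕 (U i) ζ with hh
  have hFc : ∀ i, Continuous (𝓕 (U i)) := fun i => VectorFourier.fourierIntegral_continuous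
    Real.continuous_fourierChar continuous_inner (hUi i)
  have hle : ∀ i, eLpNorm (h i) 2 volume ≤ ENNReal.ofReal (N i) := by
    intro i
    have h1 := (eLpNorm_weight_fourier_sq_le (hu i) (hc i) hs0 (by linarith)).trans (hb i)
    rw [ENNReal.ofReal_pow (hN0 i), ← ENNReal.rpow_natCast] at h1
    exact (ENNReal.rpow_le_rpow_iff (by norm_num : (0 : ℝ) < 2)).1 (by exact_mod_cast h1)
  have hmem : ∀ i, MemLp (h i) 2 volume := fun i =>
    ⟨(measurable_weight s).aestronglyMeasurable.mul (hFc i).aestronglyMeasurable,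
      (hle i).trans_lt ENNReal.ofReal_lt_top⟩
  set H : ι → Lp ℂ 2 (volume : Measure R3) := fun i => (hmem i).toLp (h i) with hH
  have hHn : ∀ i, ‖H i‖ ≤ N i := by
    intro i
    rw [hH, Lp.norm_toLp]
    exact ENNReal.toReal_le_of_le_ofReal (hN0 i) (hle i)
  have hHs : Summable H := hN.of_norm_bounded hHn
  set G : Lp ℂ 2 (volume : Measure R3) := ∑' i, H i with hG
  have hGn : ‖G‖ ≤ ∑' i, N i := tsum_of_norm_bounded hN.hasSum hHn
  set w : R3 → ℝ := fun ζ => (2 * Real.pi * ‖ζ‖) ^ (-s) with hw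
  have hwcancel : ∀ ζ : R3, ζ ≠ 0 → (w ζ : ℂ) * (((2 * Real.pi * ‖ζ‖) ^ s : ℝ) : ℂ) = 1 := by
    intro ζ hζ
    have : 0 < 2 * Real.pi * ‖ζ‖ := by have := norm_pos_iff.2 hζ; positivity
    rw [← Complex.ofReal_mul, hw, ← Real.rpow_add this]
    simp
  have hae : ∀ᵐ ζ : R3, ζ ≠ 0 := by
    simp [ae_iff]
  refine ⟨T, hT, fun ζ => (w ζ : ℂ) * G ζ, ?_, ?_, ?_⟩
  · intro φ
    have hk := memLp_schwartz_mul_weight φ hs0 hs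
    refine ⟨?_, ?_⟩
    · have := hk.integrable_mul (Lp.memLp G)
      refine this.congr (Filter.Eventually.of_forall fun ζ => ?_)
      simp only [Pi.mul_apply, hw]
      ring
    · -- both sides are the sum of `∫ φ 𝓕 (u i)`
      have s1 : HasSum (fun i => ∫ x, φ x * 𝓕 (U i) x) (∫ x, (𝓕 φ) x * f x) := by
        simp_rw [← integral_schwartz_mul_fourier (hUi _)]
        unfold HasSum
        simp_rw [← integral_finsetSum _ fun i _ => (hUi i).bdd_mul
          (c := (SchwartzMap.seminorm ℝ 0 0) (𝓕 φ)) (𝓕 φ).continuous.aestronglyMeasurable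
          (Filter.Eventually.of_forall fun x => SchwartzMap.norm_le_seminorm ℝ (𝓕 φ) x)]
        refine tendsto_integral_filter_of_dominated_convergence (fun x => ‖(𝓕 φ) x‖ * K) ?_ ?_ ?_ ?_
        · refine Filter.Eventually.of_forall fun t => Continuous.aestronglyMeasurable ?_
          exact continuous_finsetSum _ fun i _ => (𝓕 φ).continuous.mul (hU2 i)
        · refine Filter.Eventually.of_forall fun t => ?_
          filter_upwards [hnorm] with x hx
          rw [← Finset.mul_sum, norm_mul]
          exact mul_le_mul_of_nonneg_left (hx t) (norm_nonneg _)
        · exact (𝓕 φ).integrable.norm.mul_const K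
        · filter_upwards [hUf] with x hx
          exact hx.mul_left _
      have s2 : HasSum (fun i => ∫ x, φ x * 𝓕 (U i) x) (∫ x, φ x * ((w x : ℂ) * G x)) := by
        set k : Lp ℂ 2 (volume : Measure R3) := (hk.star).toLp _ with hkdef
        have key : ∀ V : Lp ℂ 2 (volume : Measure R3),
            innerSL ℂ k V = ∫ x, φ x * ((w x : ℂ) * V x) := by
          intro V
          rw [innerSL_apply_apply, L2.inner_def]
          apply integral_congr_ae
          filter_upwards [hk.star.coeFn_toLp] with x hx
          rw [hkdef, hx]
          simp [hw]
          ring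
        have := hHs.hasSum.mapL (innerSL ℂ k)
        simp only [key] at this
        have e : ∀ i, ∫ x, φ x * 𝓕 (U i) x = ∫ x, φ x * ((w x : ℂ) * H i x) := by
          intro i
          apply integral_congr_ae
          filter_upwards [(hmem i).coeFn_toLp, hae] with x hx h0
          rw [hH, hx, hh]
          simp only
          rw [← mul_assoc (w x : ℂ), hwcancel x h0, one_mul]
        simp only [e]
        exact this
      rw [TemperedDistribution.fourier_apply, (hT _).2]
      exact s1.unique s2
  · exact (measurable_weight _).aestronglyMeasurable.mul (Lp.memLp G).1
  · have : eLpNorm (fun ζ => (((2 * Real.pi * ‖ζ‖) ^ s : ℝ) : ℂ) * ((w ζ : ℂ) * G ζ)) 2 volume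
        = eLpNorm G 2 volume := by
      apply eLpNorm_congr_ae
      filter_upwards [hae] with ζ h0
      rw [← mul_assoc, mul_comm _ (w ζ : ℂ), hwcancel ζ h0, one_mul]
    rw [this, ← ENNReal.ofReal_toReal (Lp.eLpNorm_ne_top G), ← Lp.norm_def]
    exact ENNReal.ofReal_le_ofReal hGn

/-! ### Functions with symbol bounds at a point -/

/-- The partial derivative in the `i`-th coordinate direction. -/
noncomputable def partialDeriv (i : Fin 3) (u : R3 → ℝ) (x : R3) : ℝ :=
  fderiv ℝ u x (EuclideanSpace.basisFun (Fin 3) ℝ i)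

theorem abs_partialDeriv_le (i : Fin 3) (u : R3 → ℝ) (x : R3) :
    |partialDeriv i u x| ≤ ‖fderiv ℝ u x‖ := by
  have := (fderiv ℝ u x).le_opNorm (EuclideanSpace.basisFun (Fin 3) ℝ i)
  simpa [partialDeriv] using this

theorem laplacian_eq_sum_fderiv (u : R3 → ℝ) (x : R3) :
    Δ u x = ∑ i, fderiv ℝ (fderiv ℝ u) x (EuclideanSpace.basisFun (Fin 3) ℝ i)
      (EuclideanSpace.basisFun (Fin 3) ℝ i) := by
  rw [laplacian_eq_iteratedFDeriv_orthonormalBasis u (EuclideanSpace.basisFun (Fin 3) ℝ)]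
  simp [iteratedFDeriv_two_apply]

theorem eventually_differentiableAt {u : R3 → ℝ} {x : R3} (hu : ContDiffAt ℝ 2 u x) :
    ∀ᶠ y in 𝓝 x, DifferentiableAt ℝ u y := by
  filter_upwards [hu.eventually (by simp)] with y hy
  exact hy.differentiableAt (by simp)

theorem differentiableAt_fderiv {u : R3 → ℝ} {x : R3} (hu : ContDiffAt ℝ 2 u x) :
    DifferentiableAt ℝ (fderiv ℝ u) x :=
  (hu.fderiv_right (m := 1) (by norm_num)).differentiableAt (by simp)

theorem laplacian_mul_apply {u v : R3 → ℝ} {x : R3} (hu : ContDiffAt ℝ 2 u x)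
    (hv : ContDiffAt ℝ 2 v x) :
    Δ (fun y => u y * v y) x =
      u x * Δ v x + v x * Δ u x + 2 * ∑ i, partialDeriv i u x * partialDeriv i v x := by
  have e : fderiv ℝ (fun y => u y * v y) =ᶠ[𝓝 x]
      fun y => u y • fderiv ℝ v y + v y • fderiv ℝ u y := by
    filter_upwards [eventually_differentiableAt hu, eventually_differentiableAt hv] with y h1 h2
    exact fderiv_fun_mul h1 h2
  have hu1 := (hu.differentiableAt (by simp)).hasFDerivAt
  have hv1 := (hv.differentiableAt (by simp)).hasFDerivAt
  have hu2 := (differentiableAt_fderiv hu).hasFDerivAt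
  have hv2 := (differentiableAt_fderiv hv).hasFDerivAt
  have h := ((hu1.smul hv2).add (hv1.smul hu2)).congr_of_eventuallyEq e
  simp only [laplacian_eq_sum_fderiv]
  rw [h.fderiv]
  simp only [Finset.mul_sum, ← Finset.sum_add_distrib]
  refine Finset.sum_congr rfl fun i _ => ?_
  simp [partialDeriv]
  ring

theorem fderiv_comp_apply {φ : ℝ → ℝ} {φ' : ℝ} {u : R3 → ℝ} {x : R3}
    (h1 : HasDerivAt φ φ' (u x)) (hu : DifferentiableAt ℝ u x) :
    fderiv ℝ (fun y => φ (u y)) x = φ' • fderiv ℝ u x :=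
  (h1.comp_hasFDerivAt x hu.hasFDerivAt).fderiv

theorem laplacian_comp_apply {φ φ' : ℝ → ℝ} {φ'' : ℝ} {u : R3 → ℝ} {x : R3}
    (hu : ContDiffAt ℝ 2 u x) (h1 : ∀ᶠ t in 𝓝 (u x), HasDerivAt φ (φ' t) t)
    (h2 : HasDerivAt φ' φ'' (u x)) :
    Δ (fun y => φ (u y)) x = φ'' * ∑ i, partialDeriv i u x ^ 2 + φ' (u x) * Δ u x := by
  have e : fderiv ℝ (fun y => φ (u y)) =ᶠ[𝓝 x] fun y => φ' (u y) • fderiv ℝ u y := by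
    filter_upwards [eventually_differentiableAt hu,
      hu.continuousAt.eventually h1] with y hy h
    exact fderiv_comp_apply h hy
  have hu1 := (hu.differentiableAt (by simp)).hasFDerivAt
  have hu2 := (differentiableAt_fderiv hu).hasFDerivAt
  have h := ((h2.comp_hasFDerivAt x hu1).smul hu2).congr_of_eventuallyEq e
  simp only [laplacian_eq_sum_fderiv]
  rw [h.fderiv]
  simp only [Finset.mul_sum, ← Finset.sum_add_distrib]
  refine Finset.sum_congr rfl fun i _ => ?_
  simp [partialDeriv]
  ring

/-- `u` is `C²` at `x`, and `u`, `∇u` and `Δu` are bounded there by `K`, `K μ` and `K μ²`: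
the function `u` has size `K` and varies on the length scale `1/μ`. -/
structure SymbolAt (u : R3 → ℝ) (x : R3) (K μ : ℝ) : Prop where
  contDiffAt : ContDiffAt ℝ 2 u x
  abs_le : |u x| ≤ K
  norm_fderiv_le : ‖fderiv ℝ u x‖ ≤ K * μ
  abs_laplacian_le : |Δ u x| ≤ K * μ ^ 2

namespace SymbolAt

variable {u v : R3 → ℝ} {x : R3} {K L μ ν : ℝ}

theorem nonneg (h : SymbolAt u x K μ) : 0 ≤ K := (abs_nonneg _).trans h.abs_le

theorem mono (h : SymbolAt u x K μ) (hK : K ≤ L) (hμ0 : 0 ≤ μ) (hμ : μ ≤ ν) :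
    SymbolAt u x L ν where
  contDiffAt := h.contDiffAt
  abs_le := h.abs_le.trans hK
  norm_fderiv_le := h.norm_fderiv_le.trans
    (mul_le_mul hK hμ hμ0 (h.nonneg.trans hK))
  abs_laplacian_le := h.abs_laplacian_le.trans
    (mul_le_mul hK (pow_le_pow_left₀ hμ0 hμ 2) (by positivity) (h.nonneg.trans hK))

theorem mul (hu : SymbolAt u x K μ) (hv : SymbolAt v x L μ) (hμ : 0 ≤ μ) :
    SymbolAt (fun y => u y * v y) x (8 * (K * L)) μ where
  contDiffAt := hu.contDiffAt.mul hv.contDiffAt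
  abs_le := by
    rw [abs_mul]
    have := mul_le_mul hu.abs_le hv.abs_le (abs_nonneg _) hu.nonneg
    linarith [mul_nonneg hu.nonneg hv.nonneg]
  norm_fderiv_le := by
    rw [fderiv_fun_mul (hu.contDiffAt.differentiableAt (by simp))
      (hv.contDiffAt.differentiableAt (by simp))]
    refine (norm_add_le _ _).trans ?_
    rw [norm_smul, norm_smul, Real.norm_eq_abs, Real.norm_eq_abs]
    have h1 := mul_le_mul hu.abs_le hv.norm_fderiv_le (norm_nonneg _) hu.nonneg
    have h2 := mul_le_mul hv.abs_le hu.norm_fderiv_le (norm_nonneg _) hv.nonneg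
    nlinarith [mul_nonneg (mul_nonneg hu.nonneg hv.nonneg) hμ]
  abs_laplacian_le := by
    rw [laplacian_mul_apply hu.contDiffAt hv.contDiffAt]
    have h1 := mul_le_mul hu.abs_le hv.abs_laplacian_le (abs_nonneg _) hu.nonneg
    have h2 := mul_le_mul hv.abs_le hu.abs_laplacian_le (abs_nonneg _) hv.nonneg
    rw [← abs_mul] at h1 h2
    have h3 : ∀ i, |partialDeriv i u x * partialDeriv i v x| ≤ K * μ * (L * μ) := fun i => by
      rw [abs_mul]
      exact mul_le_mul ((abs_partialDeriv_le i u x).trans hu.norm_fderiv_le)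
        ((abs_partialDeriv_le i v x).trans hv.norm_fderiv_le) (abs_nonneg _)
        (mul_nonneg hu.nonneg hμ)
    have h4 := h3 0
    have h5 := h3 1
    have h6 := h3 2
    rw [Fin.sum_univ_three]
    simp only [_root_.abs_le] at *
    constructor <;> nlinarith

/-- Composition with a function of one variable whose derivatives of order `k = 0, 1, 2` at `u x`
are bounded by `M / K ^ k`. -/
theorem comp {φ φ' : ℝ → ℝ} {φ'' M : ℝ} (hu : SymbolAt u x K μ) (hμ : 0 ≤ μ)
    (hφ : ContDiffAt ℝ 2 φ (u x)) (h1 : ∀ᶠ t in 𝓝 (u x), HasDerivAt φ (φ' t) t)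
    (h2 : HasDerivAt φ' φ'' (u x)) (m0 : |φ (u x)| ≤ M) (m1 : |φ' (u x)| * K ≤ M)
    (m2 : |φ''| * K ^ 2 ≤ M) : SymbolAt (fun y => φ (u y)) x (4 * M) μ where
  contDiffAt := hφ.comp x hu.contDiffAt
  abs_le := by linarith [abs_nonneg (φ (u x))]
  norm_fderiv_le := by
    rw [fderiv_comp_apply h1.self_of_nhds (hu.contDiffAt.differentiableAt (by simp)), norm_smul,
      Real.norm_eq_abs]
    have h := mul_le_mul_of_nonneg_left hu.norm_fderiv_le (abs_nonneg (φ' (u x)))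
    have h' := mul_le_mul_of_nonneg_right m1 hμ
    nlinarith [mul_nonneg ((abs_nonneg _).trans m0) hμ]
  abs_laplacian_le := by
    rw [laplacian_comp_apply hu.contDiffAt h1 h2]
    have hM : 0 ≤ M := (abs_nonneg _).trans m0
    have h3 : ∑ i, partialDeriv i u x ^ 2 ≤ 3 * (K * μ) ^ 2 := by
      have : ∀ i, partialDeriv i u x ^ 2 ≤ (K * μ) ^ 2 := fun i =>
        sq_le_sq' (by have := _root_.abs_le.1 ((abs_partialDeriv_le i u x).trans hu.norm_fderiv_le)
                      linarith) ((le_abs_self _).trans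
          ((abs_partialDeriv_le i u x).trans hu.norm_fderiv_le))
      rw [Fin.sum_univ_three]
      linarith [this 0, this 1, this 2]
    have h4 : 0 ≤ ∑ i, partialDeriv i u x ^ 2 := Finset.sum_nonneg fun i _ => sq_nonneg _
    calc _ ≤ |φ''| * ∑ i, partialDeriv i u x ^ 2 + |φ' (u x)| * |Δ u x| := by
          refine (abs_add_le _ _).trans ?_
          rw [abs_mul, abs_mul, abs_of_nonneg h4]
      _ ≤ |φ''| * (3 * (K * μ) ^ 2) + |φ' (u x)| * (K * μ ^ 2) := by
          have := hu.abs_laplacian_le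
          gcongr
      _ = 3 * (|φ''| * K ^ 2) * μ ^ 2 + |φ' (u x)| * K * μ ^ 2 := by ring
      _ ≤ 3 * M * μ ^ 2 + M * μ ^ 2 := by gcongr
      _ = 4 * M * μ ^ 2 := by ring

theorem const (c : ℝ) (hμ : 0 ≤ μ) : SymbolAt (fun _ => c) x |c| μ where
  contDiffAt := contDiffAt_const
  abs_le := le_rfl
  norm_fderiv_le := by simp; positivity
  abs_laplacian_le := by simp; positivity

theorem inv (hu : SymbolAt u x K μ) (hμ : 0 ≤ μ) (hK : 0 < K) (h : |u x| = K) :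
    SymbolAt (fun y => (u y)⁻¹) x (8 / K) μ := by
  have hne : u x ≠ 0 := fun h0 => by simp [h0] at h; linarith
  have := hu.comp (φ := fun t => t⁻¹) (φ' := fun t => -(t ^ 2)⁻¹) (φ'' := 2 * (u x ^ 3)⁻¹)
    (M := 2 / K) hμ (contDiffAt_inv ℝ hne) ?_ ?_ ?_ ?_ ?_
  · convert this using 1
    ring
  · filter_upwards [isOpen_ne.mem_nhds hne] with t ht
    exact hasDerivAt_inv ht
  · have h2 : HasDerivAt (fun t : ℝ => t ^ 2) (2 * u x) (u x) := by
      simpa using hasDerivAt_pow 2 (u x)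
    refine (h2.inv (pow_ne_zero 2 hne)).neg.congr_deriv ?_
    field_simp
  · rw [abs_inv, h, inv_eq_one_div]
    gcongr
    norm_num
  · rw [abs_neg, abs_inv, abs_pow, h]
    field_simp
    norm_num
  · rw [abs_mul, abs_inv, abs_pow, h]
    field_simp
    norm_num

end SymbolAt

theorem hasFDerivAt_norm_sub_sq (e x : R3) :
    HasFDerivAt (fun y : R3 => ‖y - e‖ ^ 2) (2 • innerSL ℝ (x - e)) x := by
  have := (hasStrictFDerivAt_norm_sq (x - e)).hasFDerivAt.comp x ((hasFDerivAt_id x).sub_const e)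
  exact this

theorem laplacian_norm_sub_sq (e x : R3) : Δ (fun y : R3 => ‖y - e‖ ^ 2) x = 6 := by
  have e1 : fderiv ℝ (fun y : R3 => ‖y - e‖ ^ 2) = fun y => 2 • innerSL ℝ (y - e) := by
    ext1 y
    exact (hasFDerivAt_norm_sub_sq e y).fderiv
  have h : HasFDerivAt (fun y : R3 => 2 • innerSL ℝ (y - e)) (2 • (innerSL ℝ : R3 →L[ℝ] _)) x :=
    ((innerSL ℝ : R3 →L[ℝ] R3 →L[ℝ] ℝ).hasFDerivAt.comp x
      ((hasFDerivAt_id x).sub_const e)).const_smul 2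
  rw [laplacian_eq_sum_fderiv, e1, h.fderiv]
  have hi : ∀ i : Fin 3, innerSL ℝ (EuclideanSpace.single i (1 : ℝ))
      (EuclideanSpace.single i (1 : ℝ)) = 1 := fun i => by
    rw [innerSL_apply_apply]
    simp
  simp [hi]
  norm_num

theorem contDiff_norm_sub_sq (e : R3) : ContDiff ℝ 2 (fun y : R3 => ‖y - e‖ ^ 2) :=
  (contDiff_id.sub contDiff_const).norm_sq ℝ

theorem sum_partialDeriv_norm_sub_sq (e x : R3) :
    ∑ i, partialDeriv i (fun y : R3 => ‖y - e‖ ^ 2) x ^ 2 = 4 * ‖x - e‖ ^ 2 := by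
  have h : ∀ i, partialDeriv i (fun y : R3 => ‖y - e‖ ^ 2) x = 2 * (x - e) i := by
    intro i
    rw [partialDeriv, (hasFDerivAt_norm_sub_sq e x).fderiv]
    simp [EuclideanSpace.inner_single_right]
  simp only [h]
  rw [EuclideanSpace.norm_sq_eq]
  simp [Fin.sum_univ_three]
  ring

theorem symbolAt_norm_sub_sq {e x : R3} (h : x ≠ e) :
    SymbolAt (fun y : R3 => ‖y - e‖ ^ 2) x (‖x - e‖ ^ 2) (3 / ‖x - e‖) := by
  have h0 : 0 < ‖x - e‖ := norm_pos_iff.2 (sub_ne_zero.2 h)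
  refine ⟨(contDiff_norm_sub_sq e).contDiffAt, by simp, ?_, ?_⟩
  · rw [(hasFDerivAt_norm_sub_sq e x).fderiv, ← Nat.cast_smul_eq_nsmul ℝ, norm_smul,
      innerSL_apply_norm]
    simp only [Nat.cast_ofNat, Real.norm_ofNat]
    field_simp
    norm_num
  · rw [laplacian_norm_sub_sq]
    field_simp
    norm_num

theorem symbolAt_norm_sub {e x : R3} (h : x ≠ e) :
    SymbolAt (fun y : R3 => ‖y - e‖) x (4 * ‖x - e‖) (3 / ‖x - e‖) := by
  have h0 : 0 < ‖x - e‖ := norm_pos_iff.2 (sub_ne_zero.2 h)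
  have hs : Real.sqrt (‖x - e‖ ^ 2) = ‖x - e‖ := Real.sqrt_sq h0.le
  have := (symbolAt_norm_sub_sq h).comp (φ := Real.sqrt) (φ' := fun t => 1 / (2 * Real.sqrt t))
    (φ'' := -(1 / (4 * ‖x - e‖ ^ 3))) (M := ‖x - e‖) (by positivity)
    (Real.contDiffAt_sqrt (by positivity)) ?_ ?_ ?_ ?_ ?_
  · simpa only [Real.sqrt_sq (norm_nonneg _)] using this
  · filter_upwards [isOpen_ne.mem_nhds (by positivity : ‖x - e‖ ^ 2 ≠ 0)] with t ht
    exact Real.hasDerivAt_sqrt ht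
  · have h2 := ((Real.hasDerivAt_sqrt (by positivity : ‖x - e‖ ^ 2 ≠ 0)).const_mul 2).inv
      (by rw [hs]; positivity)
    simp only [one_div]
    refine h2.congr_deriv ?_
    rw [hs]
    field_simp
    norm_num
  · rw [hs, abs_of_nonneg h0.le]
  · simp only [hs]
    rw [abs_of_nonneg (by positivity)]
    field_simp
    norm_num
  · rw [abs_neg, abs_of_nonneg (by positivity)]
    field_simp
    norm_num

theorem one_div_bracket_rpow (γ : ℝ) (y : R3) :
    1 / bracket y ^ γ = (1 + ‖y‖ ^ 2) ^ (-(γ / 2)) := by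
  rw [bracket, Real.sqrt_eq_rpow, ← Real.rpow_mul (by positivity), Real.rpow_neg (by positivity),
    one_div]
  ring_nf

/-- Negative powers of the Japanese bracket are symbols of their own size. -/
theorem symbolAt_bracket_rpow {e x : R3} (h : x ≠ e) {γ : ℝ} (hγ : 0 ≤ γ) :
    SymbolAt (fun y : R3 => 1 / bracket (y - e) ^ γ) x
      (4 * ((1 + γ) ^ 2 * (1 / bracket (x - e) ^ γ))) (3 / ‖x - e‖) := by
  have h0 : 0 < ‖x - e‖ := norm_pos_iff.2 (sub_ne_zero.2 h)
  simp only [one_div_bracket_rpow]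
  set t := ‖x - e‖ ^ 2 with ht
  have ht0 : 0 ≤ t := by positivity
  set k := -(γ / 2) with hk
  have hp : ∀ s, 0 < s → ∀ j : ℝ, HasDerivAt (fun s : ℝ => (1 + s) ^ j) (j * (1 + s) ^ (j - 1)) s :=
    fun s hs j => by
      have := ((hasDerivAt_id s).const_add 1).rpow_const (p := j) (Or.inl (by simp; positivity))
      simpa using this
  have hpos : 0 < (1 + t) ^ k := by positivity
  refine (symbolAt_norm_sub_sq h).comp (φ := fun s => (1 + s) ^ k)
    (φ' := fun s => k * (1 + s) ^ (k - 1)) (φ'' := k * ((k - 1) * (1 + t) ^ (k - 1 - 1)))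
    (by positivity) ?_ ?_ ?_ ?_ ?_ ?_
  · exact (contDiffAt_const.add contDiffAt_id).rpow_const_of_ne (by simp; positivity)
  · filter_upwards [lt_mem_nhds (by positivity : 0 < t)] with s hs
    exact hp s hs k
  · exact (hp t (by positivity) (k - 1)).const_mul k
  · rw [abs_of_pos hpos]
    exact le_mul_of_one_le_left hpos.le (by nlinarith)
  · have e1 : (1 + t) ^ (k - 1) * t ≤ (1 + t) ^ k := by
      rw [Real.rpow_sub_one (by positivity)]
      rw [div_mul_eq_mul_div, div_le_iff₀ (by positivity)]
      nlinarith
    have e2 : 0 < (1 + t) ^ (k - 1) := by positivity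
    rw [abs_mul, abs_of_pos e2, mul_assoc]
    have : |k| ≤ (1 + γ) ^ 2 := by
      rw [hk, abs_neg, abs_of_nonneg (by positivity)]; nlinarith
    exact mul_le_mul this e1 (by positivity) (by positivity)
  · have e1 : (1 + t) ^ (k - 1 - 1) * t ^ 2 ≤ (1 + t) ^ k := by
      rw [Real.rpow_sub_one (by positivity), Real.rpow_sub_one (by positivity), div_div,
        div_mul_eq_mul_div, div_le_iff₀ (by positivity)]
      gcongr
      nlinarith
    have e2 : 0 < (1 + t) ^ (k - 1 - 1) := by positivity
    have : |k * (k - 1)| ≤ (1 + γ) ^ 2 := by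
      rw [hk, abs_of_nonneg (by nlinarith)]; nlinarith
    rw [← mul_assoc, abs_mul, abs_of_pos e2, mul_assoc]
    exact mul_le_mul this e1 (by positivity) (by positivity)

/-! ### Dyadic decomposition and cutoff functions -/

theorem SymbolAt.sub {u v : R3 → ℝ} {x : R3} {K L μ : ℝ} (hu : SymbolAt u x K μ)
    (hv : SymbolAt v x L μ) : SymbolAt (fun y => u y - v y) x (K + L) μ where
  contDiffAt := hu.contDiffAt.sub hv.contDiffAt
  abs_le := (abs_sub _ _).trans (add_le_add hu.abs_le hv.abs_le)
  norm_fderiv_le := by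
    rw [fderiv_fun_sub (hu.contDiffAt.differentiableAt (by simp))
      (hv.contDiffAt.differentiableAt (by simp)), add_mul]
    exact (norm_sub_le _ _).trans (add_le_add hu.norm_fderiv_le hv.norm_fderiv_le)
  abs_laplacian_le := by
    have : Δ (fun y => u y - v y) x = Δ u x - Δ v x := hu.contDiffAt.laplacian_sub hv.contDiffAt
    rw [this, add_mul]
    exact (abs_sub _ _).trans (add_le_add hu.abs_laplacian_le hv.abs_laplacian_le)

/-- A smooth function of the squared radius which is `1` for `t ≤ 1` and `0` for `t ≥ 4`. -/
noncomputable def cutoff (t : ℝ) : ℝ := Real.smoothTransition ((4 - t) / 3)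

theorem contDiff_cutoff : ContDiff ℝ 2 cutoff :=
  (Real.smoothTransition.contDiff (n := 2)).comp ((contDiff_const.sub contDiff_id).div_const 3)

theorem contDiff_deriv_cutoff : ContDiff ℝ 1 (deriv cutoff) :=
  ((contDiff_succ_iff_deriv (n := 1)).1 contDiff_cutoff).2.2

theorem cutoff_nonneg (t : ℝ) : 0 ≤ cutoff t := Real.smoothTransition.nonneg _

theorem cutoff_le_one (t : ℝ) : cutoff t ≤ 1 := Real.smoothTransition.le_one _

theorem cutoff_of_le {t : ℝ} (h : t ≤ 1) : cutoff t = 1 :=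
  Real.smoothTransition.one_of_one_le (by linarith)

theorem cutoff_of_ge {t : ℝ} (h : 4 ≤ t) : cutoff t = 0 :=
  Real.smoothTransition.zero_of_nonpos (by linarith)

theorem cutoff_antitone : Antitone cutoff := fun s t h =>
  Real.smoothTransition.monotone (by linarith)

/-- The derivatives of `cutoff` are bounded in the scale-invariant sense, by compactness of the
interval on which they live. -/
theorem exists_cutoff_bound : ∃ C : ℝ, 1 ≤ C ∧ ∀ t, 0 ≤ t →
    |deriv cutoff t| * t ≤ C ∧ |deriv (deriv cutoff) t| * t ^ 2 ≤ C := by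
  have h1 := contDiff_deriv_cutoff
  have h2 : Continuous (deriv (deriv cutoff)) := h1.continuous_deriv le_rfl
  obtain ⟨B₁, hB₁⟩ := isCompact_Icc.exists_bound_of_continuousOn (s := Set.Icc (0 : ℝ) 5)
    (f := fun t => deriv cutoff t * t) (by have := h1.continuous; fun_prop)
  obtain ⟨B₂, hB₂⟩ := isCompact_Icc.exists_bound_of_continuousOn (s := Set.Icc (0 : ℝ) 5)
    (f := fun t => deriv (deriv cutoff) t * t ^ 2) (by fun_prop)
  refine ⟨max 1 (max B₁ B₂), le_max_left _ _, fun t ht => ?_⟩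
  rcases le_or_gt t 5 with h5 | h5
  · have e1 := hB₁ t ⟨ht, h5⟩
    have e2 := hB₂ t ⟨ht, h5⟩
    rw [Real.norm_eq_abs, abs_mul, abs_of_nonneg ht] at e1
    rw [Real.norm_eq_abs, abs_mul, abs_of_nonneg (sq_nonneg t)] at e2
    exact ⟨e1.trans ((le_max_left _ _).trans (le_max_right _ _)),
      e2.trans ((le_max_right _ _).trans (le_max_right _ _))⟩
  · have z : cutoff =ᶠ[𝓝 t] fun _ => 0 := by
      filter_upwards [lt_mem_nhds (by linarith : 4 < t)] with s hs
      exact cutoff_of_ge hs.le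
    have z1 : deriv cutoff =ᶠ[𝓝 t] fun _ => 0 := by simpa using z.deriv
    have e1 : deriv cutoff t = 0 := z1.self_of_nhds
    have e2 : deriv (deriv cutoff) t = 0 := by simpa using z1.deriv_eq
    rw [e1, e2]
    simp

theorem exists_symbolAt_cutoff : ∃ C : ℝ, 1 ≤ C ∧ ∀ (e x : R3) (c : ℝ), x ≠ e → 0 ≤ c →
    SymbolAt (fun y => cutoff (c * ‖y - e‖ ^ 2)) x C (3 / ‖x - e‖) := by
  obtain ⟨C, hC1, hC⟩ := exists_cutoff_bound
  refine ⟨4 * C, by linarith, fun e x c hx hc => ?_⟩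
  set t := ‖x - e‖ ^ 2 with ht
  have hd : ∀ s, HasDerivAt cutoff (deriv cutoff s) s := fun s =>
    (contDiff_cutoff.differentiable (by simp)).differentiableAt.hasDerivAt
  have h1 := contDiff_deriv_cutoff
  have hd2 : ∀ s, HasDerivAt (deriv cutoff) (deriv (deriv cutoff) s) s := fun s =>
    (h1.differentiable (by simp)).differentiableAt.hasDerivAt
  have hm : ∀ s, HasDerivAt (fun s : ℝ => c * s) c s := fun s => by
    simpa using (hasDerivAt_id s).const_mul c
  have hb := hC (c * t) (by positivity)
  refine (symbolAt_norm_sub_sq hx).comp (φ := fun s => cutoff (c * s))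
    (φ' := fun s => deriv cutoff (c * s) * c) (φ'' := deriv (deriv cutoff) (c * t) * c * c)
    (M := C) (by positivity) ?_ ?_ ?_ ?_ ?_ ?_
  · exact (contDiff_cutoff.comp (contDiff_const.mul contDiff_id)).contDiffAt
  · exact Filter.Eventually.of_forall fun s => (hd (c * s)).comp s (hm s)
  · exact ((hd2 (c * t)).comp t (hm t)).mul_const c
  · rw [abs_of_nonneg (cutoff_nonneg _)]
    exact (cutoff_le_one _).trans hC1
  · rw [abs_mul, abs_of_nonneg hc]
    linarith [hb.1]
  · rw [abs_mul, abs_mul, abs_of_nonneg hc]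
    linarith [hb.2]

/-- The dyadic bump at scale `R`, as a function of the squared radius; it is supported in the
annulus `R ≤ |x| ≤ 4 R`. -/
noncomputable def annulus (R t : ℝ) : ℝ := cutoff ((4 * R ^ 2)⁻¹ * t) - cutoff ((R ^ 2)⁻¹ * t)

theorem annulus_nonneg {R t : ℝ} (hR : 0 < R) (ht : 0 ≤ t) : 0 ≤ annulus R t := by
  refine sub_nonneg.2 (cutoff_antitone ?_)
  gcongr
  linarith [sq_nonneg R]

theorem annulus_of_le {R t : ℝ} (hR : 0 < R) (h : t ≤ R ^ 2) : annulus R t = 0 := by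
  have h2 : 0 < R ^ 2 := by positivity
  rw [annulus, cutoff_of_le, cutoff_of_le, sub_self]
  · rw [inv_mul_le_iff₀ h2]; linarith
  · rw [inv_mul_le_iff₀ (by positivity)]; linarith

theorem annulus_of_ge {R t : ℝ} (hR : 0 < R) (h : (4 * R) ^ 2 ≤ t) : annulus R t = 0 := by
  have h2 : 0 < R ^ 2 := by positivity
  rw [annulus, cutoff_of_ge, cutoff_of_ge, sub_self]
  · rw [le_inv_mul_iff₀ h2]; linarith
  · rw [le_inv_mul_iff₀ (by positivity)]; linarith

/-- A two-sided telescoping sum of an eventually constant monotone sequence. -/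
theorem hasSum_sub_of_monotone {g : ℤ → ℝ} {b c : ℝ} (hg : Monotone g)
    (hc : ∀ᶠ n : ℕ in Filter.atTop, g n = c) (hb : ∀ᶠ n : ℕ in Filter.atTop, g (-n) = b) :
    HasSum (fun j : ℤ => g (j + 1) - g j) (c - b) := by
  have hnn : ∀ j : ℤ, 0 ≤ g (j + 1) - g j := fun j => sub_nonneg.2 (hg (by linarith))
  have hp : HasSum (fun n : ℕ => g ((n : ℤ) + 1) - g n) (c - g 0) := by
    rw [hasSum_iff_tendsto_nat_of_nonneg (fun n => hnn n)]
    have : ∀ n : ℕ, ∑ i ∈ Finset.range n, (g ((i : ℤ) + 1) - g i) = g n - g 0 := by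
      intro n
      have := Finset.sum_range_sub (fun n : ℕ => g n) n
      push_cast at this
      exact this
    simp only [this]
    refine Filter.Tendsto.congr' ?_ tendsto_const_nhds
    filter_upwards [hc] with n hn
    rw [hn]
  have hm : HasSum (fun n : ℕ => g (-((n : ℤ) + 1) + 1) - g (-((n : ℤ) + 1))) (g 0 - b) := by
    rw [hasSum_iff_tendsto_nat_of_nonneg (fun n => hnn _)]
    have : ∀ n : ℕ, ∑ i ∈ Finset.range n, (g (-((i : ℤ) + 1) + 1) - g (-((i : ℤ) + 1)))
        = g 0 - g (-(n : ℤ)) := by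
      intro n
      have := Finset.sum_range_sub' (fun n : ℕ => g (-(n : ℤ))) n
      push_cast at this
      rw [neg_zero] at this
      rw [← this]
      refine Finset.sum_congr rfl fun i _ => ?_
      rw [show -((i : ℤ) + 1) + 1 = -(i : ℤ) by ring]
    simp only [this]
    refine Filter.Tendsto.congr' ?_ tendsto_const_nhds
    filter_upwards [hb] with n hn
    rw [hn]
  have := HasSum.of_nat_of_neg_add_one (f := fun j : ℤ => g (j + 1) - g j) hp hm
  rwa [sub_add_sub_cancel] at this

theorem hasSum_annulus {t : ℝ} (ht : 0 < t) : HasSum (fun j : ℤ => annulus ((2 : ℝ) ^ j) t) 1 := by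
  set g : ℤ → ℝ := fun j => cutoff ((((2 : ℝ) ^ j) ^ 2)⁻¹ * t) with hg
  have h1 : (fun j : ℤ => annulus ((2 : ℝ) ^ j) t) = fun j => g (j + 1) - g j := by
    ext j
    simp only [annulus, hg]
    rw [zpow_add_one₀ (by norm_num : (2 : ℝ) ≠ 0), mul_pow, mul_comm _ ((2 : ℝ) ^ 2)]
    norm_num
  have h4 : Filter.Tendsto (fun n : ℕ => (4 : ℝ) ^ n) Filter.atTop Filter.atTop :=
    tendsto_pow_atTop_atTop_of_one_lt (by norm_num)
  have e4 : ∀ n : ℕ, ((2 : ℝ) ^ n) ^ 2 = 4 ^ n := fun n => by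
    rw [← pow_mul, mul_comm, pow_mul]; norm_num
  rw [h1, ← sub_zero (1 : ℝ)]
  refine hasSum_sub_of_monotone (fun i j hij => cutoff_antitone ?_) ?_ ?_
  · have : (2 : ℝ) ^ i ≤ 2 ^ j := zpow_le_zpow_right₀ (by norm_num) hij
    have h0 : (0 : ℝ) < 2 ^ i := by positivity
    gcongr
  · filter_upwards [h4.eventually_ge_atTop t] with n hn
    simp only [hg, zpow_natCast]
    apply cutoff_of_le
    rw [e4, inv_mul_le_iff₀ (by positivity)]
    linarith
  · filter_upwards [h4.eventually_ge_atTop (4 / t)] with n hn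
    simp only [hg, zpow_neg, zpow_natCast, inv_pow, inv_inv]
    apply cutoff_of_ge
    rw [e4]
    rwa [div_le_iff₀ ht] at hn

theorem exists_symbolAt_annulus : ∃ C : ℝ, 1 ≤ C ∧ ∀ (e x : R3) (R : ℝ), x ≠ e → 0 < R →
    SymbolAt (fun y => annulus R (‖y - e‖ ^ 2)) x C (3 / ‖x - e‖) := by
  obtain ⟨C, hC1, hC⟩ := exists_symbolAt_cutoff
  exact ⟨C + C, by linarith, fun e x R hx hR =>
    (hC e x _ hx (by positivity)).sub (hC e x _ hx (by positivity))⟩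

theorem symbolAt_of_iteratedFDeriv {u : R3 → ℝ} {x : R3} {A m : ℝ} (hu : ContDiffAt ℝ 2 u x)
    (hm : 0 < m) (h : ∀ k : ℕ, k ≤ 2 → m ^ k * ‖iteratedFDeriv ℝ k u x‖ ≤ A) :
    SymbolAt u x (3 * A) (1 / m) := by
  have h0 := h 0 (by norm_num)
  have h1 := h 1 (by norm_num)
  have h2 := h 2 le_rfl
  simp only [pow_zero, one_mul, norm_iteratedFDeriv_zero, Real.norm_eq_abs] at h0
  rw [pow_one, norm_iteratedFDeriv_one] at h1
  have hA : 0 ≤ A := (abs_nonneg _).trans h0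
  refine ⟨hu, by linarith, ?_, ?_⟩
  · rw [mul_one_div, le_div_iff₀ hm]
    linarith
  · rw [laplacian_eq_iteratedFDeriv_orthonormalBasis u (EuclideanSpace.basisFun (Fin 3) ℝ)]
    beta_reduce
    have : ∀ i, |iteratedFDeriv ℝ 2 u x ![EuclideanSpace.basisFun (Fin 3) ℝ i,
        EuclideanSpace.basisFun (Fin 3) ℝ i]| ≤ ‖iteratedFDeriv ℝ 2 u x‖ := by
      intro i
      have := (iteratedFDeriv ℝ 2 u x).le_opNorm ![EuclideanSpace.basisFun (Fin 3) ℝ i,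
        EuclideanSpace.basisFun (Fin 3) ℝ i]
      simpa [Fin.prod_univ_two] using this
    rw [one_div, inv_pow, ← div_eq_mul_inv, le_div_iff₀ (by positivity), Fin.sum_univ_three]
    have h3 := (abs_add_three _ _ _).trans
      (add_le_add (add_le_add (this 0) (this 1)) (this 2))
    nlinarith [sq_nonneg m]

theorem IsCutoff.symbolAt_left {c A : ℝ} {χ : R3 → R3 → ℝ} (h : IsCutoff c A χ) {ξ η : R3}
    (h1 : ξ ≠ 0) (h2 : ξ ≠ η) :
    SymbolAt (fun x => χ x η) ξ (3 * A) (1 / min ‖ξ‖ ‖ξ - η‖) := by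
  refine symbolAt_of_iteratedFDeriv ?_
    (lt_min (norm_pos_iff.2 h1) (norm_pos_iff.2 (sub_ne_zero.2 h2)))
    fun k hk => h.bound_xi k hk ξ η
  have := (contDiff_infty.1 h.smooth 2).comp
    (contDiff_id.prodMk contDiff_const : ContDiff ℝ (2 : ℕ) fun x : R3 => (x, η))
  exact_mod_cast this.contDiffAt

theorem IsCutoff.symbolAt_right {c A : ℝ} {χ : R3 → R3 → ℝ} (h : IsCutoff c A χ) {ξ η : R3}
    (h1 : η ≠ 0) (h2 : η ≠ ξ) :
    SymbolAt (fun y => χ ξ y) η (3 * A) (1 / min ‖η‖ ‖η - ξ‖) := by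
  rw [norm_sub_rev]
  refine symbolAt_of_iteratedFDeriv ?_
    (lt_min (norm_pos_iff.2 h1) (norm_pos_iff.2 (sub_ne_zero.2 h2.symm)))
    fun k hk => h.bound_eta k hk ξ η
  have := (contDiff_infty.1 h.smooth 2).comp
    (contDiff_const.prodMk contDiff_id : ContDiff ℝ (2 : ℕ) fun y : R3 => (ξ, y))
  exact_mod_cast this.contDiffAt

theorem isCutoff_one : IsCutoff 0 1 fun _ _ => 1 where
  smooth := contDiff_const
  support := fun ξ η _ => le_max_of_le_left (norm_nonneg ξ)
  bound_xi := fun k hk ξ η => by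
    rcases Nat.eq_zero_or_pos k with rfl | h
    · simp
    · rw [iteratedFDeriv_const_of_ne h.ne']; simp
  bound_eta := fun k hk ξ η => by
    rcases Nat.eq_zero_or_pos k with rfl | h
    · simp
    · rw [iteratedFDeriv_const_of_ne h.ne']; simp

/-! ### The dispersion relation and the size of the phase -/

theorem p_nonneg (x : R3) : 0 ≤ p x := by unfold p; positivity

theorem p_neg (x : R3) : p (-x) = p x := by simp [p]

theorem p_eq_mul (x : R3) : p x = ‖x‖ * Real.sqrt (1 + (1 + ‖x‖ ^ 2)⁻¹) := by
  rw [p]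
  congr 2
  field_simp
  ring

theorem p_sq (x : R3) : p x ^ 2 = (1 + ‖x‖ ^ 2) - (1 + ‖x‖ ^ 2)⁻¹ := by
  rw [p_eq_mul, mul_pow, Real.sq_sqrt (by positivity)]
  field_simp
  ring

theorem norm_le_p (x : R3) : ‖x‖ ≤ p x := by
  rw [p_eq_mul]
  refine le_mul_of_one_le_right (norm_nonneg _) (Real.one_le_sqrt.2 ?_)
  have : 0 < (1 + ‖x‖ ^ 2)⁻¹ := by positivity
  linarith

theorem sqrt_one_add_le {w : ℝ} (hw : w ≤ 1) : Real.sqrt (1 + w) ≤ 3 / 2 :=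
  Real.sqrt_le_iff.2 ⟨by norm_num, by linarith⟩

theorem inv_one_add_sq_le_one (t : ℝ) : (1 + t ^ 2)⁻¹ ≤ 1 :=
  inv_le_one_of_one_le₀ (by linarith [sq_nonneg t])

theorem p_le (x : R3) : p x ≤ 3 / 2 * ‖x‖ := by
  rw [p_eq_mul, mul_comm]
  exact mul_le_mul_of_nonneg_right (sqrt_one_add_le (inv_one_add_sq_le_one _)) (norm_nonneg _)

/-- The difference of the squares `p(x)² = (1 + |x|²) - 1 / (1 + |x|²)`, factored. -/
theorem p_sub_mul (x y : R3) : (p x - p y) * (p x + p y) =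
    (‖x‖ - ‖y‖) * (‖x‖ + ‖y‖) * (1 + (1 + ‖x‖ ^ 2)⁻¹ * (1 + ‖y‖ ^ 2)⁻¹) := by
  have : (p x - p y) * (p x + p y) = p x ^ 2 - p y ^ 2 := by ring
  rw [this, p_sq, p_sq]
  field_simp
  ring

theorem p_sub_ge {x y : R3} (h : ‖y‖ ≤ ‖x‖) : 2 / 3 * (‖x‖ - ‖y‖) ≤ p x - p y := by
  rcases eq_or_lt_of_le (norm_nonneg x) with h0 | h0
  · have : x = 0 := norm_eq_zero.1 h0.symm
    have hy : y = 0 := norm_eq_zero.1 (le_antisymm (by rwa [← h0] at h) (norm_nonneg y))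
    simp [this, hy]
  have e := p_sub_mul x y
  have h1 : 0 < (1 + ‖x‖ ^ 2)⁻¹ * (1 + ‖y‖ ^ 2)⁻¹ := by positivity
  have h2 : (‖x‖ - ‖y‖) * (‖x‖ + ‖y‖) ≤ (p x - p y) * (p x + p y) := by
    rw [e]
    exact le_mul_of_one_le_right (mul_nonneg (by linarith) (by positivity)) (by linarith)
  have h3 := p_le x
  have h4 := p_le y
  have h5 : 0 < p x + p y := by linarith [norm_le_p x, p_nonneg y]
  refine le_of_mul_le_mul_right (le_trans ?_ h2) h5
  nlinarith [norm_nonneg y]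

theorem p_sub_le (x y : R3) : p x - p y ≤ 2 * |‖x‖ - ‖y‖| := by
  rcases le_or_gt (p x - p y) 0 with h | h
  · exact h.trans (by positivity)
  have e := p_sub_mul x y
  have hx := norm_le_p x
  have hy := norm_le_p y
  have h1 : (1 + ‖x‖ ^ 2)⁻¹ * (1 + ‖y‖ ^ 2)⁻¹ ≤ 1 :=
    mul_le_one₀ (inv_one_add_sq_le_one _) (by positivity) (inv_one_add_sq_le_one _)
  have h0 : 0 < p x + p y := by linarith [p_nonneg y]
  have h2 : (‖x‖ - ‖y‖) ≤ |‖x‖ - ‖y‖| := le_abs_self _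
  refine le_of_mul_le_mul_right ?_ h0
  rw [e]
  have hw : 0 < (1 + ‖x‖ ^ 2)⁻¹ * (1 + ‖y‖ ^ 2)⁻¹ := by positivity
  calc (‖x‖ - ‖y‖) * (‖x‖ + ‖y‖) * (1 + (1 + ‖x‖ ^ 2)⁻¹ * (1 + ‖y‖ ^ 2)⁻¹)
      ≤ |‖x‖ - ‖y‖| * (‖x‖ + ‖y‖) * (1 + 1) := by gcongr
    _ ≤ |‖x‖ - ‖y‖| * (p x + p y) * (1 + 1) := by gcongr
    _ = 2 * |‖x‖ - ‖y‖| * (p x + p y) := by ring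

theorem sqrt_sub_ge {u v : ℝ} (hu : 0 ≤ u) (huv : u ≤ v) (hv : v ≤ 1) :
    (v - u) / 3 ≤ Real.sqrt (1 + v) - Real.sqrt (1 + u) := by
  have h1 := sqrt_one_add_le hv
  have h2 := sqrt_one_add_le (huv.trans hv)
  have h3 : Real.sqrt (1 + u) ≤ Real.sqrt (1 + v) := Real.sqrt_le_sqrt (by linarith)
  have e1 := Real.sq_sqrt (by linarith : 0 ≤ 1 + u)
  have e2 := Real.sq_sqrt (by linarith : 0 ≤ 1 + v)
  nlinarith

/-- Quantitative strict subadditivity of the dispersion relation. -/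
theorem subadditive_gap {a b : ℝ} (ha : 0 ≤ a) (hb : 0 ≤ b) :
    1 / 6 * (a * b * (a + b) / ((1 + a ^ 2) * (1 + b ^ 2))) ≤
      a * Real.sqrt (1 + (1 + a ^ 2)⁻¹) + b * Real.sqrt (1 + (1 + b ^ 2)⁻¹)
        - (a + b) * Real.sqrt (1 + (1 + (a + b) ^ 2)⁻¹) := by
  have h0 : 0 ≤ (1 + (a + b) ^ 2)⁻¹ := by positivity
  have h1 : (1 + (a + b) ^ 2)⁻¹ ≤ (1 + a ^ 2)⁻¹ := by gcongr; linarith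
  have h2 : (1 + (a + b) ^ 2)⁻¹ ≤ (1 + b ^ 2)⁻¹ := by gcongr; linarith
  have g1 := mul_le_mul_of_nonneg_left (sqrt_sub_ge h0 h1 (inv_one_add_sq_le_one _)) ha
  have g2 := mul_le_mul_of_nonneg_left (sqrt_sub_ge h0 h2 (inv_one_add_sq_le_one _)) hb
  have key : 1 / 6 * (a * b * (a + b) / ((1 + a ^ 2) * (1 + b ^ 2))) ≤
      a * (((1 + a ^ 2)⁻¹ - (1 + (a + b) ^ 2)⁻¹) / 3) +
        b * (((1 + b ^ 2)⁻¹ - (1 + (a + b) ^ 2)⁻¹) / 3) := by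
    have e : a * (((1 + a ^ 2)⁻¹ - (1 + (a + b) ^ 2)⁻¹) / 3) +
        b * (((1 + b ^ 2)⁻¹ - (1 + (a + b) ^ 2)⁻¹) / 3) =
        a * b * ((2 * a + b) * (1 + b ^ 2) + (a + 2 * b) * (1 + a ^ 2)) /
          (3 * (1 + (a + b) ^ 2) * ((1 + a ^ 2) * (1 + b ^ 2))) := by
      field_simp
      ring
    rw [e, ← mul_div_assoc, div_le_div_iff₀ (by positivity) (by positivity)]
    have : 1 / 6 * ((a + b) * (3 * (1 + (a + b) ^ 2))) ≤
        (2 * a + b) * (1 + b ^ 2) + (a + 2 * b) * (1 + a ^ 2) := by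
      nlinarith [mul_nonneg ha hb, mul_nonneg ha (sq_nonneg (a - b)),
        mul_nonneg hb (sq_nonneg (a - b)), mul_nonneg ha (sq_nonneg a),
        mul_nonneg hb (sq_nonneg b), mul_nonneg ha (sq_nonneg b), mul_nonneg hb (sq_nonneg a)]
    have h3 : 0 ≤ a * b * ((1 + a ^ 2) * (1 + b ^ 2)) := by positivity
    nlinarith [mul_le_mul_of_nonneg_left this h3]
  linarith

/-- The lower bound for `-Φ₁`. The first term is the growth of `p` from `|ξ|` to `|ξ - η| + |η|`,
the second one the strict subadditivity of `p` for parallel frequencies. -/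
theorem phase_lower {ξ η : R3} :
    2 / 3 * (‖ξ - η‖ + ‖η‖ - ‖ξ‖) +
      1 / 6 * (‖ξ - η‖ * ‖η‖ * (‖ξ - η‖ + ‖η‖) / ((1 + ‖ξ - η‖ ^ 2) * (1 + ‖η‖ ^ 2)))
      ≤ -Phi1 ξ η := by
  have hr : ‖ξ‖ ≤ ‖ξ - η‖ + ‖η‖ := by simpa using norm_add_le (ξ - η) η
  -- a vector of length `|ξ - η| + |η|`
  obtain ⟨z, hz⟩ : ∃ z : R3, ‖z‖ = ‖ξ - η‖ + ‖η‖ :=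
    ⟨EuclideanSpace.single 0 (‖ξ - η‖ + ‖η‖), by
      rw [PiLp.norm_single, Real.norm_of_nonneg (by positivity)]⟩
  have h1 := p_sub_ge (x := z) (y := ξ) (by rw [hz]; exact hr)
  have h2 := subadditive_gap (norm_nonneg (ξ - η)) (norm_nonneg η)
  rw [← hz, ← p_eq_mul, ← p_eq_mul, ← p_eq_mul] at h2
  rw [hz] at h1 h2
  rw [Phi1]
  linarith

theorem phase_neg {ξ η : R3} (h1 : ξ ≠ η) (h2 : η ≠ 0) : Phi1 ξ η < 0 := by
  have ha : 0 < ‖ξ - η‖ := norm_pos_iff.2 (sub_ne_zero.2 h1)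
  have hb : 0 < ‖η‖ := norm_pos_iff.2 h2
  have hr : ‖ξ‖ ≤ ‖ξ - η‖ + ‖η‖ := by simpa using norm_add_le (ξ - η) η
  have := phase_lower (ξ := ξ) (η := η)
  have h3 : 0 < ‖ξ - η‖ * ‖η‖ * (‖ξ - η‖ + ‖η‖) / ((1 + ‖ξ - η‖ ^ 2) * (1 + ‖η‖ ^ 2)) := by
    positivity
  linarith

theorem phase_upper (ξ η : R3) : -Phi1 ξ η ≤ 4 * min ‖ξ - η‖ ‖η‖ := by
  have h1 := p_sub_le (ξ - η) ξ
  have h2 := p_sub_le η ξ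
  have h3 : |‖ξ - η‖ - ‖ξ‖| ≤ ‖η‖ := by
    simpa using abs_norm_sub_norm_le (ξ - η) ξ
  have h4 : |‖η‖ - ‖ξ‖| ≤ ‖ξ - η‖ := by
    rw [norm_sub_rev]; exact abs_norm_sub_norm_le η ξ
  have h5 := p_le η
  have h6 := p_le (ξ - η)
  have := norm_nonneg η
  have := norm_nonneg (ξ - η)
  rw [Phi1]
  rcases le_total ‖ξ - η‖ ‖η‖ with h | h
  · rw [min_eq_left h]; linarith
  · rw [min_eq_right h]; linarith

/-- With `w = 1 / (1 + |x|²)`, the gradient of the dispersion relation at `x` is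
`gradFactor w * x / |x|`. -/
noncomputable def gradFactor (w : ℝ) : ℝ := (1 + w ^ 2) / Real.sqrt (1 + w)

/-- With `w = 1 / (1 + |x|²)`, the Laplacian of the dispersion relation at `x` is
`laplacianFactor w / |x|`. -/
noncomputable def laplacianFactor (w : ℝ) : ℝ :=
  (3 * (1 + w ^ 2) - 4 * (1 - w) * w ^ 2) / Real.sqrt (1 + w)
    - (1 + w ^ 2) ^ 2 / Real.sqrt (1 + w) ^ 3

/-- A `C¹` function on `[0, 1]` is bounded and Lipschitz, with a common constant. -/
theorem exists_bound_and_lipschitz {f : ℝ → ℝ} (hf : ContDiffOn ℝ 1 f (Set.Icc 0 1)) :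
    ∃ B : ℝ, 1 ≤ B ∧ (∀ w ∈ Set.Icc (0 : ℝ) 1, |f w| ≤ B) ∧
      ∀ w ∈ Set.Icc (0 : ℝ) 1, ∀ w' ∈ Set.Icc (0 : ℝ) 1, |f w - f w'| ≤ B * |w - w'| := by
  obtain ⟨K, hK⟩ := hf.exists_lipschitzOnWith (by simp) (convex_Icc 0 1) isCompact_Icc
  obtain ⟨B, hB⟩ := isCompact_Icc.exists_bound_of_continuousOn hf.continuousOn
  refine ⟨max 1 (max K B), le_max_left _ _, fun w hw => (hB w hw).trans ?_, fun w hw w' hw' => ?_⟩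
  · exact (le_max_right _ _).trans (le_max_right _ _)
  · have := hK.dist_le_mul w hw w' hw'
    rw [Real.dist_eq, Real.dist_eq] at this
    refine this.trans (mul_le_mul_of_nonneg_right ?_ (abs_nonneg _))
    exact (le_max_left _ _).trans (le_max_right _ _)

theorem contDiffOn_sqrt_one_add : ContDiffOn ℝ 1 (fun w : ℝ => Real.sqrt (1 + w)) (Set.Icc 0 1) :=
  (contDiffOn_const.add contDiffOn_id).sqrt fun w hw => by
    have := hw.1
    simp; positivity

theorem contDiffOn_gradFactor : ContDiffOn ℝ 1 gradFactor (Set.Icc 0 1) := by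
  refine ContDiffOn.div (by fun_prop) contDiffOn_sqrt_one_add fun w hw => ?_
  have := hw.1
  positivity

theorem contDiffOn_laplacianFactor : ContDiffOn ℝ 1 laplacianFactor (Set.Icc 0 1) := by
  refine (ContDiffOn.div (by fun_prop) contDiffOn_sqrt_one_add fun w hw => ?_).sub
    (ContDiffOn.div (by fun_prop) (contDiffOn_sqrt_one_add.pow 3) fun w hw => ?_)
  all_goals
    have := hw.1
    positivity

theorem p_eq_sqrt (x : R3) :
    p x = Real.sqrt ((1 + ‖x‖ ^ 2) - (1 + ‖x‖ ^ 2)⁻¹) := by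
  rw [← p_sq, Real.sqrt_sq (p_nonneg x)]

/-- The gradient and the Laplacian of the translated dispersion relation. Both are `C¹` functions of
`w = 1 / (1 + |x|²)`, up to the singular factors of a radial function. -/
theorem p_derivatives {e x : R3} (h : x ≠ e) :
    ContDiffAt ℝ 2 (fun y => p (y - e)) x ∧
    fderiv ℝ (fun y => p (y - e)) x =
      innerSL ℝ ((gradFactor (1 + ‖x - e‖ ^ 2)⁻¹ / ‖x - e‖) • (x - e)) ∧
    Δ (fun y => p (y - e)) x = laplacianFactor (1 + ‖x - e‖ ^ 2)⁻¹ / ‖x - e‖ := by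
  have h0 : 0 < ‖x - e‖ := norm_pos_iff.2 (sub_ne_zero.2 h)
  set t := ‖x - e‖ ^ 2 with ht
  have ht0 : 0 < t := by positivity
  have hpos : ∀ s : ℝ, 0 < s → 0 < (1 + s) - (1 + s)⁻¹ := fun s hs => by
    have : (1 + s)⁻¹ < 1 := inv_lt_one_of_one_lt₀ (by linarith)
    linarith
  set P := Real.sqrt ((1 + t) - (1 + t)⁻¹) with hP
  have hP0 : 0 < P := Real.sqrt_pos.2 (hpos t ht0)
  have hPp : P = ‖x - e‖ * Real.sqrt (1 + (1 + t)⁻¹) := by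
    rw [hP, ht, ← p_eq_sqrt, p_eq_mul]
  -- the profile `√((1 + s) - 1 / (1 + s))` of `p` in the variable `s = |x|²`
  set ψ' : ℝ → ℝ := fun s => 1 + ((1 + s) ^ 2)⁻¹ with hψ'
  set φ : ℝ → ℝ := fun s => Real.sqrt ((1 + s) - (1 + s)⁻¹) with hφ
  set φ' : ℝ → ℝ := fun s => ψ' s / (2 * φ s) with hφ'
  set φ'' : ℝ := -((1 + t) ^ 3)⁻¹ / P - ψ' t ^ 2 / (4 * P ^ 3) with hφ''
  have hψd : ∀ s, 0 < s → HasDerivAt (fun s : ℝ => (1 + s) - (1 + s)⁻¹) (ψ' s) s := by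
    intro s hs
    have h1 : HasDerivAt (fun s : ℝ => 1 + s) 1 s := (hasDerivAt_id s).const_add 1
    refine (h1.sub (h1.inv (by positivity))).congr_deriv ?_
    simp only [hψ']
    ring
  have hd1 : ∀ s, 0 < s → HasDerivAt φ (φ' s) s := fun s hs =>
    (hψd s hs).sqrt (hpos s hs).ne'
  have hd2 : HasDerivAt φ' φ'' t := by
    have h1 : HasDerivAt (fun s : ℝ => (1 + s) ^ 2) (2 * (1 + t)) t := by
      have := ((hasDerivAt_id t).const_add 1).fun_pow 2
      simpa using this
    have h2 : HasDerivAt ψ' (-(2 * (1 + t)) / ((1 + t) ^ 2) ^ 2) t :=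
      (h1.inv (by positivity)).const_add 1
    refine (h2.div ((hd1 t ht0).const_mul 2) (by positivity)).congr_deriv ?_
    simp only [hφ', hφ'']
    rw [show φ t = P from rfl]
    field_simp
    ring
  have hcd : ContDiffAt ℝ 2 φ t := by
    refine ContDiffAt.sqrt ?_ (hpos t ht0).ne'
    have h1 : ContDiffAt ℝ 2 (fun s : ℝ => 1 + s) t := contDiffAt_const.add contDiffAt_id
    exact h1.sub (h1.inv (by positivity))
  have hpφ : (fun y => p (y - e)) = fun y => φ (‖y - e‖ ^ 2) := by
    ext y
    rw [p_eq_sqrt]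
  have hev : ∀ᶠ s in 𝓝 t, HasDerivAt φ (φ' s) s := by
    filter_upwards [lt_mem_nhds ht0] with s hs using hd1 s hs
  have hq : 0 < Real.sqrt (1 + (1 + t)⁻¹) := by positivity
  have hqs : Real.sqrt (1 + (1 + t)⁻¹) ^ 2 = 1 + (1 + t)⁻¹ := Real.sq_sqrt (by positivity)
  rw [hpφ]
  refine ⟨ContDiffAt.comp (g := φ) x hcd (contDiff_norm_sub_sq e).contDiffAt, ?_, ?_⟩
  · rw [fderiv_comp_apply (hd1 t ht0) (hasFDerivAt_norm_sub_sq e x).differentiableAt,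
      (hasFDerivAt_norm_sub_sq e x).fderiv, ← Nat.cast_smul_eq_nsmul ℝ, smul_smul, map_smul]
    congr 1
    simp only [hφ', gradFactor, hψ']
    rw [show φ t = P from rfl, hPp]
    field_simp
    push_cast
    ring
  · rw [laplacian_comp_apply (contDiff_norm_sub_sq e).contDiffAt hev hd2,
      sum_partialDeriv_norm_sub_sq, laplacian_norm_sub_sq, ← ht, hφ'', hφ', laplacianFactor]
    simp only [hψ']
    rw [show φ t = P from rfl, hPp]
    set q := Real.sqrt (1 + (1 + t)⁻¹)
    set a := ‖x - e‖
    have hw : t = (1 + t) - 1 := by ring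
    rw [ht]
    field_simp
    ring

/-! ### The phase as a symbol -/

theorem inv_one_add_sq_mem (t : ℝ) : (1 + t ^ 2)⁻¹ ∈ Set.Icc (0 : ℝ) 1 :=
  ⟨by positivity, inv_one_add_sq_le_one t⟩

theorem abs_inv_sub_inv (r a : ℝ) : |(1 + r ^ 2)⁻¹ - (1 + a ^ 2)⁻¹| =
    |r - a| * |r + a| / ((1 + r ^ 2) * (1 + a ^ 2)) := by
  have : (1 + r ^ 2)⁻¹ - (1 + a ^ 2)⁻¹ = -((r - a) * (r + a) / ((1 + r ^ 2) * (1 + a ^ 2))) := by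
    field_simp
    ring
  rw [this, abs_neg, abs_div, abs_mul, abs_of_pos (by positivity : 0 < (1 + r ^ 2) * (1 + a ^ 2))]

theorem one_add_sq_le_mul {r a b : ℝ} (hb : 0 ≤ b) (h : b ≤ r + a) :
    1 + b ^ 2 ≤ 2 * ((1 + r ^ 2) * (1 + a ^ 2)) := by
  have : b ^ 2 ≤ (r + a) ^ 2 := pow_le_pow_left₀ hb h 2
  nlinarith [sq_nonneg (r - a), sq_nonneg (r * a)]

/-- The square of `b (r + a) / ((1 + r²) (1 + a²))`, which bounds the difference of the group speeds
at the frequencies `r` and `a`, is at most `144 κ F` with `κ = b / (r a)` and `F` the phase. -/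
theorem sq_mul_le_phase {r a b F : ℝ} (hr : 0 < r) (ha : 0 < a) (hb : 0 < b) (h1 : r ≤ a + b)
    (h3 : b ≤ r + a)
    (hF : 2 / 3 * (a + b - r) + 1 / 6 * (a * b * (a + b) / ((1 + a ^ 2) * (1 + b ^ 2))) ≤ F) :
    b * (r + a) ^ 2 * (r * a) ≤ 144 * (F * ((1 + r ^ 2) * (1 + a ^ 2)) ^ 2) := by
  have hS : 0 < a * b * (a + b) / ((1 + a ^ 2) * (1 + b ^ 2)) := by positivity
  have hvr : 1 ≤ 1 + r ^ 2 := by nlinarith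
  have hva : 1 ≤ 1 + a ^ 2 := by nlinarith
  rcases le_total (2 * r) a with h | h
  · have f1 : a / 3 ≤ F := by linarith
    have e1 : b * (r + a) ^ 2 * (r * a) ≤ (3 / 2 * a) * (3 / 2 * a) ^ 2 * (r * a) := by
      gcongr <;> linarith
    have e2 : r * a ^ 3 ≤ ((1 + r ^ 2) * (1 + a ^ 2)) ^ 2 := by
      have g1 : r ≤ (1 + r ^ 2) ^ 2 := by nlinarith [sq_nonneg (r - 1), sq_nonneg (r ^ 2)]
      have g2 : a ^ 3 ≤ (1 + a ^ 2) ^ 2 := by nlinarith [sq_nonneg (a ^ 2 - a)]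
      rw [mul_pow]
      exact mul_le_mul g1 g2 (by positivity) (by positivity)
    have e3 : a / 3 * ((1 + r ^ 2) * (1 + a ^ 2)) ^ 2 ≤ F * ((1 + r ^ 2) * (1 + a ^ 2)) ^ 2 :=
      mul_le_mul_of_nonneg_right f1 (by positivity)
    nlinarith [mul_le_mul_of_nonneg_left e2 ha.le]
  · have f1 : 1 / 6 * (a * b * (a + b) / ((1 + a ^ 2) * (1 + b ^ 2))) ≤ F := by linarith
    have hvb : 1 + b ^ 2 ≤ 2 * ((1 + r ^ 2) * (1 + a ^ 2)) := one_add_sq_le_mul hb.le h3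
    have e3 := mul_le_mul_of_nonneg_right f1
      (by positivity : 0 ≤ ((1 + r ^ 2) * (1 + a ^ 2)) ^ 2)
    refine le_trans ?_ (mul_le_mul_of_nonneg_left e3 (by norm_num))
    have e4 : 144 * (1 / 6 * (a * b * (a + b) / ((1 + a ^ 2) * (1 + b ^ 2))) *
        ((1 + r ^ 2) * (1 + a ^ 2)) ^ 2) =
        24 * (a * b * (a + b) * ((1 + r ^ 2) ^ 2 * (1 + a ^ 2))) / (1 + b ^ 2) := by
      field_simp
      ring
    rw [e4, le_div_iff₀ (by positivity)]
    calc b * (r + a) ^ 2 * (r * a) * (1 + b ^ 2)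
        = (b * a * r) * ((r + a) * (r + a)) * (1 + b ^ 2) := by ring
      _ ≤ (b * a * r) * ((2 * (a + b)) * (3 * r)) * (2 * ((1 + r ^ 2) * (1 + a ^ 2))) := by
          gcongr <;> linarith
      _ = 12 * (a * b * (a + b) * (r ^ 2 * ((1 + r ^ 2) * (1 + a ^ 2)))) := by ring
      _ ≤ 12 * (a * b * (a + b) * ((1 + r ^ 2) * ((1 + r ^ 2) * (1 + a ^ 2)))) := by
          gcongr; linarith
      _ ≤ 24 * (a * b * (a + b) * ((1 + r ^ 2) ^ 2 * (1 + a ^ 2))) := by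
          have : 0 ≤ a * b * (a + b) * ((1 + r ^ 2) ^ 2 * (1 + a ^ 2)) := by positivity
          nlinarith

/-- The squared length of a difference of two vectors of lengths `g` and `h`, split into the radial
and the angular part; `g` and `h` are the group speeds at the frequencies `x` and `z`. -/
theorem norm_sq_smul_sub_smul {x z : R3} (hx : x ≠ 0) (hz : z ≠ 0) (g h : ℝ) :
    ‖(g / ‖x‖) • x - (h / ‖z‖) • z‖ ^ 2 =
      (g - h) ^ 2 + g * h * ((‖x - z‖ ^ 2 - (‖x‖ - ‖z‖) ^ 2) / (‖x‖ * ‖z‖)) := by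
  have hx0 : ‖x‖ ≠ 0 := norm_ne_zero_iff.2 hx
  have hz0 : ‖z‖ ≠ 0 := norm_ne_zero_iff.2 hz
  rw [norm_sub_sq_real, norm_sub_sq_real, norm_smul, norm_smul, inner_smul_left, inner_smul_right,
    mul_pow, mul_pow, Real.norm_eq_abs, Real.norm_eq_abs, sq_abs, sq_abs]
  simp only [conj_trivial]
  field_simp
  ring

/-- The length scale of a function with `|∇u|² ≤ C κ |u|` and `|Δu| ≤ C κ` is `(|u| / (C
κ))^{1/2}`. -/
theorem symbolAt_of_sq_le {u : R3 → ℝ} {x : R3} {C κ : ℝ} (hu : ContDiffAt ℝ 2 u x)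
    (h0 : u x ≠ 0) (hC : 0 ≤ C * κ) (h1 : ‖fderiv ℝ u x‖ ^ 2 ≤ C * κ * |u x|)
    (h2 : |Δ u x| ≤ C * κ) : SymbolAt u x |u x| (Real.sqrt (C * κ / |u x|)) := by
  have hpos : 0 < |u x| := abs_pos.2 h0
  refine ⟨hu, le_rfl, ?_, ?_⟩
  · refine le_of_sq_le_sq ?_ (by positivity)
    rw [mul_pow, Real.sq_sqrt (by positivity)]
    refine h1.trans (le_of_eq ?_)
    field_simp
  · rw [Real.sq_sqrt (by positivity)]
    refine h2.trans (le_of_eq ?_)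
    field_simp

theorem grad_left_le {r a b F g g' B : ℝ} (hr : 0 < r) (ha : 0 < a) (hb : 0 < b)
    (h1 : r ≤ a + b) (h2 : a ≤ r + b) (h3 : b ≤ r + a)
    (hF : 2 / 3 * (a + b - r) + 1 / 6 * (a * b * (a + b) / ((1 + a ^ 2) * (1 + b ^ 2))) ≤ F)
    (hg : |g| ≤ B) (hg' : |g'| ≤ B)
    (hgg : |g - g'| ≤ B * (|r - a| * |r + a| / ((1 + r ^ 2) * (1 + a ^ 2)))) :
    (g - g') ^ 2 + g * g' * ((b ^ 2 - (r - a) ^ 2) / (r * a)) ≤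
      147 * B ^ 2 * (b / (r * a)) * F := by
  have hB : 0 ≤ B := (abs_nonneg _).trans hg
  have hS : 0 < a * b * (a + b) / ((1 + a ^ 2) * (1 + b ^ 2)) := by positivity
  have hd : |r - a| ≤ b := abs_le.2 ⟨by linarith, by linarith⟩
  have key := sq_mul_le_phase hr ha hb h1 h3 hF
  have e1 : (g - g') ^ 2 ≤ 144 * B ^ 2 * (b / (r * a)) * F := by
    rw [← sq_abs]
    calc |g - g'| ^ 2
        ≤ (B * (b * (r + a) / ((1 + r ^ 2) * (1 + a ^ 2)))) ^ 2 := by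
          rw [abs_of_pos (by positivity : 0 < r + a)] at hgg
          refine pow_le_pow_left₀ (abs_nonneg _) (hgg.trans ?_) 2
          gcongr
      _ = B ^ 2 * (b / (r * a)) * ((b * (r + a) ^ 2 * (r * a)) /
            ((1 + r ^ 2) * (1 + a ^ 2)) ^ 2) := by
          field_simp
      _ ≤ B ^ 2 * (b / (r * a)) * (144 * F) := by
          gcongr
          rw [div_le_iff₀ (by positivity)]
          linarith
      _ = _ := by ring
  have e2 : g * g' * ((b ^ 2 - (r - a) ^ 2) / (r * a)) ≤ 3 * B ^ 2 * (b / (r * a)) * F := by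
    have q0 : 0 ≤ b ^ 2 - (r - a) ^ 2 := by
      nlinarith
    have q1 : b ^ 2 - (r - a) ^ 2 ≤ 2 * b * (a + b - r) := by nlinarith
    have q2 : g * g' ≤ B ^ 2 := by
      have := mul_le_mul hg hg' (abs_nonneg _) hB
      rw [← abs_mul] at this
      nlinarith [le_abs_self (g * g')]
    calc g * g' * ((b ^ 2 - (r - a) ^ 2) / (r * a))
        ≤ B ^ 2 * ((2 * b * (a + b - r)) / (r * a)) := by gcongr
      _ = 2 * B ^ 2 * (b / (r * a)) * (a + b - r) := by ring
      _ ≤ 2 * B ^ 2 * (b / (r * a)) * (3 / 2 * F) := by gcongr; linarith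
      _ = _ := by ring
  linarith

theorem laplacian_left_le {r a b l l' K : ℝ} (hr : 0 < r) (ha : 0 < a)
    (h1 : r ≤ a + b) (h2 : a ≤ r + b) (hl : |l| ≤ K)
    (hll : |l - l'| ≤ K * (|r - a| * |r + a| / ((1 + r ^ 2) * (1 + a ^ 2)))) :
    |l / r - l' / a| ≤ 3 * K * (b / (r * a)) := by
  have hd : |r - a| ≤ b := abs_le.2 ⟨by linarith, by linarith⟩
  have hK : 0 ≤ K := (abs_nonneg _).trans hl
  have hb : 0 ≤ b := (abs_nonneg _).trans hd
  have e : l / r - l' / a = l * (a - r) / (r * a) + (l - l') / a := by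
    field_simp
    ring
  rw [e]
  refine (abs_add_le _ _).trans ?_
  have e1 : |l * (a - r) / (r * a)| ≤ K * (b / (r * a)) := by
    rw [abs_div, abs_mul, abs_of_pos (by positivity : 0 < r * a), abs_sub_comm a r,
      ← mul_div_assoc]
    gcongr
  have e2 : |(l - l') / a| ≤ 2 * K * (b / (r * a)) := by
    rw [abs_div, abs_of_pos ha]
    rw [abs_of_pos (by positivity : 0 < r + a)] at hll
    calc |l - l'| / a ≤ K * (b * (r + a) / ((1 + r ^ 2) * (1 + a ^ 2))) / a := by
          gcongr
          exact hll.trans (by gcongr)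
      _ = K * (b / (r * a)) * ((r + a) * r / ((1 + r ^ 2) * (1 + a ^ 2))) := by field_simp
      _ ≤ K * (b / (r * a)) * 2 := by
          gcongr
          rw [div_le_iff₀ (by positivity)]
          nlinarith [sq_nonneg (r - a), sq_nonneg (r * a)]
      _ = _ := by ring
  linarith

theorem grad_right_le {r a b F g g' B : ℝ} (hr : 0 < r) (ha : 0 < a) (hb : 0 < b)
    (h1 : r ≤ a + b)
    (hF : 2 / 3 * (a + b - r) + 1 / 6 * (a * b * (a + b) / ((1 + a ^ 2) * (1 + b ^ 2))) ≤ F)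
    (hg : |g| ≤ B) (hg' : |g'| ≤ B)
    (hgg : |g - g'| ≤ B * (|b - a| * |b + a| / ((1 + b ^ 2) * (1 + a ^ 2)))) :
    (g - g') ^ 2 + g * g' * (((a + b) ^ 2 - r ^ 2) / (b * a)) ≤
      9 * B ^ 2 * ((a + b) / (a * b)) * F := by
  have hB : 0 ≤ B := (abs_nonneg _).trans hg
  have hS : 0 < a * b * (a + b) / ((1 + a ^ 2) * (1 + b ^ 2)) := by positivity
  have e1 : (g - g') ^ 2 ≤ 6 * B ^ 2 * ((a + b) / (a * b)) * F := by
    rw [← sq_abs]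
    rw [abs_of_pos (by positivity : 0 < b + a)] at hgg
    have q : (b - a) ^ 2 ≤ (1 + b ^ 2) * (1 + a ^ 2) := by nlinarith [sq_nonneg (a * b)]
    calc |g - g'| ^ 2
        ≤ (B * (|b - a| * (b + a) / ((1 + b ^ 2) * (1 + a ^ 2)))) ^ 2 :=
          pow_le_pow_left₀ (abs_nonneg _) hgg 2
      _ = B ^ 2 * ((b + a) ^ 2 / ((1 + b ^ 2) * (1 + a ^ 2))) *
            ((b - a) ^ 2 / ((1 + b ^ 2) * (1 + a ^ 2))) := by
          rw [← sq_abs (b - a)]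
          field_simp
      _ ≤ B ^ 2 * ((b + a) ^ 2 / ((1 + b ^ 2) * (1 + a ^ 2))) * 1 := by
          gcongr
          exact (div_le_one (by positivity)).2 q
      _ = 6 * B ^ 2 * ((a + b) / (a * b)) *
            (1 / 6 * (a * b * (a + b) / ((1 + a ^ 2) * (1 + b ^ 2)))) := by
          field_simp
          ring
      _ ≤ 6 * B ^ 2 * ((a + b) / (a * b)) * F := by gcongr; linarith
  have e2 : g * g' * (((a + b) ^ 2 - r ^ 2) / (b * a)) ≤ 3 * B ^ 2 * ((a + b) / (a * b)) * F := by
    have q0 : 0 ≤ (a + b) ^ 2 - r ^ 2 := by nlinarith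
    have q1 : (a + b) ^ 2 - r ^ 2 ≤ 2 * (a + b) * (a + b - r) := by nlinarith
    have q2 : g * g' ≤ B ^ 2 := by
      have := mul_le_mul hg hg' (abs_nonneg _) hB
      rw [← abs_mul] at this
      nlinarith [le_abs_self (g * g')]
    calc g * g' * (((a + b) ^ 2 - r ^ 2) / (b * a))
        ≤ B ^ 2 * ((2 * (a + b) * (a + b - r)) / (b * a)) := by gcongr
      _ = 2 * B ^ 2 * ((a + b) / (a * b)) * (a + b - r) := by field_simp
      _ ≤ 2 * B ^ 2 * ((a + b) / (a * b)) * (3 / 2 * F) := by gcongr; linarith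
      _ = _ := by ring
  linarith

/-- For fixed `η` the phase satisfies `|∇Φ₁|² ≤ C κ |Φ₁|` and `|ΔΦ₁| ≤ C κ`, where
`κ = |η| / (|ξ| |ξ - η|)`. -/
theorem exists_symbolAt_phase_left : ∃ C : ℝ, 1 ≤ C ∧ ∀ ξ η : R3, ξ ≠ 0 → η ≠ 0 → ξ ≠ η →
    SymbolAt (fun x => Phi1 x η) ξ |Phi1 ξ η|
      (Real.sqrt (C * (‖η‖ / (‖ξ‖ * ‖ξ - η‖)) / |Phi1 ξ η|)) := by
  obtain ⟨B, hB1, hB, hBL⟩ := exists_bound_and_lipschitz contDiffOn_gradFactor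
  obtain ⟨K, hK1, hK, hKL⟩ := exists_bound_and_lipschitz contDiffOn_laplacianFactor
  refine ⟨147 * B ^ 2 + 3 * K, by nlinarith, fun ξ η h0 h1 h2 => ?_⟩
  have hneg := phase_neg h2 h1
  have hlow := phase_lower (ξ := ξ) (η := η)
  obtain ⟨c1, f1, l1⟩ := p_derivatives (e := 0) (x := ξ) h0
  obtain ⟨c2, f2, l2⟩ := p_derivatives h2
  simp only [sub_zero] at c1 f1 l1
  have hr : 0 < ‖ξ‖ := norm_pos_iff.2 h0
  have ha : 0 < ‖ξ - η‖ := norm_pos_iff.2 (sub_ne_zero.2 h2)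
  have hb : 0 < ‖η‖ := norm_pos_iff.2 h1
  have t1 : ‖ξ‖ ≤ ‖ξ - η‖ + ‖η‖ := by simpa using norm_add_le (ξ - η) η
  have t2 : ‖ξ - η‖ ≤ ‖ξ‖ + ‖η‖ := norm_sub_le _ _
  have t3 : ‖η‖ ≤ ‖ξ‖ + ‖ξ - η‖ := by simpa using norm_sub_le ξ (ξ - η)
  have hsub : ‖ξ - (ξ - η)‖ = ‖η‖ := by simp
  have hnorm := norm_sq_smul_sub_smul h0 (sub_ne_zero.2 h2)
    (gradFactor (1 + ‖ξ‖ ^ 2)⁻¹) (gradFactor (1 + ‖ξ - η‖ ^ 2)⁻¹)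
  rw [hsub] at hnorm
  have hcd : ContDiffAt ℝ 2 (fun x => Phi1 x η) ξ := (c1.sub c2).sub contDiffAt_const
  have hfd : fderiv ℝ (fun x => Phi1 x η) ξ =
      innerSL ℝ ((gradFactor (1 + ‖ξ‖ ^ 2)⁻¹ / ‖ξ‖) • ξ -
        (gradFactor (1 + ‖ξ - η‖ ^ 2)⁻¹ / ‖ξ - η‖) • (ξ - η)) := by
    unfold Phi1
    rw [fderiv_sub_const, fderiv_fun_sub (c1.differentiableAt (by simp))
      (c2.differentiableAt (by simp)), f1, f2, map_sub]
  have hlap : Δ (fun x => Phi1 x η) ξ = laplacianFactor (1 + ‖ξ‖ ^ 2)⁻¹ / ‖ξ‖ -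
      laplacianFactor (1 + ‖ξ - η‖ ^ 2)⁻¹ / ‖ξ - η‖ := by
    have e1 : Δ (fun x => Phi1 x η) ξ =
        Δ (fun x => p x - p (x - η)) ξ - Δ (fun _ : R3 => p η) ξ :=
      (c1.sub c2).laplacian_sub contDiffAt_const
    have e2 : Δ (fun x => p x - p (x - η)) ξ = Δ p ξ - Δ (fun x => p (x - η)) ξ :=
      c1.laplacian_sub c2
    rw [e1, e2, l1, l2]
    simp
  have hneg' : |Phi1 ξ η| = -Phi1 ξ η := abs_of_neg hneg
  have hw := inv_one_add_sq_mem ‖ξ‖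
  have hw' := inv_one_add_sq_mem ‖ξ - η‖
  have lip := abs_inv_sub_inv ‖ξ‖ ‖ξ - η‖
  have d1 := hBL _ hw _ hw'
  have d2 := hKL _ hw _ hw'
  rw [lip] at d1 d2
  refine symbolAt_of_sq_le hcd hneg.ne (by positivity) ?_ ?_
  · rw [hfd, innerSL_apply_norm, hnorm, hneg']
    refine (grad_left_le hr ha hb t1 t2 t3 hlow (hB _ hw) (hB _ hw') d1).trans ?_
    have : 0 < -Phi1 ξ η := by linarith
    gcongr
    linarith
  · rw [hlap]
    refine (laplacian_left_le hr ha t1 t2 (hK _ hw) d2).trans ?_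
    gcongr
    nlinarith

/-- For fixed `ξ` the phase satisfies `|∇Φ₁|² ≤ C κ |Φ₁|` and `|ΔΦ₁| ≤ C κ`, where
`κ = (|ξ - η| + |η|) / (|ξ - η| |η|)`. -/
theorem exists_symbolAt_phase_right : ∃ C : ℝ, 1 ≤ C ∧ ∀ ξ η : R3, ξ ≠ 0 → η ≠ 0 → η ≠ ξ →
    SymbolAt (fun y => Phi1 ξ y) η |Phi1 ξ η|
      (Real.sqrt (C * ((‖η - ξ‖ + ‖η‖) / (‖η - ξ‖ * ‖η‖)) / |Phi1 ξ η|)) := by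
  obtain ⟨B, hB1, hB, hBL⟩ := exists_bound_and_lipschitz contDiffOn_gradFactor
  obtain ⟨K, hK1, hK, hKL⟩ := exists_bound_and_lipschitz contDiffOn_laplacianFactor
  refine ⟨9 * B ^ 2 + K, by nlinarith, fun ξ η h0 h1 h2 => ?_⟩
  have hneg := phase_neg h2.symm h1
  have hlow := phase_lower (ξ := ξ) (η := η)
  rw [norm_sub_rev ξ η] at hlow
  obtain ⟨c1, f1, l1⟩ := p_derivatives (e := 0) (x := η) h1
  obtain ⟨c2, f2, l2⟩ := p_derivatives h2
  simp only [sub_zero] at c1 f1 l1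
  have hr : 0 < ‖ξ‖ := norm_pos_iff.2 h0
  have ha : 0 < ‖η - ξ‖ := norm_pos_iff.2 (sub_ne_zero.2 h2)
  have hb : 0 < ‖η‖ := norm_pos_iff.2 h1
  have t1 : ‖ξ‖ ≤ ‖η - ξ‖ + ‖η‖ := by
    rw [norm_sub_rev]; simpa using norm_add_le (ξ - η) η
  have hsub : ‖η - (η - ξ)‖ = ‖ξ‖ := by simp
  have hnorm := norm_sq_smul_sub_smul h1 (sub_ne_zero.2 h2)
    (gradFactor (1 + ‖η‖ ^ 2)⁻¹) (-gradFactor (1 + ‖η - ξ‖ ^ 2)⁻¹)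
  rw [hsub, neg_div, neg_smul, sub_neg_eq_add] at hnorm
  have hphi : (fun y => Phi1 ξ y) = fun y => p ξ - p (y - ξ) - p y := by
    ext y
    rw [Phi1, ← p_neg (ξ - y), neg_sub]
  have hcd : ContDiffAt ℝ 2 (fun y => Phi1 ξ y) η := by
    rw [hphi]; exact (contDiffAt_const.sub c2).sub c1
  have hfd : fderiv ℝ (fun y => Phi1 ξ y) η =
      -innerSL ℝ ((gradFactor (1 + ‖η‖ ^ 2)⁻¹ / ‖η‖) • η +
        (gradFactor (1 + ‖η - ξ‖ ^ 2)⁻¹ / ‖η - ξ‖) • (η - ξ)) := by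
    rw [hphi, fderiv_fun_sub ((c2.differentiableAt (by simp)).const_sub _)
      (c1.differentiableAt (by simp)), fderiv_const_sub, f1, f2, map_add]
    abel
  have hlap : Δ (fun y => Phi1 ξ y) η = -(laplacianFactor (1 + ‖η - ξ‖ ^ 2)⁻¹ / ‖η - ξ‖) -
      laplacianFactor (1 + ‖η‖ ^ 2)⁻¹ / ‖η‖ := by
    have e1 : Δ (fun y => p ξ - p (y - ξ) - p y) η =
        Δ (fun y => p ξ - p (y - ξ)) η - Δ p η :=
      (contDiffAt_const.sub c2).laplacian_sub c1
    have e2 : Δ (fun y => p ξ - p (y - ξ)) η =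
        Δ (fun _ : R3 => p ξ) η - Δ (fun y => p (y - ξ)) η :=
      contDiffAt_const.laplacian_sub c2
    rw [hphi, e1, e2, l1, l2]
    simp
  have hneg' : |Phi1 ξ η| = -Phi1 ξ η := abs_of_neg hneg
  have hw := inv_one_add_sq_mem ‖η‖
  have hw' := inv_one_add_sq_mem ‖η - ξ‖
  have d1 := hBL _ hw _ hw'
  rw [abs_inv_sub_inv] at d1
  refine symbolAt_of_sq_le hcd hneg.ne (by positivity) ?_ ?_
  · rw [hfd, norm_neg, innerSL_apply_norm, hnorm, hneg']
    have := grad_right_le hr ha hb t1 hlow (hB _ hw) (hB _ hw') d1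
    have h3 : 0 < -Phi1 ξ η := by linarith
    calc _ = _ := ?_
      _ ≤ _ := this
      _ ≤ _ := ?_
    · field_simp
      ring
    · gcongr
      linarith
  · rw [hlap]
    refine (abs_sub _ _).trans ?_
    rw [abs_neg, abs_div, abs_div, abs_of_pos ha, abs_of_pos hb]
    calc _ ≤ K / ‖η - ξ‖ + K / ‖η‖ := by
          have := hK _ hw
          have := hK _ hw'
          gcongr
      _ = K * ((‖η - ξ‖ + ‖η‖) / (‖η - ξ‖ * ‖η‖)) := by field_simp; ring
      _ ≤ _ := by gcongr; nlinarith

/-! ### The multiplier as a symbol -/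

/-- The multiplier `χ |ξ| |ξ - η| |η| / (Φ₁ ⟨ξ - η⟩^γ₁ ⟨η⟩^γ₂)`. -/
noncomputable def multiplier (γ₁ γ₂ : ℝ) (χ : R3 → R3 → ℝ) (ξ η : R3) : ℝ :=
  χ ξ η * ‖ξ‖ * ‖ξ - η‖ * ‖η‖ * (Phi1 ξ η)⁻¹ * (1 / bracket (ξ - η) ^ γ₁) * (1 / bracket η ^ γ₂)

/-- The absolute value of the multiplier without the cutoff function. -/
noncomputable def multiplierSize (γ₁ γ₂ : ℝ) (ξ η : R3) : ℝ :=
  ‖ξ‖ * ‖ξ - η‖ * ‖η‖ / |Phi1 ξ η| * (1 / bracket (ξ - η) ^ γ₁) * (1 / bracket η ^ γ₂)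

/-- The constant in the symbol bounds of the multiplier: the product of the constants of its seven
factors and of the constants `8` from the product rule. -/
noncomputable def multiplierConst (A γ₁ γ₂ : ℝ) : ℝ :=
  8 ^ 6 * (3 * A * 4 * 4 * 4 * 8 * (4 * (1 + γ₁) ^ 2) * (4 * (1 + γ₂) ^ 2))

theorem bracket_pos (x : R3) : 0 < bracket x := by unfold bracket; positivity

theorem SymbolAt.const_of_nonneg {x : R3} {c μ k : ℝ} (hc : 0 ≤ c) (hk : 1 ≤ k) (hμ : 0 ≤ μ) :
    SymbolAt (fun _ => c) x (k * c) μ :=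
  (SymbolAt.const c hμ).mono (by rw [abs_of_nonneg hc]; nlinarith) hμ le_rfl

theorem SymbolAt.seven {x : R3} {μ : ℝ} (hμ : 0 ≤ μ) {u₁ u₂ u₃ u₄ u₅ u₆ u₇ : R3 → ℝ}
    {K₁ K₂ K₃ K₄ K₅ K₆ K₇ : ℝ} (h₁ : SymbolAt u₁ x K₁ μ) (h₂ : SymbolAt u₂ x K₂ μ)
    (h₃ : SymbolAt u₃ x K₃ μ) (h₄ : SymbolAt u₄ x K₄ μ) (h₅ : SymbolAt u₅ x K₅ μ)
    (h₆ : SymbolAt u₆ x K₆ μ) (h₇ : SymbolAt u₇ x K₇ μ) :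
    SymbolAt (fun y => u₁ y * u₂ y * u₃ y * u₄ y * u₅ y * u₆ y * u₇ y) x
      (8 ^ 6 * (K₁ * K₂ * K₃ * K₄ * K₅ * K₆ * K₇)) μ :=
  ((((((h₁.mul h₂ hμ).mul h₃ hμ).mul h₄ hμ).mul h₅ hμ).mul h₆ hμ).mul h₇ hμ).mono
    (le_of_eq (by ring)) hμ le_rfl

theorem one_div_min_le {r a μ : ℝ} (hr : 3 / r ≤ μ) (ha : 3 / a ≤ μ) (hr0 : 0 < r) (ha0 : 0 < a) :
    1 / min r a ≤ μ := by
  have : ∀ t : ℝ, 0 < t → 1 / t ≤ 3 / t := fun t ht => by gcongr; norm_num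
  rcases min_choice r a with h | h <;> rw [h]
  · exact (this r hr0).trans hr
  · exact (this a ha0).trans ha

theorem symbolAt_multiplier_left {c A γ₁ γ₂ C₀ : ℝ} (hγ₁ : 0 ≤ γ₁)
    {χ : R3 → R3 → ℝ} (hχ : IsCutoff c A χ) {ξ η : R3} (h0 : ξ ≠ 0) (h1 : η ≠ 0) (h2 : ξ ≠ η)
    (hC₀ : SymbolAt (fun x => Phi1 x η) ξ |Phi1 ξ η|
      (Real.sqrt (C₀ * (‖η‖ / (‖ξ‖ * ‖ξ - η‖)) / |Phi1 ξ η|))) {μ : ℝ}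
    (hr : 3 / ‖ξ‖ ≤ μ) (ha : 3 / ‖ξ - η‖ ≤ μ)
    (hμ : Real.sqrt (C₀ * (‖η‖ / (‖ξ‖ * ‖ξ - η‖)) / |Phi1 ξ η|) ≤ μ) (hγ₂ : 0 ≤ γ₂) :
    SymbolAt (fun x => multiplier γ₁ γ₂ χ x η) ξ
      (multiplierConst A γ₁ γ₂ * multiplierSize γ₁ γ₂ ξ η) μ := by
  have hF : 0 < |Phi1 ξ η| := abs_pos.2 (phase_neg h2 h1).ne
  have hr0 : 0 < ‖ξ‖ := norm_pos_iff.2 h0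
  have ha0 : 0 < ‖ξ - η‖ := norm_pos_iff.2 (sub_ne_zero.2 h2)
  have hμ0 : 0 ≤ μ := (Real.sqrt_nonneg _).trans hμ
  have s1 := (hχ.symbolAt_left h0 h2).mono le_rfl (by positivity) (one_div_min_le hr ha hr0 ha0)
  have s2 := symbolAt_norm_sub (e := 0) h0
  simp only [sub_zero] at s2
  have s2' := s2.mono le_rfl (by positivity) hr
  have s3 := (symbolAt_norm_sub h2).mono le_rfl (by positivity) ha
  have s4 : SymbolAt (fun _ => ‖η‖) ξ (4 * ‖η‖) μ :=
    SymbolAt.const_of_nonneg (norm_nonneg _) (by norm_num) hμ0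
  have s5 := (hC₀.mono le_rfl (Real.sqrt_nonneg _) hμ).inv hμ0 hF rfl
  have s6 := (symbolAt_bracket_rpow h2 hγ₁).mono le_rfl (by positivity) ha
  have hb := bracket_pos η
  have s7 : SymbolAt (fun _ => 1 / bracket η ^ γ₂) ξ
      (4 * (1 + γ₂) ^ 2 * (1 / bracket η ^ γ₂)) μ :=
    SymbolAt.const_of_nonneg (by positivity) (by nlinarith) hμ0
  refine (SymbolAt.seven hμ0 s1 s2' s3 s4 s5 s6 s7).mono (le_of_eq ?_) hμ0 le_rfl
  rw [multiplierConst, multiplierSize]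
  ring

theorem symbolAt_multiplier_right {c A γ₁ γ₂ C₀ : ℝ} (hγ₁ : 0 ≤ γ₁)
    {χ : R3 → R3 → ℝ} (hχ : IsCutoff c A χ) {ξ η : R3} (h1 : η ≠ 0) (h2 : η ≠ ξ)
    (hC₀ : SymbolAt (fun y => Phi1 ξ y) η |Phi1 ξ η|
      (Real.sqrt (C₀ * ((‖η - ξ‖ + ‖η‖) / (‖η - ξ‖ * ‖η‖)) / |Phi1 ξ η|))) {μ : ℝ}
    (hb : 3 / ‖η‖ ≤ μ) (ha : 3 / ‖η - ξ‖ ≤ μ)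
    (hμ : Real.sqrt (C₀ * ((‖η - ξ‖ + ‖η‖) / (‖η - ξ‖ * ‖η‖)) / |Phi1 ξ η|) ≤ μ)
    (hγ₂ : 0 ≤ γ₂) :
    SymbolAt (fun y => multiplier γ₁ γ₂ χ ξ y) η
      (multiplierConst A γ₁ γ₂ * multiplierSize γ₁ γ₂ ξ η) μ := by
  have hF : 0 < |Phi1 ξ η| := abs_pos.2 (phase_neg h2.symm h1).ne
  have hb0 : 0 < ‖η‖ := norm_pos_iff.2 h1
  have ha0 : 0 < ‖η - ξ‖ := norm_pos_iff.2 (sub_ne_zero.2 h2)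
  have hμ0 : 0 ≤ μ := (Real.sqrt_nonneg _).trans hμ
  have s1 := (hχ.symbolAt_right h1 h2).mono le_rfl (by positivity) (one_div_min_le hb ha hb0 ha0)
  have s2 : SymbolAt (fun _ => ‖ξ‖) η (4 * ‖ξ‖) μ :=
    SymbolAt.const_of_nonneg (norm_nonneg _) (by norm_num) hμ0
  have s3 := (symbolAt_norm_sub h2).mono le_rfl (by positivity) ha
  have s4 := symbolAt_norm_sub (e := 0) h1
  simp only [sub_zero] at s4
  have s4' := s4.mono le_rfl (by positivity) hb
  have s5 := (hC₀.mono le_rfl (Real.sqrt_nonneg _) hμ).inv hμ0 hF rfl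
  have s6 := (symbolAt_bracket_rpow h2 hγ₁).mono le_rfl (by positivity) ha
  have s7 := symbolAt_bracket_rpow (e := 0) h1 hγ₂
  simp only [sub_zero] at s7
  have s7' := s7.mono le_rfl (by positivity) hb
  have hbr : ∀ y : R3, bracket (ξ - y) = bracket (y - ξ) := fun y => by
    rw [bracket, bracket, norm_sub_rev]
  have e : (fun y => multiplier γ₁ γ₂ χ ξ y) = fun y => χ ξ y * ‖ξ‖ * ‖y - ξ‖ * ‖y‖ *
      (Phi1 ξ y)⁻¹ * (1 / bracket (y - ξ) ^ γ₁) * (1 / bracket y ^ γ₂) := by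
    ext y
    rw [multiplier, hbr, norm_sub_rev ξ y]
  rw [e]
  refine (SymbolAt.seven hμ0 s1 s2 s3 s4' s5 s6 s7').mono (le_of_eq ?_) hμ0 le_rfl
  rw [multiplierConst, multiplierSize, hbr, norm_sub_rev ξ η]
  ring

/-! ### Interpolation bounds for functions concentrated near a line -/

theorem integrable_inv_mul_sq_add {κ D : ℝ} (hκ : 0 < κ) (hD : 0 < D) :
    Integrable (fun y : ℝ => (κ * y ^ 2 + D)⁻¹) ∧
      ∫ y : ℝ, (κ * y ^ 2 + D)⁻¹ = Real.pi / Real.sqrt (κ * D) := by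
  set a := Real.sqrt (κ / D) with ha
  have ha0 : 0 < a := Real.sqrt_pos.2 (by positivity)
  have ha2 : a ^ 2 = κ / D := Real.sq_sqrt (by positivity)
  have e : (fun y : ℝ => (κ * y ^ 2 + D)⁻¹) = fun y => D⁻¹ * (1 + (a * y) ^ 2)⁻¹ := by
    ext y
    rw [mul_pow, ha2]
    field_simp
    ring
  refine ⟨?_, ?_⟩
  · rw [e]
    exact (integrable_inv_one_add_sq.comp_mul_left' ha0.ne').const_mul _
  · rw [e, integral_const_mul, Measure.integral_comp_mul_left (fun y => (1 + y ^ 2)⁻¹) a,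
      integral_univ_inv_one_add_sq, abs_of_pos (by positivity), smul_eq_mul]
    have : Real.sqrt (κ * D) = D * a := by
      rw [ha, show κ * D = D ^ 2 * (κ / D) by field_simp, Real.sqrt_mul (by positivity),
        Real.sqrt_sq hD.le]
    rw [this]
    field_simp

/-- The squared length of the component of `x` orthogonal to the unit vector `e`. -/
noncomputable def perpSq (e x : R3) : ℝ := ‖x‖ ^ 2 - inner ℝ e x ^ 2

theorem perpSq_nonneg {e : R3} (he : ‖e‖ = 1) (x : R3) : 0 ≤ perpSq e x := by
  have := abs_real_inner_le_norm e x
  rw [he, one_mul] at this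
  have := sq_le_sq' (by have := abs_le.1 this; linarith) ((le_abs_self _).trans this)
  unfold perpSq
  linarith

/-- In coordinates adapted to `e` the integrand is dominated by a product of functions of one
variable, because `(κ (y² + z²) + D)² ≥ (κ y² + D) (κ z² + D)`. -/
theorem lintegral_slab_le {e : R3} (he : ‖e‖ = 1) (z : ℝ) {L κ D : ℝ} (hL : 0 ≤ L) (hκ : 0 < κ)
    (hD : 0 < D) :
    ∫⁻ x, {x : R3 | |inner ℝ e x - z| ≤ L}.indicator
      (fun x => ENNReal.ofReal (((κ * perpSq e x + D) ^ 2)⁻¹)) x ≤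
      ENNReal.ofReal (2 * L * Real.pi ^ 2 / (κ * D)) := by
  obtain ⟨b, hb⟩ := Orthonormal.exists_orthonormalBasis_extension_of_card_eq (𝕜 := ℝ)
    (E := R3) (ι := Fin 3) (by simp) (v := fun _ => e) (s := {0})
    (by
      rw [orthonormal_iff_ite]
      rintro ⟨i, hi⟩ ⟨j, hj⟩
      rw [Set.mem_singleton_iff] at hi hj
      subst hi hj
      simp [he])
  have hb0 : b 0 = e := hb 0 rfl
  have hin : ∀ x, inner ℝ e x = b.repr x 0 := fun x => by rw [b.repr_apply_apply, hb0]
  have hperp : ∀ x, perpSq e x = b.repr x 1 ^ 2 + b.repr x 2 ^ 2 := fun x => by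
    rw [perpSq, hin, ← b.repr.norm_map x, EuclideanSpace.norm_sq_eq, Fin.sum_univ_three]
    simp only [Real.norm_eq_abs, sq_abs]
    ring
  set g : Fin 3 → ℝ → ℝ := ![(Set.Icc (z - L) (z + L)).indicator fun _ => 1,
    fun y => (κ * y ^ 2 + D)⁻¹, fun y => (κ * y ^ 2 + D)⁻¹] with hg
  set G : (Fin 3 → ℝ) → ℝ := fun w => ∏ i, g i (w i) with hG
  have hgi : ∀ i, Integrable (g i) := by
    intro i
    fin_cases i
    · exact (integrable_indicator_iff measurableSet_Icc).2 (by simp)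
    · exact (integrable_inv_mul_sq_add hκ hD).1
    · exact (integrable_inv_mul_sq_add hκ hD).1
  have hG0 : ∀ w, 0 ≤ G w := fun w => by
    simp only [hG, hg, Fin.prod_univ_three]
    have h1 : 0 ≤ (Set.Icc (z - L) (z + L)).indicator (fun _ => (1 : ℝ)) (w 0) :=
      Set.indicator_nonneg (fun _ _ => zero_le_one) _
    simp only [Matrix.cons_val]
    positivity
  have hGi : Integrable G := Integrable.fintype_prod hgi
  have hGint : ∫ w, G w = 2 * L * Real.pi ^ 2 / (κ * D) := by
    rw [hG, integral_fintype_prod_volume_eq_prod]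
    simp only [hg, Fin.prod_univ_three, Matrix.cons_val, (integrable_inv_mul_sq_add hκ hD).2]
    rw [integral_indicator measurableSet_Icc]
    simp only [integral_const, smul_eq_mul, mul_one, measureReal_restrict_apply_univ,
      Real.volume_real_Icc]
    rw [max_eq_left (by linarith), mul_assoc, div_mul_div_comm, Real.mul_self_sqrt (by positivity)]
    ring
  have hmp := (PiLp.volume_preserving_ofLp (Fin 3)).comp b.measurePreserving_repr
  calc _ ≤ ∫⁻ x, ENNReal.ofReal (G (WithLp.ofLp (b.repr x))) := by
        refine lintegral_mono fun x => ?_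
        by_cases hx : x ∈ {x : R3 | |inner ℝ e x - z| ≤ L}
        · rw [Set.indicator_of_mem hx]
          refine ENNReal.ofReal_le_ofReal ?_
          have hmem : (b.repr x) 0 ∈ Set.Icc (z - L) (z + L) := by
            have h : |inner ℝ e x - z| ≤ L := hx
            rw [abs_le] at h
            rw [hin] at h
            exact ⟨by linarith, by linarith⟩
          simp only [hG, hg, Fin.prod_univ_three, Matrix.cons_val]
          rw [Set.indicator_of_mem hmem, one_mul, ← mul_inv, hperp]
          gcongr
          have h1 : 0 ≤ κ * b.repr x 1 ^ 2 := by positivity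
          have h2 : 0 ≤ κ * b.repr x 2 ^ 2 := by positivity
          nlinarith
        · rw [Set.indicator_of_notMem hx]
          exact zero_le
    _ = ∫⁻ w, ENNReal.ofReal (G w) :=
        hmp.lintegral_comp_emb (f := fun w => ENNReal.ofReal (G w))
          (MeasurableEquiv.measurableEmbedding
            (b.measurableEquiv.trans (MeasurableEquiv.toLp 2 (Fin 3 → ℝ)).symm))
    _ = _ := by
        rw [← ofReal_integral_eq_lintegral_ofReal hGi (Filter.Eventually.of_forall hG0), hGint]

theorem lintegral_sq_le {u : R3 → ℝ} {e : R3} (he : ‖e‖ = 1) {z L κ D P : ℝ} (hL : 0 ≤ L)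
    (hκ : 0 < κ) (hD : 0 < D)
    (h : ∀ x, u x = 0 ∨ |inner ℝ e x - z| ≤ L ∧ |u x| ≤ P / (κ * perpSq e x + D)) :
    ∫⁻ x, ‖u x‖ₑ ^ (2 : ℝ) ≤ ENNReal.ofReal (P ^ 2 * (2 * L * Real.pi ^ 2 / (κ * D))) := by
  calc ∫⁻ x, ‖u x‖ₑ ^ (2 : ℝ)
      ≤ ∫⁻ x, ENNReal.ofReal (P ^ 2) * {x : R3 | |inner ℝ e x - z| ≤ L}.indicator
          (fun x => ENNReal.ofReal (((κ * perpSq e x + D) ^ 2)⁻¹)) x := by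
        refine lintegral_mono fun x => ?_
        rcases h x with hx | ⟨h1, h2⟩
        · simp [hx]
        · have hpos := perpSq_nonneg he x
          rw [Set.indicator_of_mem (by exact h1), ← ENNReal.ofReal_mul (sq_nonneg _),
            Real.enorm_eq_ofReal_abs, ENNReal.ofReal_rpow_of_nonneg (abs_nonneg _) (by norm_num)]
          refine ENNReal.ofReal_le_ofReal ?_
          rw [← div_eq_mul_inv, ← div_pow]
          exact_mod_cast pow_le_pow_left₀ (abs_nonneg _) h2 2
    _ = ENNReal.ofReal (P ^ 2) * ∫⁻ x, {x : R3 | |inner ℝ e x - z| ≤ L}.indicator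
          (fun x => ENNReal.ofReal (((κ * perpSq e x + D) ^ 2)⁻¹)) x :=
        lintegral_const_mul' _ _ ENNReal.ofReal_ne_top
    _ ≤ _ := by
        rw [ENNReal.ofReal_mul (sq_nonneg _)]
        exact mul_le_mul_right (lintegral_slab_le he z hL hκ hD) _

/-- The interpolation bound of a bump of size `P / (κ |y|² + D)` and inverse scale
`(κ / (κ |y|² + D))^{1/2}` in a slab of width `L`, where `y` is the component orthogonal to `e`. -/
theorem interpolation_bound {u : R3 → ℝ} {e : R3} (he : ‖e‖ = 1) {z L κ D P s : ℝ} (hL : 0 ≤ L)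
    (hκ : 0 < κ) (hD : 0 < D) (hP : 0 ≤ P) (hs0 : 0 ≤ s) (hs2 : s < 2)
    (h : ∀ x, u =ᶠ[𝓝 x] 0 ∨ |inner ℝ e x - z| ≤ L ∧ |u x| ≤ P / (κ * perpSq e x + D) ∧
      |Δ u x| ≤ P * κ / (κ * perpSq e x + D) ^ 2) :
    (∫⁻ x, ‖u x‖ₑ ^ (2 : ℝ)) ^ (1 - s / 2) * (∫⁻ x, ‖Δ u x‖ₑ ^ (2 : ℝ)) ^ (s / 2) ≤
      ENNReal.ofReal (P ^ 2 * (2 * L * Real.pi ^ 2 / (κ * D)) * (κ / D) ^ s) := by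
  have h1 := lintegral_sq_le (u := u) (P := P) he hL hκ hD (z := z) fun x => by
    rcases h x with hx | hx
    · exact Or.inl hx.self_of_nhds
    · exact Or.inr ⟨hx.1, hx.2.1⟩
  have h2 := lintegral_sq_le (u := Δ u) (P := P * (κ / D)) he hL hκ hD (z := z) fun x => by
    rcases h x with hx | ⟨hx1, -, hx2⟩
    · left
      have h0 : Δ u x = Δ (fun _ : R3 => (0 : ℝ)) x := (laplacian_congr_nhds hx).self_of_nhds
      rw [h0]
      simp
    · refine Or.inr ⟨hx1, hx2.trans ?_⟩
      have := perpSq_nonneg he x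
      have h0 : 0 < κ * perpSq e x + D := by positivity
      have hD' : D ≤ κ * perpSq e x + D := le_add_of_nonneg_left (by positivity)
      rw [sq, ← div_div]
      refine div_le_div_of_nonneg_right ?_ h0.le
      rw [mul_div_assoc]
      gcongr
  set Q := 2 * L * Real.pi ^ 2 / (κ * D) with hQ
  have hQ0 : 0 ≤ Q := by positivity
  have hp : 0 ≤ 1 - s / 2 := by linarith
  have hq : 0 ≤ s / 2 := by linarith
  rw [mul_pow, mul_right_comm] at h2
  have hX : 0 ≤ P ^ 2 * Q := by positivity
  generalize P ^ 2 * Q = X at *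
  have hr : 0 ≤ κ / D := by positivity
  generalize κ / D = r at *
  calc _ ≤ ENNReal.ofReal X ^ (1 - s / 2) * ENNReal.ofReal (X * r ^ 2) ^ (s / 2) := by gcongr
    _ = ENNReal.ofReal X ^ (1 - s / 2) *
        (ENNReal.ofReal X ^ (s / 2) * ENNReal.ofReal (r ^ s)) := by
        have e : r ^ s = (r ^ 2) ^ (s / 2) := by
          rw [← Real.rpow_natCast, ← Real.rpow_mul hr]
          congr 1
          push_cast
          ring
        rw [ENNReal.ofReal_mul hX, ENNReal.mul_rpow_of_nonneg _ _ hq, e,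
          ← ENNReal.ofReal_rpow_of_nonneg (by positivity) hq]
    _ = ENNReal.ofReal X * ENNReal.ofReal (r ^ s) := by
        rw [← mul_assoc, ← ENNReal.rpow_add_of_nonneg _ _ hp hq]
        simp
    _ = _ := by rw [ENNReal.ofReal_mul hX]

theorem summable_two_zpow_rpow {a b : ℝ} {f : ℤ → ℝ} (hf0 : ∀ j, 0 ≤ f j) (ha : 0 < a) (hb : 0 < b)
    (h1 : ∀ j, f j ≤ ((2 : ℝ) ^ j) ^ a) (h2 : ∀ j, f j ≤ ((2 : ℝ) ^ j) ^ (-b)) : Summable f := by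
  have hpow : ∀ (n : ℕ) (c : ℝ), ((2 : ℝ) ^ (n : ℤ)) ^ c = ((2 : ℝ) ^ c) ^ n := fun n c => by
    rw [zpow_natCast, ← Real.rpow_natCast, ← Real.rpow_natCast, ← Real.rpow_mul (by norm_num),
      ← Real.rpow_mul (by norm_num), mul_comm]
  have hg : ∀ c : ℝ, 0 < c → Summable fun n : ℕ => ((2 : ℝ) ^ (-c)) ^ n := fun c hc =>
    summable_geometric_of_lt_one (by positivity)
      (Real.rpow_lt_one_of_one_lt_of_neg (by norm_num) (by linarith))
  refine Summable.of_nat_of_neg_add_one ?_ ?_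
  · refine Summable.of_nonneg_of_le (fun n => hf0 _) (fun n => ?_) (hg b hb)
    rw [← hpow]
    exact h2 n
  · refine Summable.of_nonneg_of_le (fun n => hf0 _) (fun n => ?_)
      ((summable_nat_add_iff 1).2 (hg a ha))
    refine (h1 _).trans (le_of_eq ?_)
    rw [← hpow, zpow_neg, Real.inv_rpow (by positivity), ← Real.rpow_neg (by positivity)]
    push_cast
    rfl

/-- The square roots of `R^α (1 + R²)^{-β/2}` decay geometrically at both ends of the dyadic
scales. -/
theorem summable_dyadic {α β : ℝ} (hα : 0 < α) (hβ : α < β) (K : ℝ) :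
    Summable fun j : ℤ =>
      Real.sqrt (K * (((2 : ℝ) ^ j) ^ α * (1 + ((2 : ℝ) ^ j) ^ 2) ^ (-(β / 2)))) := by
  rcases lt_or_ge K 0 with hK | hK
  · convert summable_zero with j
    exact Real.sqrt_eq_zero_of_nonpos (mul_nonpos_of_nonpos_of_nonneg hK.le (by positivity))
  simp_rw [Real.sqrt_mul hK]
  refine Summable.mul_left _ ?_
  have hsq : ∀ (R c : ℝ), 0 < R → Real.sqrt (R ^ c) = R ^ (c / 2) := fun R c hR => by
    rw [Real.sqrt_eq_rpow, ← Real.rpow_mul hR.le]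
    ring_nf
  refine summable_two_zpow_rpow (a := α / 2) (b := (β - α) / 2) (fun j => Real.sqrt_nonneg _)
    (by linarith) (by linarith) (fun j => ?_) fun j => ?_
  all_goals
    have hR : (0 : ℝ) < 2 ^ j := by positivity
    generalize (2 : ℝ) ^ j = R at *
  · rw [← hsq R _ hR]
    refine Real.sqrt_le_sqrt (mul_le_of_le_one_right (by positivity) ?_)
    exact Real.rpow_le_one_of_one_le_of_nonpos (by nlinarith) (by linarith)
  · rw [show -((β - α) / 2) = (α - β) / 2 by ring, ← hsq R _ hR]
    refine Real.sqrt_le_sqrt ?_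
    rw [sub_eq_add_neg, Real.rpow_add hR]
    gcongr
    calc (1 + R ^ 2) ^ (-(β / 2)) ≤ (R ^ 2) ^ (-(β / 2)) :=
          Real.rpow_le_rpow_of_nonpos (by positivity) (by linarith) (by linarith)
      _ = R ^ (-β) := by
          rw [← Real.rpow_natCast, ← Real.rpow_mul hR.le]
          congr 1
          push_cast
          ring

/-! ### Near-parallel frequencies and the bound of a dyadic piece -/

theorem norm_inv_norm_smul {v : R3} (hv : v ≠ 0) : ‖(‖v‖⁻¹ : ℝ) • v‖ = 1 := by
  rw [norm_smul, norm_inv, norm_norm, inv_mul_cancel₀ (norm_ne_zero_iff.2 hv)]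

theorem inner_inv_norm_smul_self {v : R3} (hv : v ≠ 0) :
    inner ℝ ((‖v‖⁻¹ : ℝ) • v) v = ‖v‖ := by
  have := norm_ne_zero_iff.2 hv
  rw [real_inner_smul_left, real_inner_self_eq_norm_sq]
  field_simp

theorem perpSq_sub {v : R3} (hv : v ≠ 0) (x : R3) :
    perpSq ((‖v‖⁻¹ : ℝ) • v) (x - v) = perpSq ((‖v‖⁻¹ : ℝ) • v) x := by
  have h0 := norm_ne_zero_iff.2 hv
  rw [perpSq, perpSq, inner_sub_right, inner_inv_norm_smul_self hv, norm_sub_sq_real,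
    real_inner_smul_left, real_inner_comm]
  field_simp
  ring

/-- For fixed `η`, the distance of `ξ` to the line through `η` is controlled by the defect
`|ξ - η| + |η| - |ξ|` in the triangle inequality. -/
theorem perp_le_left {ξ η : R3} (hη : η ≠ 0) :
    ‖η‖ * perpSq ((‖η‖⁻¹ : ℝ) • η) ξ ≤
      2 * (‖ξ - η‖ * (‖ξ - η‖ + ‖η‖)) * (‖ξ - η‖ + ‖η‖ - ‖ξ‖) := by
  have he := norm_inv_norm_smul hη
  set e := (‖η‖⁻¹ : ℝ) • η with hedef
  have hb : 0 < ‖η‖ := norm_pos_iff.2 hη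
  rw [← perpSq_sub hη]
  set z := inner ℝ e (ξ - η) with hz
  have hza : |z| ≤ ‖ξ - η‖ := by
    have := abs_real_inner_le_norm e (ξ - η)
    rwa [he, one_mul] at this
  have hr2 : ‖ξ‖ ^ 2 = ‖ξ - η‖ ^ 2 + 2 * ‖η‖ * z + ‖η‖ ^ 2 := by
    have h1 : ‖ξ‖ ^ 2 = ‖(ξ - η) + η‖ ^ 2 := by simp
    rw [h1, norm_add_sq_real, hz, hedef, real_inner_smul_left, real_inner_comm]
    field_simp
  have hr : ‖ξ‖ ≤ ‖ξ - η‖ + ‖η‖ := by simpa using norm_add_le (ξ - η) η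
  have hp : perpSq e (ξ - η) = (‖ξ - η‖ - z) * (‖ξ - η‖ + z) := by
    rw [perpSq]; ring
  have hz1 := abs_le.1 hza
  have ha := norm_nonneg (ξ - η)
  have hr0 := norm_nonneg ξ
  rw [hp]
  generalize ‖ξ - η‖ = a at *
  generalize ‖η‖ = b at *
  generalize ‖ξ‖ = r at *
  have e1 : (a + b - r) * (a + b + r) = 2 * b * (a - z) := by nlinarith
  have e2 : b * ((a - z) * (a + z)) ≤ b * ((a - z) * (2 * a)) := by
    have : 0 ≤ a - z := by linarith
    gcongr
    linarith
  have e3 : (a + b - r) * (a + b + r) * a ≤ (a + b - r) * (2 * (a + b)) * a := by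
    have : 0 ≤ a + b - r := by linarith
    gcongr
    linarith
  nlinarith

/-- For fixed `ξ`, the distance of `y` to the line through `ξ` is controlled by the defect
`|y - ξ| + |y| - |ξ|` in the triangle inequality. -/
theorem perp_le_right {ξ : R3} (hξ : ξ ≠ 0) (y : R3) :
    perpSq ((‖ξ‖⁻¹ : ℝ) • ξ) y ≤ 2 * ‖y - ξ‖ * (‖y - ξ‖ + ‖y‖ - ‖ξ‖) ∧
    perpSq ((‖ξ‖⁻¹ : ℝ) • ξ) y ≤ 2 * ‖y‖ * (‖y - ξ‖ + ‖y‖ - ‖ξ‖) := by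
  have he := norm_inv_norm_smul hξ
  have hs := perpSq_sub hξ y
  have hin := inner_inv_norm_smul_self hξ
  set e := (‖ξ‖⁻¹ : ℝ) • ξ with hedef
  have h1 : |inner ℝ e (y - ξ)| ≤ ‖y - ξ‖ := by
    have := abs_real_inner_le_norm e (y - ξ)
    rwa [he, one_mul] at this
  have h2 : |inner ℝ e y| ≤ ‖y‖ := by
    have := abs_real_inner_le_norm e y
    rwa [he, one_mul] at this
  have h3 : inner ℝ e (y - ξ) = inner ℝ e y - ‖ξ‖ := by rw [inner_sub_right, hin]
  rw [abs_le] at h1 h2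
  constructor
  · rw [← hs, perpSq]
    nlinarith
  · rw [perpSq]
    nlinarith

/-- The bound, up to a constant, of the square of the `Ḣ^s` norm of the piece of the multiplier at
scale `R`; `B` is the size of the other input frequency. -/
noncomputable def pieceBound (γ₁ γ₂ s R B : ℝ) : ℝ :=
  R ^ 3 * (R + B) ^ 2 * (1 + R ^ 2) ^ (1 - γ₁) * (1 + B ^ 2) ^ (1 - γ₂) *
    ((1 + R ^ 2) * (1 + B ^ 2) / (R * (R + B)) ^ 2) ^ s

/-- The second term in the lower bound of the phase only changes by a constant factor when the
frequencies do; `104976 = 9 * 9 * 16 * 81`. -/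
theorem gap_ge {R B a b : ℝ} (hR : 0 < R) (hB : 0 < B) (ha1 : R ≤ a) (ha2 : a ≤ 4 * R)
    (hb1 : B / 9 ≤ b) (hb2 : b ≤ 9 * B) :
    1 / 104976 * (R * B * (R + B) / ((1 + R ^ 2) * (1 + B ^ 2))) ≤
      a * b * (a + b) / ((1 + a ^ 2) * (1 + b ^ 2)) := by
  have ha : 0 < a := by linarith
  have hb : 0 < b := by linarith
  have h1 : 1 + a ^ 2 ≤ 16 * (1 + R ^ 2) := by nlinarith
  have h2 : 1 + b ^ 2 ≤ 81 * (1 + B ^ 2) := by nlinarith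
  calc 1 / 104976 * (R * B * (R + B) / ((1 + R ^ 2) * (1 + B ^ 2)))
      = R * (B / 9) * ((R + B) / 9) / ((16 * (1 + R ^ 2)) * (81 * (1 + B ^ 2))) := by
        field_simp
        norm_num
    _ ≤ a * b * (a + b) / ((1 + a ^ 2) * (1 + b ^ 2)) := by
        gcongr
        linarith

theorem one_add_sq_rpow_le {B b γ : ℝ} (hB : 0 < B) (hb1 : B / 9 ≤ b) (hγ : 0 ≤ γ) :
    (1 + b ^ 2) ^ (-(γ / 2)) ≤ 81 ^ (γ / 2) * (1 + B ^ 2) ^ (-(γ / 2)) := by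
  have e1 : (81 : ℝ) ^ (γ / 2) * (1 + B ^ 2) ^ (-(γ / 2)) =
      ((1 + B ^ 2) / 81) ^ (-(γ / 2)) := by
    rw [Real.div_rpow (by positivity) (by norm_num), Real.rpow_neg (by norm_num : (0:ℝ) ≤ 81)]
    field_simp
  rw [e1]
  exact Real.rpow_le_rpow_of_nonpos (by positivity) (by nlinarith) (by linarith)

theorem symbol_size_le {R B r a b wa wb wR wB N : ℝ} (hR : 0 < R) (hB : 0 < B) (ha1 : R ≤ a)
    (ha2 : a ≤ 4 * R) (hb1 : B / 9 ≤ b) (hb2 : b ≤ 9 * B) (hr : r ≤ 9 * (R + B))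
    (hwa0 : 0 ≤ wa) (hwb0 : 0 ≤ wb) (hwa : wa ≤ wR) (hwb : wb ≤ N * wB) :
    r * a * b * (wa * wb) ≤ 324 * N * ((R + B) * R * B * (wR * wB)) := by
  have ha : 0 < a := by linarith
  have hb : 0 < b := by linarith
  have hwR0 : 0 ≤ wR := hwa0.trans hwa
  calc r * a * b * (wa * wb)
      ≤ (9 * (R + B)) * (4 * R) * (9 * B) * (wR * (N * wB)) := by gcongr
    _ = 324 * N * ((R + B) * R * B * (wR * wB)) := by ring

/-- The bounds by the phase `F` turn into bounds by its lower bound `G`. The factor `576 = 48 * 12`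
is the ratio of the coefficients of `κ` in `interpolation_bound_piece`. -/
theorem symbol_bounds {C₁ C₂ S Q F G κ κ₀ v d m w : ℝ} (hC₁ : 0 ≤ C₁) (hC₂ : 1 ≤ C₂)
    (hG0 : 0 < G) (hG : G ≤ F) (hm : m * w ≤ Q) (hmw : 0 ≤ m * w) (hκ : κ ≤ 576 * κ₀)
    (hκ₀ : 0 ≤ κ₀)
    (hS : S = C₁ * (m / F * w)) (hv : v ≤ S) (hd : d ≤ S * (C₂ * κ / F)) :
    v ≤ C₁ * C₂ * 576 * Q / G ∧ d ≤ C₁ * C₂ * 576 * Q * κ₀ / G ^ 2 := by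
  have hF0 : 0 < F := hG0.trans_le hG
  have hQ0 : 0 ≤ Q := hmw.trans hm
  have hS0 : 0 ≤ S := by
    rw [hS, div_mul_eq_mul_div]
    positivity
  have hSQ : S ≤ C₁ * (Q / F) := by
    rw [hS, div_mul_eq_mul_div]
    gcongr
  have h1 : C₁ * Q ≤ C₁ * C₂ * 576 * Q := by nlinarith [mul_nonneg hC₁ hQ0]
  constructor
  · calc v ≤ C₁ * (Q / F) := hv.trans hSQ
      _ = C₁ * Q / F := by ring
      _ ≤ C₁ * C₂ * 576 * Q / G := by gcongr
  · calc d ≤ S * (C₂ * κ / F) := hd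
      _ ≤ S * (C₂ * (576 * κ₀) / F) := by gcongr
      _ ≤ C₁ * (Q / F) * (C₂ * (576 * κ₀) / F) := by gcongr
      _ = C₁ * C₂ * 576 * Q * κ₀ / F ^ 2 := by field_simp
      _ ≤ C₁ * C₂ * 576 * Q * κ₀ / G ^ 2 := by gcongr

theorem rpow_half_sq_mul {t : ℝ} (ht : 0 < t) (g : ℝ) : (t ^ (-(g / 2))) ^ 2 * t = t ^ (1 - g) := by
  rw [← Real.rpow_natCast, ← Real.rpow_mul ht.le, ← Real.rpow_add_one ht.ne']
  congr 1
  push_cast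
  ring

theorem pieceBound_eq {R B : ℝ} (hR : 0 < R) (hB : 0 < B) (γ₁ γ₂ s M k : ℝ) :
    (M * ((R + B) * R * B * ((1 + R ^ 2) ^ (-(γ₁ / 2)) * (1 + B ^ 2) ^ (-(γ₂ / 2))))) ^ 2 *
      (2 * (4 * R) * k / ((1 / 48 * (B / (R * (R + B)))) *
        (1 / 629856 * (R * B * (R + B) / ((1 + R ^ 2) * (1 + B ^ 2)))))) *
      ((1 / 48 * (B / (R * (R + B)))) /
        (1 / 629856 * (R * B * (R + B) / ((1 + R ^ 2) * (1 + B ^ 2))))) ^ s =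
    M ^ 2 * (8 * k * 48 * 629856) * (13122 : ℝ) ^ s * pieceBound γ₁ γ₂ s R B := by
  have e2 : (1 / 48 * (B / (R * (R + B)))) /
        (1 / 629856 * (R * B * (R + B) / ((1 + R ^ 2) * (1 + B ^ 2)))) =
      13122 * ((1 + R ^ 2) * (1 + B ^ 2) / (R * (R + B)) ^ 2) := by
    field_simp
    norm_num
  rw [e2, Real.mul_rpow (by norm_num) (by positivity), pieceBound,
    ← rpow_half_sq_mul (by positivity) γ₁, ← rpow_half_sq_mul (by positivity) γ₂]
  generalize ((1 + R ^ 2) * (1 + B ^ 2) / (R * (R + B)) ^ 2) ^ s = T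
  generalize (1 + R ^ 2) ^ (-(γ₁ / 2)) = wa
  generalize (1 + B ^ 2) ^ (-(γ₂ / 2)) = wb
  generalize (13122 : ℝ) ^ s = U
  have hX : (1 + R ^ 2) ≠ 0 := by positivity
  have hY : (1 + B ^ 2) ≠ 0 := by positivity
  generalize (1 + R ^ 2) = X at *
  generalize (1 + B ^ 2) = Y at *
  field_simp
  ring

/-- The interpolation bound of a piece of the multiplier. Here `a` is the size of the frequency
which is localised to the scale `R`, `b` that of the other input frequency, comparable to `B`, and
`r` that of the output; `F` is the phase. The function `u` has the size of the multiplier and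
varies on the length scale `(F / (C₂ κ))^{1/2}`. -/
theorem interpolation_bound_piece {u : R3 → ℝ} {e : R3} (he : ‖e‖ = 1)
    {z R B γ₁ γ₂ s C₁ C₂ : ℝ}
    (hR : 0 < R) (hB : 0 < B) (hγ₁ : 0 ≤ γ₁) (hγ₂ : 0 ≤ γ₂) (hs0 : 0 ≤ s) (hs2 : s < 2)
    (hC₁ : 0 ≤ C₁) (hC₂ : 1 ≤ C₂)
    (h : ∀ x, u =ᶠ[𝓝 x] 0 ∨ ∃ r a b F κ : ℝ, |inner ℝ e x - z| ≤ 4 * R ∧ R ≤ a ∧ a ≤ 4 * R ∧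
      B / 9 ≤ b ∧ b ≤ 9 * B ∧ 0 ≤ r ∧ r ≤ 9 * (R + B) ∧
      1 / 48 * (B / (R * (R + B))) * perpSq e x +
        1 / 6 * (a * b * (a + b) / ((1 + a ^ 2) * (1 + b ^ 2))) ≤ F ∧
      κ ≤ 12 * (B / (R * (R + B))) ∧
      |u x| ≤ C₁ * (r * a * b / F * ((1 + a ^ 2) ^ (-(γ₁ / 2)) * (1 + b ^ 2) ^ (-(γ₂ / 2)))) ∧
      |Δ u x| ≤ C₁ * (r * a * b / F * ((1 + a ^ 2) ^ (-(γ₁ / 2)) * (1 + b ^ 2) ^ (-(γ₂ / 2)))) *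
        (C₂ * κ / F)) :
    (∫⁻ x, ‖u x‖ₑ ^ (2 : ℝ)) ^ (1 - s / 2) * (∫⁻ x, ‖Δ u x‖ₑ ^ (2 : ℝ)) ^ (s / 2) ≤
      ENNReal.ofReal ((C₁ * C₂ * 576 * (324 * 81 ^ (γ₂ / 2))) ^ 2 *
        (8 * Real.pi ^ 2 * 48 * 629856) * (13122 : ℝ) ^ s *
        pieceBound γ₁ γ₂ s R B) := by
  rw [← pieceBound_eq hR hB]
  refine interpolation_bound (u := u) (z := z) he (by positivity) (by positivity) (by positivity)
    (by positivity) hs0 hs2 fun x => ?_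
  rcases h x with hx | ⟨r, a, b, F, κ, h1, ha1, ha2, hb1, hb2, hr0, hr, hF, hκ, hu, hΔ⟩
  · exact Or.inl hx
  right
  have hperp := perpSq_nonneg he x
  have ha : 0 < a := by linarith
  have hb : 0 < b := by linarith
  have hgap := gap_ge hR hB ha1 ha2 hb1 hb2
  have hwa : (1 + a ^ 2) ^ (-(γ₁ / 2)) ≤ (1 + R ^ 2) ^ (-(γ₁ / 2)) :=
    Real.rpow_le_rpow_of_nonpos (by positivity) (by nlinarith) (by linarith)
  have hM := symbol_size_le hR hB ha1 ha2 hb1 hb2 hr (by positivity) (by positivity) hwa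
    (one_add_sq_rpow_le hB hb1 hγ₂)
  have hb := symbol_bounds (κ₀ := 1 / 48 * (B / (R * (R + B))))
    (G := 1 / 48 * (B / (R * (R + B))) * perpSq e x +
      1 / 629856 * (R * B * (R + B) / ((1 + R ^ 2) * (1 + B ^ 2)))) hC₁ hC₂ (by positivity)
    (by linarith) hM (by positivity) (by linarith) (by positivity) rfl hu hΔ
  rw [← mul_assoc (C₁ * C₂ * 576)] at hb
  exact ⟨h1, hb.1, hb.2⟩

/-! ### Summation over the dyadic scales -/

/-- The sum over the dyadic scales `R = 2^j` of the square roots of `K R^α (1 + R²)^{-β/2}`; it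
converges for `0 < α < β`. -/
noncomputable def dyadicSum (K α β : ℝ) : ℝ :=
  ∑' j : ℤ, √(K * (((2:ℝ) ^ j) ^ α * (1 + ((2:ℝ) ^ j) ^ 2) ^ (-(β / 2))))

/-- A bounded function is in `Ḣ^s` if the squares of the `Ḣ^s` norms of its pieces on the annuli
around a point `e` decay at both ends of the dyadic scales. -/
theorem hasSobolevBound_of_annuli {s : ℝ} (hs0 : 0 ≤ s) (hs : s < 3 / 2) {v : R3 → ℝ} {e : R3}
    {M K α β : ℝ} (hM : ∀ x, |v x| ≤ M) (hα : 0 < α) (hβ : α < β)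
    (hreg : ∀ R : ℝ, 0 < R → ∀ x, (fun y => v y * annulus R (‖y - e‖ ^ 2)) =ᶠ[𝓝 x] 0 ∨
      ContDiffAt ℝ 2 (fun y => v y * annulus R (‖y - e‖ ^ 2)) x)
    (hb : ∀ R : ℝ, 0 < R →
      (∫⁻ x, ‖v x * annulus R (‖x - e‖ ^ 2)‖ₑ ^ (2 : ℝ)) ^ (1 - s / 2) *
        (∫⁻ x, ‖Δ (fun y => v y * annulus R (‖y - e‖ ^ 2)) x‖ₑ ^ (2 : ℝ)) ^ (s / 2) ≤
      ENNReal.ofReal (K * (R ^ α * (1 + R ^ 2) ^ (-(β / 2))))) :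
    HasSobolevBound s (fun x => (v x : ℂ)) (ENNReal.ofReal (dyadicSum K α β)) := by
  have hR : ∀ j : ℤ, (0:ℝ) < 2 ^ j := fun j => by positivity
  have hae : ∀ᵐ x : R3, x ≠ e := by
    rw [ae_iff]
    simp
  have hsum : ∀ x : R3, x ≠ e → HasSum (fun j : ℤ => annulus ((2:ℝ) ^ j) (‖x - e‖ ^ 2)) 1 :=
    fun x hx => hasSum_annulus (pow_pos (norm_pos_iff.2 (sub_ne_zero.2 hx)) 2)
  refine hasSobolevBound_of_hasSum (u := fun j x => v x * annulus ((2:ℝ) ^ j) (‖x - e‖ ^ 2))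
    (K := M) hs0 hs (fun j => ?_) (fun j => ?_) ?_ ?_ (fun j => Real.sqrt_nonneg _)
    (summable_dyadic hα hβ K) (fun j => ?_)
  · rw [contDiff_iff_contDiffAt]
    intro x
    rcases hreg _ (hR j) x with h | h
    · exact (contDiffAt_const (c := (0:ℝ))).congr_of_eventuallyEq h
    · exact h
  · refine HasCompactSupport.intro (isCompact_closedBall e (4 * 2 ^ j)) fun x hx => ?_
    rw [Metric.mem_closedBall, dist_eq_norm, not_le] at hx
    rw [annulus_of_ge (hR j) (by gcongr), mul_zero]
  · filter_upwards [hae] with x hx t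
    rw [← Finset.mul_sum, abs_mul]
    have h0 : ∀ j : ℤ, 0 ≤ annulus ((2:ℝ) ^ j) (‖x - e‖ ^ 2) :=
      fun j => annulus_nonneg (hR j) (by positivity)
    have h1 : ∑ j ∈ t, annulus ((2:ℝ) ^ j) (‖x - e‖ ^ 2) ≤ 1 :=
      sum_le_hasSum t (fun j _ => h0 j) (hsum x hx)
    rw [abs_of_nonneg (Finset.sum_nonneg fun j _ => h0 j)]
    have := hM x
    have := abs_nonneg (v x)
    nlinarith [Finset.sum_nonneg fun j (_ : j ∈ t) => h0 j]
  · filter_upwards [hae] with x hx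
    simpa using (hsum x hx).mul_left (v x)
  · refine (hb _ (hR j)).trans (ENNReal.ofReal_le_ofReal ?_)
    by_cases hneg : 0 ≤ K * (((2:ℝ) ^ j) ^ α * (1 + ((2:ℝ) ^ j) ^ 2) ^ (-(β / 2)))
    · rw [Real.sq_sqrt hneg]
    · rw [Real.sqrt_eq_zero_of_nonpos (not_le.1 hneg).le]
      nlinarith [not_le.1 hneg]

/-! ### The pieces at fixed `η`, away from `ξ = 0` -/

theorem IsCutoff.nonneg {c A : ℝ} {χ : R3 → R3 → ℝ} (h : IsCutoff c A χ) : 0 ≤ A := by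
  have := h.bound_xi 0 (by norm_num) 0 0
  rw [pow_zero, one_mul] at this
  exact (norm_nonneg _).trans this

theorem multiplierConst_nonneg {A γ₁ γ₂ : ℝ} (hA : 0 ≤ A) : 0 ≤ multiplierConst A γ₁ γ₂ := by
  unfold multiplierConst; positivity

theorem multiplierSize_eq (γ₁ γ₂ : ℝ) (ξ η : R3) : multiplierSize γ₁ γ₂ ξ η =
    ‖ξ‖ * ‖ξ - η‖ * ‖η‖ / |Phi1 ξ η| *
      ((1 + ‖ξ - η‖ ^ 2) ^ (-(γ₁ / 2)) * (1 + ‖η‖ ^ 2) ^ (-(γ₂ / 2))) := by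
  rw [multiplierSize, one_div_bracket_rpow, one_div_bracket_rpow, mul_assoc]

theorem le_sqrt_div {t μ C κ F : ℝ} (ht : 0 < t) (hF : 0 < F) (hμ : μ = √(C * κ / F))
    (h : 9 * F ≤ C * κ * t ^ 2) : 3 / t ≤ μ := by
  rw [hμ]
  apply Real.le_sqrt_of_sq_le
  rw [div_pow, div_le_div_iff₀ (by positivity) hF]
  linarith

/-- Localisation of a symbol by two cutoffs on the same length scale. -/
theorem SymbolAt.localize {m ρ w : R3 → ℝ} {x : R3} {M S Cρ Cw μ : ℝ} (hμ : 0 ≤ μ)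
    (hm : SymbolAt m x (M * S) μ) (hρ : SymbolAt ρ x Cρ μ) (hw : SymbolAt w x Cw μ) :
    SymbolAt (fun y => m y * ρ y * w y) x (64 * M * Cρ * Cw * S) μ :=
  ((hm.mul hρ hμ).mul hw hμ).mono (le_of_eq (by ring)) hμ le_rfl

theorem mul_annulus_eventuallyEq {v : R3 → ℝ} {e x : R3} {R : ℝ} (hR : 0 < R)
    (h : ¬ (R ≤ ‖x - e‖ ∧ ‖x - e‖ ≤ 4 * R)) :
    (fun y => v y * annulus R (‖y - e‖ ^ 2)) =ᶠ[𝓝 x] 0 := by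
  have hc : Continuous fun y : R3 => ‖y - e‖ := by fun_prop
  rcases not_and_or.1 h with h | h
  · filter_upwards [hc.continuousAt.eventually_lt continuousAt_const (not_le.1 h)] with y hy
    rw [annulus_of_le hR (by gcongr)]
    simp
  · filter_upwards [continuousAt_const.eventually_lt hc.continuousAt (not_le.1 h)] with y hy
    rw [annulus_of_ge hR (by gcongr)]
    simp

theorem outer_eventuallyEq {m w : R3 → ℝ} {x : R3} {b : ℝ} (hb : 0 < b) (h : ‖x‖ < b / 4) :
    (fun y => m y * (1 - cutoff (16 / b ^ 2 * ‖y‖ ^ 2)) * w y) =ᶠ[𝓝 x] 0 := by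
  filter_upwards [continuous_norm.continuousAt.eventually_lt continuousAt_const h] with y hy
  rw [cutoff_of_le]
  · simp
  · rw [div_mul_eq_mul_div, div_le_one (by positivity)]
    have : ‖y‖ ^ 2 ≤ (b / 4) ^ 2 := by gcongr
    linarith

theorem inner_eventuallyEq {m w : R3 → ℝ} {x : R3} {b : ℝ} (hb : 0 < b) (h : b / 2 < ‖x‖) :
    (fun y => m y * cutoff (16 / b ^ 2 * ‖y‖ ^ 2) * w y) =ᶠ[𝓝 x] 0 := by
  filter_upwards [continuousAt_const.eventually_lt continuous_norm.continuousAt h] with y hy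
  rw [cutoff_of_ge]
  · simp
  · rw [div_mul_eq_mul_div, le_div_iff₀ (by positivity)]
    have : (b / 2) ^ 2 ≤ ‖y‖ ^ 2 := by gcongr
    linarith

theorem SymbolAt.abs_laplacian_le_sqrt {u : R3 → ℝ} {x : R3} {K t : ℝ} (h : SymbolAt u x K (√t))
    (ht : 0 ≤ t) : |Δ u x| ≤ K * t := by
  have := h.abs_laplacian_le
  rwa [Real.sq_sqrt ht] at this

theorem norm_relations (ξ η : R3) : ‖ξ‖ ≤ ‖ξ - η‖ + ‖η‖ ∧ ‖ξ - η‖ ≤ ‖ξ‖ + ‖η‖ ∧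
    ‖η‖ ≤ ‖ξ - η‖ + ‖ξ‖ := by
  refine ⟨by simpa using norm_add_le (ξ - η) η, norm_sub_le ξ η, ?_⟩
  have := norm_sub_le ξ (ξ - η)
  rw [sub_sub_cancel] at this
  linarith

theorem abs_phase {ξ η : R3} (h1 : η ≠ 0) (h2 : ξ ≠ η) : |Phi1 ξ η| = -Phi1 ξ η :=
  abs_of_neg (phase_neg h2 h1)

/-- At fixed `η`, the pieces on the annuli around `ξ = η` of the part of the multiplier away from
`ξ = 0`. The other input frequency is `η` itself. -/
theorem exists_left_far (A : ℝ) {γ₁ γ₂ s : ℝ} (hγ₁ : 0 ≤ γ₁) (hγ₂ : 0 ≤ γ₂) (hs0 : 0 ≤ s)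
    (hs2 : s < 2) : ∃ C : ℝ, 0 ≤ C ∧ ∀ (c : ℝ) (χ : R3 → R3 → ℝ), IsCutoff c A χ → ∀ η : R3, η ≠ 0 →
    ∀ R : ℝ, 0 < R → ∀ u : R3 → ℝ, u = (fun x => multiplier γ₁ γ₂ χ x η *
      (1 - cutoff (16 / ‖η‖ ^ 2 * ‖x‖ ^ 2)) * annulus R (‖x - η‖ ^ 2)) →
    (∀ x, u =ᶠ[𝓝 x] 0 ∨ ContDiffAt ℝ 2 u x) ∧
    (∫⁻ x, ‖u x‖ₑ ^ (2 : ℝ)) ^ (1 - s / 2) * (∫⁻ x, ‖Δ u x‖ₑ ^ (2 : ℝ)) ^ (s / 2) ≤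
      ENNReal.ofReal (C * pieceBound γ₁ γ₂ s R ‖η‖) := by
  obtain ⟨C₀, hC₀1, hC₀⟩ := exists_symbolAt_phase_left
  obtain ⟨Cc, hCc1, hCc⟩ := exists_symbolAt_cutoff
  obtain ⟨Ca, hCa1, hCa⟩ := exists_symbolAt_annulus
  refine ⟨(64 * multiplierConst A γ₁ γ₂ * (1 + Cc) * Ca * (C₀ + 180) * 576 *
    (324 * 81 ^ (γ₂ / 2))) ^ 2 * (8 * Real.pi ^ 2 * 48 * 629856) * (13122 : ℝ) ^ s, by positivity,
    fun c χ hχ η hη R hR u hu => ?_⟩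
  have hb : 0 < ‖η‖ := norm_pos_iff.2 hη
  have hMc : 0 ≤ multiplierConst A γ₁ γ₂ := multiplierConst_nonneg hχ.nonneg
  have key : ∀ x, u =ᶠ[𝓝 x] 0 ∨ (R ≤ ‖x - η‖ ∧ ‖x - η‖ ≤ 4 * R ∧ ‖η‖ / 4 ≤ ‖x‖ ∧
      SymbolAt u x (64 * multiplierConst A γ₁ γ₂ * (1 + Cc) * Ca * multiplierSize γ₁ γ₂ x η)
        (√((C₀ + 180) * (‖η‖ / (‖x‖ * ‖x - η‖)) / |Phi1 x η|))) := fun x => by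
    by_cases h1 : R ≤ ‖x - η‖ ∧ ‖x - η‖ ≤ 4 * R
    swap
    · left
      rw [hu]
      exact mul_annulus_eventuallyEq hR h1
    by_cases h2 : ‖η‖ / 4 ≤ ‖x‖
    swap
    · left
      rw [hu]
      exact outer_eventuallyEq hb (not_le.1 h2)
    right
    refine ⟨h1.1, h1.2, h2, ?_⟩
    have ha : 0 < ‖x - η‖ := hR.trans_le h1.1
    have hr : 0 < ‖x‖ := by linarith
    have hxη : x ≠ η := fun h => by simp [h] at ha
    have hx0 : x ≠ 0 := norm_pos_iff.1 hr
    have hF : 0 < |Phi1 x η| := abs_pos.2 (phase_neg hxη hη).ne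
    have hF4 := phase_upper x η
    rw [← abs_phase hη hxη] at hF4
    obtain ⟨n1, n2, n3⟩ := norm_relations x η
    have hFa : |Phi1 x η| ≤ 4 * ‖x - η‖ := hF4.trans (by gcongr; exact min_le_left _ _)
    have hFb : |Phi1 x η| ≤ 4 * ‖η‖ := hF4.trans (by gcongr; exact min_le_right _ _)
    have hμr : 3 / ‖x‖ ≤ √((C₀ + 180) * (‖η‖ / (‖x‖ * ‖x - η‖)) / |Phi1 x η|) := by
      refine le_sqrt_div hr hF rfl ?_
      have e : (C₀ + 180) * (‖η‖ / (‖x‖ * ‖x - η‖)) * ‖x‖ ^ 2 =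
        (C₀ + 180) * (‖η‖ * ‖x‖) / ‖x - η‖ := by field_simp
      rw [e, le_div_iff₀ ha]
      have : |Phi1 x η| * ‖x - η‖ ≤ 4 * ‖η‖ * (5 * ‖x‖) := by gcongr; linarith
      nlinarith [mul_pos hb hr]
    have hμa : 3 / ‖x - η‖ ≤ √((C₀ + 180) * (‖η‖ / (‖x‖ * ‖x - η‖)) / |Phi1 x η|) := by
      refine le_sqrt_div ha hF rfl ?_
      have e : (C₀ + 180) * (‖η‖ / (‖x‖ * ‖x - η‖)) * ‖x - η‖ ^ 2 =
        (C₀ + 180) * (‖η‖ * ‖x - η‖) / ‖x‖ := by field_simp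
      rw [e, le_div_iff₀ hr]
      have h3 : |Phi1 x η| * ‖x‖ ≤ |Phi1 x η| * (‖x - η‖ + ‖η‖) := by gcongr
      have h4 : |Phi1 x η| * ‖x - η‖ ≤ 4 * ‖η‖ * ‖x - η‖ := by gcongr
      have h5 : |Phi1 x η| * ‖η‖ ≤ 4 * ‖x - η‖ * ‖η‖ := by gcongr
      nlinarith [mul_pos hb ha]
    have hμ0 : √(C₀ * (‖η‖ / (‖x‖ * ‖x - η‖)) / |Phi1 x η|) ≤
        √((C₀ + 180) * (‖η‖ / (‖x‖ * ‖x - η‖)) / |Phi1 x η|) := by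
      apply Real.sqrt_le_sqrt
      gcongr
      linarith
    have s1 := symbolAt_multiplier_left hγ₁ hχ hx0 hη hxη (hC₀ x η hx0 hη hxη) hμr hμa hμ0 hγ₂
    have s2 := hCc 0 x (16 / ‖η‖ ^ 2) hx0 (by positivity)
    simp only [sub_zero] at s2
    have s2' : SymbolAt (fun y : R3 => 1 - cutoff (16 / ‖η‖ ^ 2 * ‖y‖ ^ 2)) x (1 + Cc)
        (√((C₀ + 180) * (‖η‖ / (‖x‖ * ‖x - η‖)) / |Phi1 x η|)) :=
      ((SymbolAt.const 1 (Real.sqrt_nonneg _)).mono (by simp) (Real.sqrt_nonneg _) le_rfl).sub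
        (s2.mono le_rfl (by positivity) hμr)
    have s3 := (hCa η x R hxη hR).mono le_rfl (by positivity) hμa
    rw [hu]
    exact SymbolAt.localize (Real.sqrt_nonneg _) s1 s2' s3
  refine ⟨fun x => (key x).imp_right fun h => h.2.2.2.contDiffAt, ?_⟩
  refine interpolation_bound_piece (norm_inv_norm_smul hη) (z := ‖η‖) hR hb hγ₁ hγ₂ hs0 hs2
    (by positivity) (by linarith) fun x => (key x).imp_right ?_
  rintro ⟨h1, h2, h3, hS⟩
  have ha : 0 < ‖x - η‖ := hR.trans_le h1
  have hr : 0 < ‖x‖ := by linarith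
  have hxη : x ≠ η := fun h => by simp [h] at ha
  have hF : 0 < |Phi1 x η| := abs_pos.2 (phase_neg hxη hη).ne
  obtain ⟨n1, n2, n3⟩ := norm_relations x η
  have hlow := phase_lower (ξ := x) (η := η)
  rw [← abs_phase hη hxη] at hlow
  refine ⟨‖x‖, ‖x - η‖, ‖η‖, |Phi1 x η|, ‖η‖ / (‖x‖ * ‖x - η‖), ?_, h1, h2, by linarith,
    by linarith, hr.le, by linarith, ?_, ?_, ?_, ?_⟩
  · have := abs_real_inner_le_norm ((‖η‖⁻¹ : ℝ) • η) (x - η)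
    rw [inner_sub_right, inner_inv_norm_smul_self hη, norm_inv_norm_smul hη, one_mul] at this
    exact this.trans h2
  · refine le_trans (add_le_add ?_ le_rfl) hlow
    have hp := perp_le_left (ξ := x) hη
    have hp0 := perpSq_nonneg (norm_inv_norm_smul hη) x
    have e : 1 / 48 * (‖η‖ / (R * (R + ‖η‖))) * perpSq ((‖η‖⁻¹ : ℝ) • η) x =
      1 / 48 * (‖η‖ * perpSq ((‖η‖⁻¹ : ℝ) • η) x) / (R * (R + ‖η‖)) := by ring
    rw [e, div_le_iff₀ (by positivity)]
    have hgap : 0 ≤ ‖x - η‖ + ‖η‖ - ‖x‖ := by linarith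
    have : ‖x - η‖ * (‖x - η‖ + ‖η‖) ≤ 4 * R * (4 * (R + ‖η‖)) := by gcongr; linarith
    nlinarith [mul_le_mul_of_nonneg_right this hgap]
  · rw [← mul_div_assoc, div_le_div_iff₀ (by positivity) (by positivity)]
    have : R * (R + ‖η‖) ≤ ‖x - η‖ * (12 * ‖x‖) := by gcongr; linarith
    nlinarith
  · have := hS.abs_le
    rwa [multiplierSize_eq] at this
  · have := hS.abs_laplacian_le_sqrt (by positivity)
    rwa [multiplierSize_eq] at this

/-! ### The pieces at fixed `ξ` -/

/-- At fixed `ξ` the length scale of the phase is at most that of the other factors, by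
`|Φ₁| ≤ 4 min(|ξ - η|, |η|)`. -/
theorem exists_symbolAt_multiplier_right (γ₁ γ₂ : ℝ) (hγ₁ : 0 ≤ γ₁) (hγ₂ : 0 ≤ γ₂) :
    ∃ C : ℝ, 1 ≤ C ∧ ∀ (c A : ℝ) (χ : R3 → R3 → ℝ), IsCutoff c A χ → ∀ ξ y : R3, y ≠ 0 → y ≠ ξ →
      ∀ μ : ℝ, μ = √(C * ((‖y - ξ‖ + ‖y‖) / (‖y - ξ‖ * ‖y‖)) / |Phi1 ξ y|) →
      ξ ≠ 0 → 3 / ‖y‖ ≤ μ ∧ 3 / ‖y - ξ‖ ≤ μ ∧ SymbolAt (fun y => multiplier γ₁ γ₂ χ ξ y) y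
        (multiplierConst A γ₁ γ₂ * multiplierSize γ₁ γ₂ ξ y) μ := by
  obtain ⟨C₀, hC₀1, hC₀⟩ := exists_symbolAt_phase_right
  refine ⟨C₀ + 36, by linarith, fun c A χ hχ ξ y hy hyξ μ hμ hξ => ?_⟩
  have hb : 0 < ‖y‖ := norm_pos_iff.2 hy
  have ha : 0 < ‖y - ξ‖ := norm_pos_iff.2 (sub_ne_zero.2 hyξ)
  have hF : 0 < |Phi1 ξ y| := abs_pos.2 (phase_neg hyξ.symm hy).ne
  have hF4 := phase_upper ξ y
  rw [← abs_phase hy hyξ.symm, norm_sub_rev] at hF4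
  have hFa : |Phi1 ξ y| ≤ 4 * ‖y - ξ‖ := hF4.trans (by gcongr; exact min_le_left _ _)
  have hFb : |Phi1 ξ y| ≤ 4 * ‖y‖ := hF4.trans (by gcongr; exact min_le_right _ _)
  have hμb : 3 / ‖y‖ ≤ μ := by
    refine le_sqrt_div hb hF hμ ?_
    have e : (C₀ + 36) * ((‖y - ξ‖ + ‖y‖) / (‖y - ξ‖ * ‖y‖)) * ‖y‖ ^ 2 =
      (C₀ + 36) * ((‖y - ξ‖ + ‖y‖) * ‖y‖) / ‖y - ξ‖ := by field_simp
    rw [e, le_div_iff₀ ha]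
    have h3 : |Phi1 ξ y| * ‖y - ξ‖ ≤ 4 * ‖y‖ * ‖y - ξ‖ := by gcongr
    nlinarith [mul_pos hb ha, mul_pos hb hb]
  have hμa : 3 / ‖y - ξ‖ ≤ μ := by
    refine le_sqrt_div ha hF hμ ?_
    have e : (C₀ + 36) * ((‖y - ξ‖ + ‖y‖) / (‖y - ξ‖ * ‖y‖)) * ‖y - ξ‖ ^ 2 =
      (C₀ + 36) * ((‖y - ξ‖ + ‖y‖) * ‖y - ξ‖) / ‖y‖ := by field_simp
    rw [e, le_div_iff₀ hb]
    have h3 : |Phi1 ξ y| * ‖y‖ ≤ 4 * ‖y - ξ‖ * ‖y‖ := by gcongr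
    nlinarith [mul_pos hb ha, mul_pos ha ha]
  have hμ0 : √(C₀ * ((‖y - ξ‖ + ‖y‖) / (‖y - ξ‖ * ‖y‖)) / |Phi1 ξ y|) ≤ μ := by
    rw [hμ]
    apply Real.sqrt_le_sqrt
    gcongr
    linarith
  exact ⟨hμb, hμa, symbolAt_multiplier_right hγ₁ hχ hy hyξ (hC₀ ξ y hξ hy hyξ) hμb hμa hμ0 hγ₂⟩

/-- At fixed `ξ`, the pieces on the annuli around `η = ξ` of the part of the multiplier away from
`η = 0`. The other input frequency `η` has size comparable to `R + |ξ|`, because `|η| ≥ |ξ| / 4`. -/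
theorem exists_right_far (A : ℝ) {γ₁ γ₂ s : ℝ} (hγ₁ : 0 ≤ γ₁) (hγ₂ : 0 ≤ γ₂) (hs0 : 0 ≤ s)
    (hs2 : s < 2) : ∃ C : ℝ, 0 ≤ C ∧ ∀ (c : ℝ) (χ : R3 → R3 → ℝ), IsCutoff c A χ → ∀ ξ : R3, ξ ≠ 0 →
    ∀ R : ℝ, 0 < R → ∀ u : R3 → ℝ, u = (fun y => multiplier γ₁ γ₂ χ ξ y *
      (1 - cutoff (16 / ‖ξ‖ ^ 2 * ‖y‖ ^ 2)) * annulus R (‖y - ξ‖ ^ 2)) →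
    (∀ x, u =ᶠ[𝓝 x] 0 ∨ ContDiffAt ℝ 2 u x) ∧
    (∫⁻ x, ‖u x‖ₑ ^ (2 : ℝ)) ^ (1 - s / 2) * (∫⁻ x, ‖Δ u x‖ₑ ^ (2 : ℝ)) ^ (s / 2) ≤
      ENNReal.ofReal (C * pieceBound γ₁ γ₂ s R (R + ‖ξ‖)) := by
  obtain ⟨C₀, hC₀1, hC₀⟩ := exists_symbolAt_multiplier_right γ₁ γ₂ hγ₁ hγ₂
  obtain ⟨Cc, hCc1, hCc⟩ := exists_symbolAt_cutoff
  obtain ⟨Ca, hCa1, hCa⟩ := exists_symbolAt_annulus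
  refine ⟨(64 * multiplierConst A γ₁ γ₂ * (1 + Cc) * Ca * C₀ * 576 *
    (324 * 81 ^ (γ₂ / 2))) ^ 2 * (8 * Real.pi ^ 2 * 48 * 629856) * (13122 : ℝ) ^ s, by positivity,
    fun c χ hχ ξ hξ R hR u hu => ?_⟩
  have hr : 0 < ‖ξ‖ := norm_pos_iff.2 hξ
  have hMc : 0 ≤ multiplierConst A γ₁ γ₂ := multiplierConst_nonneg hχ.nonneg
  have key : ∀ y, u =ᶠ[𝓝 y] 0 ∨ (R ≤ ‖y - ξ‖ ∧ ‖y - ξ‖ ≤ 4 * R ∧ ‖ξ‖ / 4 ≤ ‖y‖ ∧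
      SymbolAt u y (64 * multiplierConst A γ₁ γ₂ * (1 + Cc) * Ca * multiplierSize γ₁ γ₂ ξ y)
        (√(C₀ * ((‖y - ξ‖ + ‖y‖) / (‖y - ξ‖ * ‖y‖)) / |Phi1 ξ y|))) := fun y => by
    by_cases h1 : R ≤ ‖y - ξ‖ ∧ ‖y - ξ‖ ≤ 4 * R
    swap
    · left
      rw [hu]
      exact mul_annulus_eventuallyEq hR h1
    by_cases h2 : ‖ξ‖ / 4 ≤ ‖y‖
    swap
    · left
      rw [hu]
      exact outer_eventuallyEq hr (not_le.1 h2)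
    right
    refine ⟨h1.1, h1.2, h2, ?_⟩
    have ha : 0 < ‖y - ξ‖ := hR.trans_le h1.1
    have hb : 0 < ‖y‖ := by linarith
    have hyξ : y ≠ ξ := fun h => by simp [h] at ha
    have hy0 : y ≠ 0 := norm_pos_iff.1 hb
    obtain ⟨hμb, hμa, s1⟩ := hC₀ c A χ hχ ξ y hy0 hyξ _ rfl hξ
    have s2 := hCc 0 y (16 / ‖ξ‖ ^ 2) hy0 (by positivity)
    simp only [sub_zero] at s2
    have s2' := ((SymbolAt.const (x := y) 1 (Real.sqrt_nonneg _)).mono (L := 1) (by simp)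
      (Real.sqrt_nonneg _) le_rfl).sub (s2.mono le_rfl (by positivity) hμb)
    have s3 := (hCa ξ y R hyξ hR).mono le_rfl (by positivity) hμa
    rw [hu]
    exact SymbolAt.localize (Real.sqrt_nonneg _) s1 s2' s3
  refine ⟨fun x => (key x).imp_right fun h => h.2.2.2.contDiffAt, ?_⟩
  refine interpolation_bound_piece (norm_inv_norm_smul hξ) (z := ‖ξ‖) hR (by positivity) hγ₁ hγ₂
    hs0 hs2 (by positivity) hC₀1 fun y => (key y).imp_right ?_
  rintro ⟨h1, h2, h3, hS⟩
  have ha : 0 < ‖y - ξ‖ := hR.trans_le h1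
  have hb : 0 < ‖y‖ := by linarith
  have hyξ : y ≠ ξ := fun h => by simp [h] at ha
  have hy0 : y ≠ 0 := norm_pos_iff.1 hb
  have hF : 0 < |Phi1 ξ y| := abs_pos.2 (phase_neg hyξ.symm hy0).ne
  obtain ⟨n1, n2, n3⟩ := norm_relations ξ y
  have hlow := phase_lower (ξ := ξ) (η := y)
  rw [← abs_phase hy0 hyξ.symm] at hlow
  rw [norm_sub_rev ξ y] at n1 n2 n3 hlow
  have hsize := multiplierSize_eq γ₁ γ₂ ξ y
  rw [norm_sub_rev ξ y] at hsize
  refine ⟨‖ξ‖, ‖y - ξ‖, ‖y‖, |Phi1 ξ y|, (‖y - ξ‖ + ‖y‖) / (‖y - ξ‖ * ‖y‖), ?_, h1, h2,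
    by linarith, by linarith, hr.le, by linarith, ?_, ?_, ?_, ?_⟩
  · have := abs_real_inner_le_norm ((‖ξ‖⁻¹ : ℝ) • ξ) (y - ξ)
    rw [inner_sub_right, inner_inv_norm_smul_self hξ, norm_inv_norm_smul hξ, one_mul] at this
    exact this.trans h2
  · refine le_trans (add_le_add ?_ le_rfl) hlow
    have hp := (perp_le_right hξ y).1
    have hp0 := perpSq_nonneg (norm_inv_norm_smul hξ) y
    have hgap : 0 ≤ ‖y - ξ‖ + ‖y‖ - ‖ξ‖ := by linarith
    have hk : (R + ‖ξ‖) / (R * (R + (R + ‖ξ‖))) ≤ 1 / R := by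
      rw [div_le_div_iff₀ (by positivity) hR]
      nlinarith
    calc _ ≤ 1 / 48 * (1 / R) * (2 * (4 * R) * (‖y - ξ‖ + ‖y‖ - ‖ξ‖)) := by
          gcongr
          exact hp.trans (by gcongr)
      _ = 1 / 6 * (‖y - ξ‖ + ‖y‖ - ‖ξ‖) := by field_simp; ring
      _ ≤ _ := by linarith
  · have e1 : (‖y - ξ‖ + ‖y‖) / (‖y - ξ‖ * ‖y‖) = 1 / ‖y - ξ‖ + 1 / ‖y‖ := by
      field_simp
      ring
    have e2 : 1 / ‖y - ξ‖ ≤ 1 / R := by gcongr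
    have e3 : 1 / ‖y‖ ≤ 5 / R := by
      rw [div_le_div_iff₀ hb hR]
      linarith
    have e4 : 1 / R / 2 ≤ (R + ‖ξ‖) / (R * (R + (R + ‖ξ‖))) := by
      rw [div_div, div_le_div_iff₀ (by positivity) (by positivity)]
      nlinarith
    have e5 : 5 / R = 5 * (1 / R) := by ring
    rw [e1]
    linarith
  · have := hS.abs_le
    rwa [hsize] at this
  · have := hS.abs_laplacian_le_sqrt (by positivity)
    rwa [hsize] at this

/-- At fixed `ξ`, the pieces on the annuli around `η = 0` of the part of the multiplier near `η =
0`. The localised frequency is `η` and the other one is `ξ - η`, of size comparable to `R + |ξ|`;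
so the two decay exponents change places. -/
theorem exists_right_near (A : ℝ) {γ₁ γ₂ s : ℝ} (hγ₁ : 0 ≤ γ₁) (hγ₂ : 0 ≤ γ₂) (hs0 : 0 ≤ s)
    (hs2 : s < 2) : ∃ C : ℝ, 0 ≤ C ∧ ∀ (c : ℝ) (χ : R3 → R3 → ℝ), IsCutoff c A χ → ∀ ξ : R3, ξ ≠ 0 →
    ∀ R : ℝ, 0 < R → ∀ u : R3 → ℝ, u = (fun y => multiplier γ₁ γ₂ χ ξ y *
      cutoff (16 / ‖ξ‖ ^ 2 * ‖y‖ ^ 2) * annulus R (‖y - 0‖ ^ 2)) →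
    (∀ x, u =ᶠ[𝓝 x] 0 ∨ ContDiffAt ℝ 2 u x) ∧
    (∫⁻ x, ‖u x‖ₑ ^ (2 : ℝ)) ^ (1 - s / 2) * (∫⁻ x, ‖Δ u x‖ₑ ^ (2 : ℝ)) ^ (s / 2) ≤
      ENNReal.ofReal (C * pieceBound γ₂ γ₁ s R (R + ‖ξ‖)) := by
  obtain ⟨C₀, hC₀1, hC₀⟩ := exists_symbolAt_multiplier_right γ₁ γ₂ hγ₁ hγ₂
  obtain ⟨Cc, hCc1, hCc⟩ := exists_symbolAt_cutoff
  obtain ⟨Ca, hCa1, hCa⟩ := exists_symbolAt_annulus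
  refine ⟨(64 * multiplierConst A γ₁ γ₂ * Cc * Ca * C₀ * 576 *
    (324 * 81 ^ (γ₁ / 2))) ^ 2 * (8 * Real.pi ^ 2 * 48 * 629856) * (13122 : ℝ) ^ s, by positivity,
    fun c χ hχ ξ hξ R hR u hu => ?_⟩
  have hr : 0 < ‖ξ‖ := norm_pos_iff.2 hξ
  have hMc : 0 ≤ multiplierConst A γ₁ γ₂ := multiplierConst_nonneg hχ.nonneg
  have key : ∀ y, u =ᶠ[𝓝 y] 0 ∨ (R ≤ ‖y‖ ∧ ‖y‖ ≤ 4 * R ∧ ‖y‖ ≤ ‖ξ‖ / 2 ∧ y ≠ ξ ∧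
      SymbolAt u y (64 * multiplierConst A γ₁ γ₂ * Cc * Ca * multiplierSize γ₁ γ₂ ξ y)
        (√(C₀ * ((‖y - ξ‖ + ‖y‖) / (‖y - ξ‖ * ‖y‖)) / |Phi1 ξ y|))) := fun y => by
    by_cases h1 : R ≤ ‖y‖ ∧ ‖y‖ ≤ 4 * R
    swap
    · left
      rw [hu]
      exact mul_annulus_eventuallyEq hR (by rwa [sub_zero])
    by_cases h2 : ‖y‖ ≤ ‖ξ‖ / 2
    swap
    · left
      rw [hu]
      exact inner_eventuallyEq hr (not_le.1 h2)
    right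
    have hb : 0 < ‖y‖ := hR.trans_le h1.1
    have hyξ : y ≠ ξ := fun h => by rw [h] at h2; linarith
    refine ⟨h1.1, h1.2, h2, hyξ, ?_⟩
    have hy0 : y ≠ 0 := norm_pos_iff.1 hb
    obtain ⟨hμb, hμa, s1⟩ := hC₀ c A χ hχ ξ y hy0 hyξ _ rfl hξ
    have s2 := hCc 0 y (16 / ‖ξ‖ ^ 2) hy0 (by positivity)
    have s3 := hCa 0 y R hy0 hR
    simp only [sub_zero] at s2 s3
    rw [hu]
    simp only [sub_zero]
    exact SymbolAt.localize (Real.sqrt_nonneg _) s1 (s2.mono le_rfl (by positivity) hμb)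
      (s3.mono le_rfl (by positivity) hμb)
  refine ⟨fun x => (key x).imp_right fun h => h.2.2.2.2.contDiffAt, ?_⟩
  refine interpolation_bound_piece (norm_inv_norm_smul hξ) (z := 0) hR (by positivity) hγ₂ hγ₁
    hs0 hs2 (by positivity) hC₀1 fun y => (key y).imp_right ?_
  rintro ⟨h1, h2, h3, hyξ, hS⟩
  have hb : 0 < ‖y‖ := hR.trans_le h1
  have ha : 0 < ‖y - ξ‖ := norm_pos_iff.2 (sub_ne_zero.2 hyξ)
  have hy0 : y ≠ 0 := norm_pos_iff.1 hb
  have hF : 0 < |Phi1 ξ y| := abs_pos.2 (phase_neg hyξ.symm hy0).ne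
  obtain ⟨n1, n2, n3⟩ := norm_relations ξ y
  have hlow := phase_lower (ξ := ξ) (η := y)
  rw [← abs_phase hy0 hyξ.symm] at hlow
  rw [norm_sub_rev ξ y] at n1 n2 n3 hlow
  have hsize : multiplierSize γ₁ γ₂ ξ y = ‖ξ‖ * ‖y‖ * ‖y - ξ‖ / |Phi1 ξ y| *
      ((1 + ‖y‖ ^ 2) ^ (-(γ₂ / 2)) * (1 + ‖y - ξ‖ ^ 2) ^ (-(γ₁ / 2))) := by
    rw [multiplierSize_eq, norm_sub_rev ξ y]
    ring
  refine ⟨‖ξ‖, ‖y‖, ‖y - ξ‖, |Phi1 ξ y|, (‖y - ξ‖ + ‖y‖) / (‖y - ξ‖ * ‖y‖), ?_, h1, h2,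
    by linarith, by linarith, hr.le, by linarith, ?_, ?_, ?_, ?_⟩
  · have := abs_real_inner_le_norm ((‖ξ‖⁻¹ : ℝ) • ξ) y
    rw [norm_inv_norm_smul hξ, one_mul] at this
    rw [sub_zero]
    exact this.trans h2
  · have e : ‖y‖ * ‖y - ξ‖ * (‖y‖ + ‖y - ξ‖) / ((1 + ‖y‖ ^ 2) * (1 + ‖y - ξ‖ ^ 2)) =
        ‖y - ξ‖ * ‖y‖ * (‖y - ξ‖ + ‖y‖) / ((1 + ‖y - ξ‖ ^ 2) * (1 + ‖y‖ ^ 2)) := by ring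
    rw [e]
    refine le_trans (add_le_add ?_ le_rfl) hlow
    have hp := (perp_le_right hξ y).2
    have hp0 := perpSq_nonneg (norm_inv_norm_smul hξ) y
    have hgap : 0 ≤ ‖y - ξ‖ + ‖y‖ - ‖ξ‖ := by linarith
    have hk : (R + ‖ξ‖) / (R * (R + (R + ‖ξ‖))) ≤ 1 / R := by
      rw [div_le_div_iff₀ (by positivity) hR]
      nlinarith
    calc _ ≤ 1 / 48 * (1 / R) * (2 * (4 * R) * (‖y - ξ‖ + ‖y‖ - ‖ξ‖)) := by
          gcongr
          exact hp.trans (by gcongr)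
      _ = 1 / 6 * (‖y - ξ‖ + ‖y‖ - ‖ξ‖) := by field_simp; ring
      _ ≤ _ := by linarith
  · have e1 : (‖y - ξ‖ + ‖y‖) / (‖y - ξ‖ * ‖y‖) = 1 / ‖y - ξ‖ + 1 / ‖y‖ := by
      field_simp
      ring
    have e2 : 1 / ‖y‖ ≤ 1 / R := by gcongr
    have e3 : 1 / ‖y - ξ‖ ≤ 1 / R := by
      gcongr
      linarith
    have e4 : 1 / R / 2 ≤ (R + ‖ξ‖) / (R * (R + (R + ‖ξ‖))) := by
      rw [div_div, div_le_div_iff₀ (by positivity) (by positivity)]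
      nlinarith
    have e5 : 0 < 1 / R := by positivity
    rw [e1]
    linarith
  · have := hS.abs_le
    rwa [hsize] at this
  · have := hS.abs_laplacian_le_sqrt (by positivity)
    rwa [hsize] at this

/-! ### The pieces at fixed `η`, near `ξ = 0` -/

/-- The size of the multiplier for `|ξ| ≤ |η| / 2`: the factor `|η|` is absorbed by the decay, of
total order at least four, in the two input frequencies. -/
theorem size_le_near {R r a b F γ₁ γ₂ : ℝ} (hR : 0 < R) (hγ₁ : 0 ≤ γ₁)
    (hγ : 4 ≤ γ₁ + γ₂) (hr1 : R ≤ r) (hr2 : r ≤ 4 * R) (hb : 2 * r ≤ b) (ha : b / 2 ≤ a)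
    (hF : 2 / 3 * a ≤ F) :
    r * a * b / F * ((1 + a ^ 2) ^ (-(γ₁ / 2)) * (1 + b ^ 2) ^ (-(γ₂ / 2))) ≤
      6 * 4 ^ (γ₁ / 2) * (R * (1 + R ^ 2) ^ (-(3 / 2) : ℝ)) := by
  have hb0 : 0 < b := by linarith
  have ha0 : 0 < a := by linarith
  have hF0 : 0 < F := by linarith
  have h1 : r * a * b / F ≤ 6 * R * b := by
    rw [div_le_iff₀ hF0]
    calc r * a * b ≤ 4 * R * a * b := by gcongr
      _ = 6 * R * b * (2 / 3 * a) := by ring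
      _ ≤ 6 * R * b * F := by gcongr
  have h2 : (1 + a ^ 2) ^ (-(γ₁ / 2)) ≤ 4 ^ (γ₁ / 2) * (1 + b ^ 2) ^ (-(γ₁ / 2)) := by
    have e1 : (4 : ℝ) ^ (γ₁ / 2) * (1 + b ^ 2) ^ (-(γ₁ / 2)) =
        ((1 + b ^ 2) / 4) ^ (-(γ₁ / 2)) := by
      rw [Real.div_rpow (by positivity) (by norm_num), Real.rpow_neg (by norm_num : (0:ℝ) ≤ 4)]
      field_simp
    rw [e1]
    exact Real.rpow_le_rpow_of_nonpos (by positivity) (by nlinarith) (by linarith)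
  have h3 : b ≤ (1 + b ^ 2) ^ (1 / 2 : ℝ) := by
    rw [← Real.sqrt_eq_rpow]
    exact Real.le_sqrt_of_sq_le (by linarith)
  calc _ ≤ 6 * R * (1 + b ^ 2) ^ (1 / 2 : ℝ) *
        (4 ^ (γ₁ / 2) * (1 + b ^ 2) ^ (-(γ₁ / 2)) * (1 + b ^ 2) ^ (-(γ₂ / 2))) := by
        gcongr
        exact h1.trans (by gcongr)
    _ = 6 * 4 ^ (γ₁ / 2) * (R * ((1 + b ^ 2) ^ (1 / 2 : ℝ) *
        (1 + b ^ 2) ^ (-(γ₁ / 2)) * (1 + b ^ 2) ^ (-(γ₂ / 2)))) := by ring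
    _ = 6 * 4 ^ (γ₁ / 2) * (R * (1 + b ^ 2) ^ (1 / 2 + -(γ₁ / 2) + -(γ₂ / 2))) := by
        rw [← Real.rpow_add (by positivity), ← Real.rpow_add (by positivity)]
    _ ≤ 6 * 4 ^ (γ₁ / 2) * (R * (1 + b ^ 2) ^ (-(3 / 2) : ℝ)) := by
        gcongr
        · nlinarith
        · linarith
    _ ≤ _ := by
        gcongr 6 * 4 ^ (γ₁ / 2) * (R * ?_)
        exact Real.rpow_le_rpow_of_nonpos (by positivity) (by nlinarith) (by norm_num)

/-- At fixed `η`, the pieces on the annuli around `ξ = 0` of the part of the multiplier near `ξ =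
0`. There the phase is comparable to `|η|` and the multiplier varies on the length scale `|ξ|`. -/
theorem exists_left_near (A : ℝ) {γ₁ γ₂ s : ℝ} (hγ₁ : 0 ≤ γ₁) (hγ₂ : 0 ≤ γ₂) (hγ : 4 ≤ γ₁ + γ₂)
    (hs0 : 0 ≤ s) (hs2 : s < 2) :
    ∃ C : ℝ, 0 ≤ C ∧ ∀ (c : ℝ) (χ : R3 → R3 → ℝ), IsCutoff c A χ → ∀ η : R3, η ≠ 0 →
    ∀ R : ℝ, 0 < R → ∀ u : R3 → ℝ, u = (fun x => multiplier γ₁ γ₂ χ x η *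
      cutoff (16 / ‖η‖ ^ 2 * ‖x‖ ^ 2) * annulus R (‖x - 0‖ ^ 2)) →
    (∀ x, u =ᶠ[𝓝 x] 0 ∨ ContDiffAt ℝ 2 u x) ∧
    (∫⁻ x, ‖u x‖ₑ ^ (2 : ℝ)) ^ (1 - s / 2) * (∫⁻ x, ‖Δ u x‖ₑ ^ (2 : ℝ)) ^ (s / 2) ≤
      ENNReal.ofReal (C * (R ^ (5 - 2 * s) * (1 + R ^ 2) ^ (-(6 / 2) : ℝ))) := by
  obtain ⟨C₀, hC₀1, hC₀⟩ := exists_symbolAt_phase_left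
  obtain ⟨Cc, hCc1, hCc⟩ := exists_symbolAt_cutoff
  obtain ⟨Ca, hCa1, hCa⟩ := exists_symbolAt_annulus
  refine ⟨(17 ^ 2 * (64 * multiplierConst A γ₁ γ₂ * Cc * Ca * (6 * 4 ^ (γ₁ / 2))) *
    (3 * C₀) ^ 2) ^ 2 * (8 * Real.pi ^ 2), by positivity,
    fun c χ hχ η hη R hR u hu => ?_⟩
  have hb : 0 < ‖η‖ := norm_pos_iff.2 hη
  have hMc : 0 ≤ multiplierConst A γ₁ γ₂ := multiplierConst_nonneg hχ.nonneg
  have key : ∀ x, u =ᶠ[𝓝 x] 0 ∨ (‖x‖ ≤ 4 * R ∧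
      SymbolAt u x (64 * multiplierConst A γ₁ γ₂ * Cc * Ca *
        (6 * 4 ^ (γ₁ / 2) * (R * (1 + R ^ 2) ^ (-(3 / 2) : ℝ)))) (3 * C₀ / R)) := fun x => by
    by_cases h1 : R ≤ ‖x‖ ∧ ‖x‖ ≤ 4 * R
    swap
    · left
      rw [hu]
      exact mul_annulus_eventuallyEq hR (by rwa [sub_zero])
    by_cases h2 : ‖x‖ ≤ ‖η‖ / 2
    swap
    · left
      rw [hu]
      exact inner_eventuallyEq hb (not_le.1 h2)
    right
    refine ⟨h1.2, ?_⟩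
    have hr : 0 < ‖x‖ := hR.trans_le h1.1
    have hx0 : x ≠ 0 := norm_pos_iff.1 hr
    have hxη : x ≠ η := fun h => by rw [h] at h2; linarith
    have ha : 0 < ‖x - η‖ := norm_pos_iff.2 (sub_ne_zero.2 hxη)
    have hF : 0 < |Phi1 x η| := abs_pos.2 (phase_neg hxη hη).ne
    obtain ⟨n1, n2, n3⟩ := norm_relations x η
    have hlow := phase_lower (ξ := x) (η := η)
    rw [← abs_phase hη hxη] at hlow
    have hpos : 0 ≤ 1 / 6 * (‖x - η‖ * ‖η‖ * (‖x - η‖ + ‖η‖) /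
      ((1 + ‖x - η‖ ^ 2) * (1 + ‖η‖ ^ 2))) := by positivity
    have hFa : 2 / 3 * ‖x - η‖ ≤ |Phi1 x η| := by linarith
    have hμ : 3 / ‖x‖ ≤ 3 * C₀ / R := by
      rw [div_le_div_iff₀ hr hR]
      nlinarith
    have hμa : 3 / ‖x - η‖ ≤ 3 * C₀ / R := by
      refine le_trans ?_ hμ
      gcongr
      linarith
    have hμ0 : √(C₀ * (‖η‖ / (‖x‖ * ‖x - η‖)) / |Phi1 x η|) ≤ 3 * C₀ / R := by
      rw [Real.sqrt_le_left (by positivity)]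
      calc C₀ * (‖η‖ / (‖x‖ * ‖x - η‖)) / |Phi1 x η|
          ≤ C₀ * (2 * ‖x - η‖ / (‖x‖ * ‖x - η‖)) / (2 / 3 * ‖x - η‖) := by
            gcongr
            linarith
        _ = 3 * C₀ / (‖x‖ * ‖x - η‖) := by
            field_simp
        _ ≤ (3 * C₀) ^ 2 / (R * R) := by
            gcongr
            · nlinarith
            · linarith
            · linarith
        _ = (3 * C₀ / R) ^ 2 := by ring
    have hμn : 0 ≤ 3 * C₀ / R := by positivity
    have s1 := symbolAt_multiplier_left hγ₁ hχ hx0 hη hxη (hC₀ x η hx0 hη hxη) hμ hμa hμ0 hγ₂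
    have s2 := hCc 0 x (16 / ‖η‖ ^ 2) hx0 (by positivity)
    have s3 := hCa 0 x R hx0 hR
    simp only [sub_zero] at s2 s3
    rw [hu]
    simp only [sub_zero]
    refine (SymbolAt.localize hμn s1 (s2.mono le_rfl (by positivity) hμ)
      (s3.mono le_rfl (by positivity) hμ)).mono ?_ hμn le_rfl
    rw [multiplierSize_eq]
    refine mul_le_mul_of_nonneg_left ?_ (by positivity)
    exact size_le_near (r := ‖x‖) (a := ‖x - η‖) (b := ‖η‖) hR hγ₁ hγ h1.1 h1.2
      (by linarith) (by linarith) hFa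
  refine ⟨fun x => (key x).imp_right fun h => h.2.contDiffAt, ?_⟩
  have hK : 0 ≤ 64 * multiplierConst A γ₁ γ₂ * Cc * Ca * (6 * 4 ^ (γ₁ / 2)) := by positivity
  have hw : 0 < (1 + R ^ 2) ^ (-(3 / 2) : ℝ) := by positivity
  have hw2 : (1 + R ^ 2) ^ (-(6 / 2) : ℝ) = ((1 + R ^ 2) ^ (-(3 / 2) : ℝ)) ^ 2 := by
    rw [← Real.rpow_mul_natCast (by positivity)]
    norm_num
  have hRs : R ^ (5 - 2 * s) = R ^ 5 * (1 / R ^ 2) ^ s := by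
    rw [Real.rpow_sub hR, Real.rpow_mul hR.le, one_div, Real.inv_rpow (by positivity)]
    norm_cast
  rw [hRs, hw2]
  generalize (1 + R ^ 2) ^ (-(3 / 2) : ℝ) = w at *
  have hkey : ∀ x, u =ᶠ[𝓝 x] 0 ∨ (‖x‖ ≤ 4 * R ∧
      SymbolAt u x ((64 * multiplierConst A γ₁ γ₂ * Cc * Ca * (6 * 4 ^ (γ₁ / 2))) * (R * w))
        (3 * C₀ / R)) := fun x => (key x).imp_right fun h => by
    convert h using 2
    ring
  generalize 64 * multiplierConst A γ₁ γ₂ * Cc * Ca * (6 * 4 ^ (γ₁ / 2)) = M at *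
  have he := norm_inv_norm_smul hη
  -- no degeneracy in any direction: the choice `κ = 1 / R²`, `D = 1` keeps `κ |y|² + D` between
  -- `1` and `17` on the ball of radius `4 R`
  refine (interpolation_bound (u := u) (z := 0) (L := 4 * R) (κ := 1 / R ^ 2) (D := 1)
    (P := 17 ^ 2 * M * (3 * C₀) ^ 2 * (R * w)) he (by positivity)
    (by positivity) one_pos (by positivity) hs0 hs2 fun x => (hkey x).imp_right ?_).trans
    (ENNReal.ofReal_le_ofReal (le_of_eq ?_))
  · rintro ⟨h2, hS⟩
    have hin := abs_real_inner_le_norm ((‖η‖⁻¹ : ℝ) • η) x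
    rw [he, one_mul] at hin
    have hp0 := perpSq_nonneg he x
    have hG : 1 / R ^ 2 * perpSq ((‖η‖⁻¹ : ℝ) • η) x + 1 ≤ 17 := by
      have : perpSq ((‖η‖⁻¹ : ℝ) • η) x ≤ 16 * R ^ 2 := by
        rw [perpSq]
        nlinarith [sq_nonneg (inner ℝ ((‖η‖⁻¹ : ℝ) • η) x), norm_nonneg x]
      rw [one_div_mul_eq_div]
      have : perpSq ((‖η‖⁻¹ : ℝ) • η) x / R ^ 2 ≤ 16 := by
        rw [div_le_iff₀ (by positivity)]
        exact this
      linarith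
    have hC : 1 ≤ (3 * C₀) ^ 2 := by nlinarith
    have hMw : 0 ≤ M * (R * w) := by positivity
    refine ⟨by rw [sub_zero]; exact hin.trans h2, hS.abs_le.trans ?_,
      hS.abs_laplacian_le.trans ?_⟩
    · rw [le_div_iff₀ (by positivity)]
      calc M * (R * w) * (1 / R ^ 2 * perpSq ((‖η‖⁻¹ : ℝ) • η) x + 1)
          ≤ M * (R * w) * (17 ^ 2 * (3 * C₀) ^ 2) := by gcongr; linarith
        _ = _ := by ring
    · rw [le_div_iff₀ (by positivity)]
      calc M * (R * w) * (3 * C₀ / R) ^ 2 * (1 / R ^ 2 * perpSq ((‖η‖⁻¹ : ℝ) • η) x + 1) ^ 2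
          ≤ M * (R * w) * (3 * C₀ / R) ^ 2 * 17 ^ 2 := by gcongr
        _ = _ := by ring
  · rw [div_one]
    generalize (1 / R ^ 2) ^ s = T
    field_simp
    ring

/-! ### Uniform Sobolev bounds of the multiplier -/

/-- The bounds of the pieces at the scales `R` decay geometrically as `R → 0` and as `R → ∞`,
uniformly in the size `B` of the other input frequency, among the frequencies with
`c ≤ 9 (R + B)`. -/
def PieceDecay (γ₁ γ₂ s c : ℝ) : Prop :=
  ∃ K α β : ℝ, 0 < α ∧ α < β ∧ ∀ R B : ℝ, 0 < R → 0 < B → c ≤ 9 * (R + B) →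
    pieceBound γ₁ γ₂ s R B ≤ K * (R ^ α * (1 + R ^ 2) ^ (-(β / 2)))

/-- The multiplier is bounded, as decay of order two in each input frequency compensates for the
denominators in the lower bound of the phase. -/
theorem multiplierSize_le {γ₁ γ₂ : ℝ} (hγ₁ : 2 ≤ γ₁) (hγ₂ : 2 ≤ γ₂) (ξ η : R3) :
    multiplierSize γ₁ γ₂ ξ η ≤ 6 := by
  by_cases hη : η = 0
  · simp [multiplierSize, hη]
  by_cases hξη : ξ = η
  · simp [multiplierSize, hξη]
  rw [multiplierSize_eq]
  have hlow := phase_lower (ξ := ξ) (η := η)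
  rw [← abs_phase hη hξη] at hlow
  obtain ⟨n1, n2, n3⟩ := norm_relations ξ η
  have hb : 0 < ‖η‖ := norm_pos_iff.2 hη
  have ha : 0 < ‖ξ - η‖ := norm_pos_iff.2 (sub_ne_zero.2 hξη)
  have hF : 0 < |Phi1 ξ η| := abs_pos.2 (phase_neg hξη hη).ne
  have hr := norm_nonneg ξ
  generalize ‖ξ - η‖ = a at *
  generalize ‖η‖ = b at *
  generalize ‖ξ‖ = r at *
  generalize |Phi1 ξ η| = F at *
  have hdec : ∀ t γ : ℝ, 2 ≤ γ → (1 + t ^ 2) ^ (-(γ / 2)) ≤ 1 / (1 + t ^ 2) := fun t γ hγ => by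
    rw [one_div, ← Real.rpow_neg_one]
    exact Real.rpow_le_rpow_of_exponent_le (by nlinarith) (by linarith)
  have h1 : r * a * b / F ≤ 6 * ((1 + a ^ 2) * (1 + b ^ 2)) := by
    rw [div_le_iff₀ hF]
    have h2 : a * b * (a + b) ≤ 6 * F * ((1 + a ^ 2) * (1 + b ^ 2)) := by
      rw [← div_le_iff₀ (by positivity)]
      linarith
    have h3 : r * a * b ≤ (a + b) * a * b := by gcongr
    linarith
  calc _ ≤ 6 * ((1 + a ^ 2) * (1 + b ^ 2)) * (1 / (1 + a ^ 2) * (1 / (1 + b ^ 2))) := by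
        gcongr
        exacts [hdec _ _ hγ₁, hdec _ _ hγ₂]
    _ = 6 := by field_simp

theorem abs_multiplier_le {γ₁ γ₂ c A : ℝ} (hγ₁ : 2 ≤ γ₁) (hγ₂ : 2 ≤ γ₂) {χ : R3 → R3 → ℝ}
    (hχ : IsCutoff c A χ) (ξ η : R3) : |multiplier γ₁ γ₂ χ ξ η| ≤ A * 6 := by
  have h0 := hχ.bound_xi 0 (by norm_num) ξ η
  rw [pow_zero, one_mul, norm_iteratedFDeriv_zero, Real.norm_eq_abs] at h0
  have hb1 := bracket_pos (ξ - η)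
  have hb2 := bracket_pos η
  have e : |multiplier γ₁ γ₂ χ ξ η| = |χ ξ η| * multiplierSize γ₁ γ₂ ξ η := by
    rw [multiplier, multiplierSize]
    simp only [abs_mul, abs_norm, abs_inv]
    rw [abs_of_nonneg (a := 1 / bracket (ξ - η) ^ γ₁) (by positivity),
      abs_of_nonneg (a := 1 / bracket η ^ γ₂) (by positivity)]
    ring
  rw [e]
  have hs : 0 ≤ multiplierSize γ₁ γ₂ ξ η := by unfold multiplierSize; positivity
  exact mul_le_mul h0 (multiplierSize_le hγ₁ hγ₂ ξ η) hs hχ.nonneg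

theorem abs_mul_le_of_mem {m t M : ℝ} (hm : |m| ≤ M) (h0 : 0 ≤ t) (h1 : t ≤ 1) :
    |m * t| ≤ M := by
  rw [abs_mul, abs_of_nonneg h0]
  have := abs_nonneg m
  nlinarith

theorem interpolation_of_zero {u : R3 → ℝ} (hu : ∀ x, u x = 0) {s : ℝ} (hs2 : s < 2) (N : ℝ≥0∞) :
    (∫⁻ x, ‖u x‖ₑ ^ (2 : ℝ)) ^ (1 - s / 2) * (∫⁻ x, ‖Δ u x‖ₑ ^ (2 : ℝ)) ^ (s / 2) ≤ N := by
  have : ∫⁻ x, ‖u x‖ₑ ^ (2 : ℝ) = 0 := by simp [hu]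
  rw [this, ENNReal.zero_rpow_of_pos (by linarith), zero_mul]
  exact zero_le

theorem annulus_eq_zero_of_not {R t : ℝ} (hR : 0 < R) (h : ¬ t ≤ 4 * R) :
    annulus R (t ^ 2) = 0 :=
  annulus_of_ge hR (by gcongr; exact (not_le.1 h).le)

theorem IsCutoff.multiplier_eq_zero {γ₁ γ₂ c A : ℝ} {χ : R3 → R3 → ℝ} (hχ : IsCutoff c A χ)
    {ξ η : R3} (h : max ‖ξ‖ (max ‖ξ - η‖ ‖η‖) < c) : multiplier γ₁ γ₂ χ ξ η = 0 := by
  have : χ ξ η = 0 := by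
    by_contra h0
    exact absurd (hχ.support ξ η h0) (not_le.2 h)
  simp [multiplier, this]

theorem HasSobolevBound.of_add_eq {s : ℝ} {f g h : R3 → ℝ} {M N : ℝ}
    (hf : HasSobolevBound s (fun x => (f x : ℂ)) (ENNReal.ofReal M))
    (hg : HasSobolevBound s (fun x => (g x : ℂ)) (ENNReal.ofReal N)) (he : ∀ x, f x + g x = h x) :
    HasSobolevBound s (fun x => (h x : ℂ)) (ENNReal.ofReal M + ENNReal.ofReal N) := by
  have := hf.add hg
  have e : (fun x => (h x : ℂ)) = fun x => (f x : ℂ) + (g x : ℂ) := by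
    ext x
    rw [← he]
    push_cast
    rfl
  rwa [e]

theorem exists_hasSobolevBound_left {γ₁ γ₂ s c : ℝ} (A : ℝ) (hγ₁ : 2 ≤ γ₁) (hγ₂ : 2 ≤ γ₂)
    (hs0 : 0 ≤ s) (hs : s < 3 / 2) (hd : PieceDecay γ₁ γ₂ s c) :
    ∃ C : ℝ≥0, ∀ χ : R3 → R3 → ℝ, IsCutoff c A χ → ∀ η : R3, η ≠ 0 →
      HasSobolevBound s (fun ξ => (multiplier γ₁ γ₂ χ ξ η : ℂ)) C := by
  obtain ⟨K, α, β, hα, hβ, hK⟩ := hd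
  obtain ⟨C₁, hC₁0, hC₁⟩ := exists_left_near A (γ₁ := γ₁) (γ₂ := γ₂) (s := s) (by linarith)
    (by linarith) (by linarith) hs0 (by linarith)
  obtain ⟨C₂, hC₂0, hC₂⟩ := exists_left_far A (γ₁ := γ₁) (γ₂ := γ₂) (s := s) (by linarith)
    (by linarith) hs0 (by linarith)
  refine ⟨(dyadicSum C₁ (5 - 2 * s) 6).toNNReal + (dyadicSum (C₂ * K) α β).toNNReal,
    fun χ hχ η hη => ?_⟩
  have hM := fun x => abs_multiplier_le hγ₁ hγ₂ hχ x η
  have h1 := hasSobolevBound_of_annuli hs0 hs (e := 0) (K := C₁) (α := 5 - 2 * s) (β := 6)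
    (fun x => abs_mul_le_of_mem (hM x) (cutoff_nonneg (16 / ‖η‖ ^ 2 * ‖x‖ ^ 2)) (cutoff_le_one _))
    (by linarith) (by linarith) (fun R hR => (hC₁ c χ hχ η hη R hR _ rfl).1)
    (fun R hR => (hC₁ c χ hχ η hη R hR _ rfl).2)
  have h2 := hasSobolevBound_of_annuli hs0 hs (e := η) (K := C₂ * K) (α := α) (β := β)
    (fun x => abs_mul_le_of_mem (hM x)
      (sub_nonneg.2 (cutoff_le_one (16 / ‖η‖ ^ 2 * ‖x‖ ^ 2)))
      (sub_le_self 1 (cutoff_nonneg _)))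
    hα hβ (fun R hR => (hC₂ c χ hχ η hη R hR _ rfl).1) (fun R hR => ?_)
  · have := h1.of_add_eq h2 (h := fun x => multiplier γ₁ γ₂ χ x η) (fun x => by ring)
    rwa [ENNReal.coe_add]
  · by_cases hc : c ≤ 9 * (R + ‖η‖)
    · refine (hC₂ c χ hχ η hη R hR _ rfl).2.trans (ENNReal.ofReal_le_ofReal ?_)
      rw [mul_assoc]
      gcongr
      exact hK R ‖η‖ hR (norm_pos_iff.2 hη) hc
    · refine interpolation_of_zero (fun x => ?_) (by linarith) _
      by_cases hx : ‖x - η‖ ≤ 4 * R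
      · rw [hχ.multiplier_eq_zero]
        · ring
        · have := norm_relations x η
          have := norm_nonneg η
          rw [max_lt_iff, max_lt_iff]
          refine ⟨?_, ?_, ?_⟩ <;> linarith
      · rw [annulus_eq_zero_of_not hR hx, mul_zero]

theorem exists_hasSobolevBound_right {γ₁ γ₂ s c : ℝ} (A : ℝ) (hγ₁ : 2 ≤ γ₁) (hγ₂ : 2 ≤ γ₂)
    (hs0 : 0 ≤ s) (hs : s < 3 / 2) (hd : PieceDecay γ₁ γ₂ s c) (hd' : PieceDecay γ₂ γ₁ s c) :
    ∃ C : ℝ≥0, ∀ χ : R3 → R3 → ℝ, IsCutoff c A χ → ∀ ξ : R3, ξ ≠ 0 →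
      HasSobolevBound s (fun η => (multiplier γ₁ γ₂ χ ξ η : ℂ)) C := by
  obtain ⟨K, α, β, hα, hβ, hK⟩ := hd
  obtain ⟨K', α', β', hα', hβ', hK'⟩ := hd'
  obtain ⟨C₁, hC₁0, hC₁⟩ := exists_right_near A (γ₁ := γ₁) (γ₂ := γ₂) (s := s) (by linarith)
    (by linarith) hs0 (by linarith)
  obtain ⟨C₂, hC₂0, hC₂⟩ := exists_right_far A (γ₁ := γ₁) (γ₂ := γ₂) (s := s) (by linarith)
    (by linarith) hs0 (by linarith)
  refine ⟨(dyadicSum (C₁ * K') α' β').toNNReal + (dyadicSum (C₂ * K) α β).toNNReal,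
    fun χ hχ ξ hξ => ?_⟩
  have hr : 0 < ‖ξ‖ := norm_pos_iff.2 hξ
  have hM := fun y => abs_multiplier_le hγ₁ hγ₂ hχ ξ y
  have h1 := hasSobolevBound_of_annuli hs0 hs (e := 0) (K := C₁ * K') (α := α') (β := β')
    (fun y => abs_mul_le_of_mem (hM y) (cutoff_nonneg (16 / ‖ξ‖ ^ 2 * ‖y‖ ^ 2)) (cutoff_le_one _))
    hα' hβ' (fun R hR => (hC₁ c χ hχ ξ hξ R hR _ rfl).1) (fun R hR => ?_)
  have h2 := hasSobolevBound_of_annuli hs0 hs (e := ξ) (K := C₂ * K) (α := α) (β := β)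
    (fun y => abs_mul_le_of_mem (hM y)
      (sub_nonneg.2 (cutoff_le_one (16 / ‖ξ‖ ^ 2 * ‖y‖ ^ 2)))
      (sub_le_self 1 (cutoff_nonneg _)))
    hα hβ (fun R hR => (hC₂ c χ hχ ξ hξ R hR _ rfl).1) (fun R hR => ?_)
  · have := h1.of_add_eq h2 (h := fun y => multiplier γ₁ γ₂ χ ξ y) (fun y => by ring)
    rwa [ENNReal.coe_add]
  · by_cases hc : c ≤ 9 * (R + (R + ‖ξ‖))
    · refine (hC₂ c χ hχ ξ hξ R hR _ rfl).2.trans (ENNReal.ofReal_le_ofReal ?_)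
      rw [mul_assoc]
      gcongr
      exact hK R (R + ‖ξ‖) hR (by positivity) hc
    · refine interpolation_of_zero (fun y => ?_) (by linarith) _
      by_cases hy : ‖y - ξ‖ ≤ 4 * R
      · rw [hχ.multiplier_eq_zero]
        · ring
        · have := norm_relations ξ y
          rw [norm_sub_rev] at hy
          rw [max_lt_iff, max_lt_iff]
          refine ⟨?_, ?_, ?_⟩ <;> linarith
      · rw [annulus_eq_zero_of_not hR hy, mul_zero]
  · by_cases hc : c ≤ 9 * (R + (R + ‖ξ‖))
    · refine (hC₁ c χ hχ ξ hξ R hR _ rfl).2.trans (ENNReal.ofReal_le_ofReal ?_)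
      rw [mul_assoc]
      gcongr
      exact hK' R (R + ‖ξ‖) hR (by positivity) hc
    · refine interpolation_of_zero (fun y => ?_) (by linarith) _
      by_cases hy : ‖y - 0‖ ≤ 4 * R
      · rw [hχ.multiplier_eq_zero]
        · ring
        · have := norm_relations ξ y
          rw [sub_zero] at hy
          rw [max_lt_iff, max_lt_iff]
          refine ⟨?_, ?_, ?_⟩ <;> linarith
      · rw [annulus_eq_zero_of_not hR hy, mul_zero]

theorem exists_norm_le {γ₁ γ₂ s c : ℝ} (A : ℝ) (hγ₁ : 2 ≤ γ₁) (hγ₂ : 2 ≤ γ₂)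
    (hs0 : 0 ≤ s) (hs : s < 3 / 2) (hd : PieceDecay γ₁ γ₂ s c) (hd' : PieceDecay γ₂ γ₁ s c) :
    ∃ C : ℝ≥0, ∀ χ : R3 → R3 → ℝ, IsCutoff c A χ →
      normLinftyEtaHsXi s (multiplier γ₁ γ₂ χ) + normLinftyXiHsEta s (multiplier γ₁ γ₂ χ) ≤ C := by
  obtain ⟨C₁, hC₁⟩ := exists_hasSobolevBound_left A hγ₁ hγ₂ hs0 hs hd
  obtain ⟨C₂, hC₂⟩ := exists_hasSobolevBound_right A hγ₁ hγ₂ hs0 hs hd hd'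
  have hae : ∀ᵐ x : R3, x ≠ 0 := by
    rw [ae_iff]
    simp
  refine ⟨C₁ + C₂, fun χ hχ => ?_⟩
  rw [ENNReal.coe_add]
  refine add_le_add (essSup_le_of_ae_le _ ?_) (essSup_le_of_ae_le _ ?_)
  · filter_upwards [hae] with η hη
    exact (hC₁ χ hχ η hη).homSobolevNorm_le
  · filter_upwards [hae] with ξ hξ
    exact (hC₂ χ hχ ξ hξ).homSobolevNorm_le

/-! ### Decay of the pieces for the exponents of the theorem -/

theorem pieceBound_eq_rpow {R B : ℝ} (hR : 0 < R) (hB : 0 < B) (γ₁ γ₂ s : ℝ) :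
    pieceBound γ₁ γ₂ s R B = R ^ (3 - 2 * s) * (R + B) ^ (2 - 2 * s) *
      ((1 + R ^ 2) ^ (1 - γ₁ + s) * (1 + B ^ 2) ^ (1 - γ₂ + s)) := by
  have hY : 0 < R + B := by positivity
  have e1 : ∀ t : ℝ, 0 < t → ((t ^ 2) ^ s)⁻¹ = t ^ (-(2 * s)) := fun t ht => by
    rw [Real.rpow_neg ht.le, Real.rpow_mul ht.le]
    norm_cast
  rw [pieceBound, Real.div_rpow (by positivity) (by positivity),
    Real.mul_rpow (by positivity) (by positivity), mul_pow,
    Real.mul_rpow (by positivity) (by positivity), Real.rpow_add (by positivity),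
    Real.rpow_add (by positivity), sub_eq_add_neg 3, sub_eq_add_neg 2, Real.rpow_add hR,
    Real.rpow_add hY, ← e1 R hR, ← e1 _ hY]
  norm_cast
  field_simp

theorem add_sq_le_two_mul {R B : ℝ} : (R + B) ^ 2 ≤ 2 * ((1 + R ^ 2) * (1 + B ^ 2)) := by
  nlinarith [sq_nonneg (R - B), sq_nonneg (R * B)]

/-- Both input frequencies contribute their decay to the sum `R + B`. -/
theorem add_rpow_le {R B t : ℝ} (hR : 0 < R) (hB : 0 < B) (ht : 0 ≤ t) :
    (R + B) ^ (2 * t) ≤ 2 ^ t * ((1 + R ^ 2) ^ t * (1 + B ^ 2) ^ t) := by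
  rw [← Real.mul_rpow (by positivity) (by positivity),
    ← Real.mul_rpow (by norm_num) (by positivity), Real.rpow_mul (by positivity)]
  apply Real.rpow_le_rpow (by positivity) _ ht
  exact_mod_cast add_sq_le_two_mul

theorem rpow_one_add_sq_le_one {B t : ℝ} (ht : t ≤ 0) : (1 + B ^ 2) ^ t ≤ 1 :=
  Real.rpow_le_one_of_one_le_of_nonpos (by nlinarith [sq_nonneg B]) ht

/-- With the decay exponents `2λ`, `λ > 9/8`, and `s = 5/4 - ε`. The power `2 - 2s = 2 (ε - 1/4)` of
`R + B` has either sign: a positive power is absorbed by the decay, a negative one is bounded by the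
same power of `R`. -/
theorem pieceDecay_of_nine_eighths {lam ε : ℝ} (hε : 0 < ε) (h : ε < 2 * lam - 9 / 4) :
    PieceDecay (2 * lam) (2 * lam) (5 / 4 - ε) 0 := by
  obtain ⟨g, hg⟩ : ∃ g, g = 2 * lam - 9 / 4 + ε := ⟨_, rfl⟩
  have hg2 : 2 * ε < g := by linarith
  have e1 : 1 - 2 * lam + (5 / 4 - ε) = -g := by rw [hg]; ring
  have e2 : 3 - 2 * (5 / 4 - ε) = 1 / 2 + 2 * ε := by ring
  have e3 : 2 - 2 * (5 / 4 - ε) = 2 * (ε - 1 / 4) := by ring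
  rcases le_or_gt (1 / 4) ε with hε4 | hε4
  · refine ⟨2 ^ (ε - 1 / 4), 1 / 2 + 2 * ε, 2 * (g - (ε - 1 / 4)), by linarith, by linarith,
      fun R B hR hB _ => ?_⟩
    rw [pieceBound_eq_rpow hR hB, e1, e2, e3]
    calc R ^ (1 / 2 + 2 * ε) * (R + B) ^ (2 * (ε - 1 / 4)) *
          ((1 + R ^ 2) ^ (-g) * (1 + B ^ 2) ^ (-g))
        ≤ R ^ (1 / 2 + 2 * ε) * (2 ^ (ε - 1 / 4) * ((1 + R ^ 2) ^ (ε - 1 / 4) *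
          (1 + B ^ 2) ^ (ε - 1 / 4))) * ((1 + R ^ 2) ^ (-g) * (1 + B ^ 2) ^ (-g)) := by
          gcongr
          exact add_rpow_le hR hB (by linarith)
      _ = 2 ^ (ε - 1 / 4) * (R ^ (1 / 2 + 2 * ε) * ((1 + R ^ 2) ^ (ε - 1 / 4) *
          (1 + R ^ 2) ^ (-g))) * ((1 + B ^ 2) ^ (ε - 1 / 4) * (1 + B ^ 2) ^ (-g)) := by ring
      _ = 2 ^ (ε - 1 / 4) * (R ^ (1 / 2 + 2 * ε) * (1 + R ^ 2) ^ (ε - 1 / 4 + -g)) *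
          (1 + B ^ 2) ^ (ε - 1 / 4 + -g) := by
          rw [← Real.rpow_add (by positivity), ← Real.rpow_add (by positivity)]
      _ ≤ 2 ^ (ε - 1 / 4) * (R ^ (1 / 2 + 2 * ε) * (1 + R ^ 2) ^ (ε - 1 / 4 + -g)) * 1 := by
          gcongr
          exact rpow_one_add_sq_le_one (by linarith)
      _ = _ := by
          rw [mul_one]
          congr 3
          ring
  · refine ⟨1, 4 * ε, 2 * g, by linarith, by linarith, fun R B hR hB _ => ?_⟩
    rw [pieceBound_eq_rpow hR hB, e1, e2, e3]
    calc R ^ (1 / 2 + 2 * ε) * (R + B) ^ (2 * (ε - 1 / 4)) *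
          ((1 + R ^ 2) ^ (-g) * (1 + B ^ 2) ^ (-g))
        ≤ R ^ (1 / 2 + 2 * ε) * R ^ (2 * (ε - 1 / 4)) * ((1 + R ^ 2) ^ (-g) * 1) := by
          gcongr ?_ * ?_ * (?_ * ?_)
          · exact Real.rpow_le_rpow_of_nonpos hR (by linarith) (by linarith)
          · exact rpow_one_add_sq_le_one (by linarith)
      _ = _ := by
          rw [← Real.rpow_add hR, mul_one, one_mul]
          congr 2 <;> ring

theorem sqrt_one_add_sq_le {c R Y : ℝ} (hc : 0 < c) (hR : 0 < R) (hRY : R ≤ Y) (hY : c ≤ 9 * Y) :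
    (1 + R ^ 2) ^ (1 / 2 : ℝ) ≤ (1 + 9 / c) * Y := by
  have hY0 : 0 < Y := by linarith
  rw [← Real.sqrt_eq_rpow, Real.sqrt_le_left (by positivity)]
  have h1 : 1 ≤ 9 / c * Y := by
    rw [div_mul_eq_mul_div, le_div_iff₀ hc]
    linarith
  nlinarith [mul_pos (div_pos (by norm_num : (0:ℝ) < 9) hc) hY0]

/-- With decay exponents which differ by `1/2`, and `s = 3/2 - ε`. If `R + B` is bounded below, the
missing half power of decay in one of the frequencies costs at most one factor `R + B`, which turns
the power `2 - 2s = 2ε - 1` of `R + B` into `2ε`. -/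
theorem pieceDecay_of_one {γ₁ γ₂ ε g c : ℝ} (hε : 0 < ε) (hg : 2 * ε < g) (hc : 0 < c)
    (hγ : (γ₁ = 5 / 2 - ε + g ∧ γ₂ = 5 / 2 - ε + g - 1 / 2) ∨
      (γ₂ = 5 / 2 - ε + g ∧ γ₁ = 5 / 2 - ε + g - 1 / 2)) :
    PieceDecay γ₁ γ₂ (3 / 2 - ε) c := by
  refine ⟨(1 + 9 / c) * 2 ^ ε, 2 * ε, 2 * (g - ε), by linarith, by linarith,
    fun R B hR hB hcR => ?_⟩
  have hY : 0 < R + B := by positivity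
  have e2 : 3 - 2 * (3 / 2 - ε) = 2 * ε := by ring
  have e3 : 2 - 2 * (3 / 2 - ε) = 2 * ε + (-1) := by ring
  have key : (1 + R ^ 2) ^ (1 - γ₁ + (3 / 2 - ε)) * (1 + B ^ 2) ^ (1 - γ₂ + (3 / 2 - ε)) ≤
      (1 + 9 / c) * (R + B) * ((1 + R ^ 2) ^ (-g) * (1 + B ^ 2) ^ (-g)) := by
    rcases hγ with ⟨h1, h2⟩ | ⟨h1, h2⟩
    · have e4 : 1 - γ₁ + (3 / 2 - ε) = -g := by rw [h1]; ring
      have e5 : 1 - γ₂ + (3 / 2 - ε) = 1 / 2 + -g := by rw [h2]; ring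
      rw [e4, e5, Real.rpow_add (by positivity)]
      calc _ = (1 + B ^ 2) ^ (1 / 2 : ℝ) * ((1 + R ^ 2) ^ (-g) * (1 + B ^ 2) ^ (-g)) := by ring
        _ ≤ _ := by
          refine mul_le_mul_of_nonneg_right ?_ (by positivity)
          exact sqrt_one_add_sq_le hc hB (by linarith) hcR
    · have e4 : 1 - γ₂ + (3 / 2 - ε) = -g := by rw [h1]; ring
      have e5 : 1 - γ₁ + (3 / 2 - ε) = 1 / 2 + -g := by rw [h2]; ring
      rw [e4, e5, Real.rpow_add (by positivity)]
      calc _ = (1 + R ^ 2) ^ (1 / 2 : ℝ) * ((1 + R ^ 2) ^ (-g) * (1 + B ^ 2) ^ (-g)) := by ring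
        _ ≤ _ := by
          refine mul_le_mul_of_nonneg_right ?_ (by positivity)
          exact sqrt_one_add_sq_le hc hR (by linarith) hcR
  rw [pieceBound_eq_rpow hR hB, e2, e3, Real.rpow_add hY, Real.rpow_neg_one]
  calc _ ≤ R ^ (2 * ε) * (2 ^ ε * ((1 + R ^ 2) ^ ε * (1 + B ^ 2) ^ ε) * (R + B)⁻¹) *
        ((1 + 9 / c) * (R + B) * ((1 + R ^ 2) ^ (-g) * (1 + B ^ 2) ^ (-g))) := by
        refine mul_le_mul ?_ key (by positivity) (by positivity)
        gcongr
        exact add_rpow_le hR hB hε.le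
    _ = (1 + 9 / c) * 2 ^ ε * (R ^ (2 * ε) * ((1 + R ^ 2) ^ ε * (1 + R ^ 2) ^ (-g))) *
        ((1 + B ^ 2) ^ ε * (1 + B ^ 2) ^ (-g)) := by
        field_simp
    _ = (1 + 9 / c) * 2 ^ ε * (R ^ (2 * ε) * (1 + R ^ 2) ^ (ε + -g)) *
        (1 + B ^ 2) ^ (ε + -g) := by
        rw [← Real.rpow_add (by positivity), ← Real.rpow_add (by positivity)]
    _ ≤ (1 + 9 / c) * 2 ^ ε * (R ^ (2 * ε) * (1 + R ^ 2) ^ (ε + -g)) * 1 := by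
        refine mul_le_mul_of_nonneg_left ?_ (by positivity)
        exact rpow_one_add_sq_le_one (by linarith)
    _ = _ := by
        rw [mul_one]
        congr 3
        ring

theorem M1_eq_multiplier (lam : ℝ) :
    M1 lam = multiplier (2 * lam) (2 * lam) fun _ _ => 1 := by
  ext ξ η
  simp only [M1, multiplier, div_eq_mul_inv, mul_inv]
  ring

theorem cutoff_left_mul_M1 (lam : ℝ) (χ : R3 → R3 → ℝ) :
    (fun ξ η => χ ξ η / bracket (ξ - η) ^ (1 / 2 : ℝ) * M1 lam ξ η) =
      multiplier (2 * lam + 1 / 2) (2 * lam) χ := by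
  ext ξ η
  rw [multiplier, Real.rpow_add (bracket_pos _)]
  simp only [M1, div_eq_mul_inv, mul_inv]
  ring

theorem cutoff_right_mul_M1 (lam : ℝ) (χ : R3 → R3 → ℝ) :
    (fun ξ η => χ ξ η / bracket η ^ (1 / 2 : ℝ) * M1 lam ξ η) =
      multiplier (2 * lam) (2 * lam + 1 / 2) χ := by
  ext ξ η
  rw [multiplier, Real.rpow_add (bracket_pos _)]
  simp only [M1, div_eq_mul_inv, mul_inv]
  ring

end IonEuler

open IonEuler in
theorem mainTheorem5 :
    (∀ lam ε : ℝ, 9 / 8 < lam → 0 < ε → ε ≤ 5 / 4 → ε < 2 * lam - 9 / 4 →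
      ∃ C : ℝ≥0,
        normLinftyEtaHsXi (5 / 4 - ε) (M1 lam) + normLinftyXiHsEta (5 / 4 - ε) (M1 lam) ≤ C) ∧
    (∀ lam ε c A : ℝ, 1 < lam → 0 < ε → ε ≤ 3 / 2 → ε < 2 * lam - 2 → 0 < c →
      ∃ C : ℝ≥0, ∀ χ : R3 → R3 → ℝ, IsCutoff c A χ →
        ∀ f : R3 → R3 → ℝ,
          ((f = fun ξ η => χ ξ η / bracket (ξ - η) ^ (1 / 2 : ℝ)) ∨
            (f = fun ξ η => χ ξ η / bracket η ^ (1 / 2 : ℝ))) →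
          normLinftyEtaHsXi (3 / 2 - ε) (fun ξ η => f ξ η * M1 lam ξ η) +
            normLinftyXiHsEta (3 / 2 - ε) (fun ξ η => f ξ η * M1 lam ξ η) ≤ C) := by
  constructor
  · intro lam ε hlam hε hε' h
    have hd := pieceDecay_of_nine_eighths hε h
    obtain ⟨C, hC⟩ := exists_norm_le 1 (by linarith) (by linarith) (by linarith) (by linarith) hd hd
    refine ⟨C, ?_⟩
    rw [M1_eq_multiplier]
    exact hC _ isCutoff_one
  · intro lam ε c A hlam hε hε' h hc
    have hd₁ : PieceDecay (2 * lam + 1 / 2) (2 * lam) (3 / 2 - ε) c :=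
      pieceDecay_of_one (g := 2 * lam - 2 + ε) hε (by linarith) hc
        (Or.inl ⟨by ring, by ring⟩)
    have hd₂ : PieceDecay (2 * lam) (2 * lam + 1 / 2) (3 / 2 - ε) c :=
      pieceDecay_of_one (g := 2 * lam - 2 + ε) hε (by linarith) hc
        (Or.inr ⟨by ring, by ring⟩)
    obtain ⟨C₁, hC₁⟩ := exists_norm_le A (by linarith) (by linarith) (by linarith) (by linarith)
      hd₁ hd₂
    obtain ⟨C₂, hC₂⟩ := exists_norm_le A (by linarith) (by linarith) (by linarith) (by linarith)
      hd₂ hd₁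
    refine ⟨max C₁ C₂, fun χ hχ f hf => ?_⟩
    rcases hf with rfl | rfl
    · rw [cutoff_left_mul_M1]
      exact (hC₁ χ hχ).trans (by gcongr; exact le_max_left _ _)
    · rw [cutoff_right_mul_M1]
      exact (hC₂ χ hχ).trans (by gcongr; exact le_max_right _ _)
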